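/- Write $B^1(J)=\{u\in L^2(J;\mathbb C): u'\in L^2(J),\ t\,u\in L^2(J)\}$ for an open interval $J\subset\mathbb R$. For $a\in(-1,0)$ and $\xi\in\mathbb R$ let $$V_a(\xi,t)=\begin{cases}(\xi+at)^2,& t<0,\\ (\xi+t)^2,& t>0,\end{cases}$$ let $\mathfrak h_a[\xi]=-\frac{d^2}{dt^2}+V_a(\xi,t)$ be the operator in $L^2(\mathbb R)$ with domain $\{u\in B^1(\mathbb R): -u''+V_a(\xi,\cdot)u\in L^2(\mathbb R)\}$ (derivatives in the sense of distributions on $\mathbb R$, so that $u'(0_+)=u'(0_-)$), and let $$\mu_a(\xi)=\inf_{0\ne u\in B^1(\mathbb R)}\frac{\int_{\mathbb R}\big(|u'|^2+V_a(\xi,t)|u|^2\big)\,dt}{\|u\|_{L^2(\mathbb R)}^2}.$$ For $\gamma\in\mathbb R$ let $$\Theta(\gamma)=\inf_{\xi\in\mathbb R}\ \inf_{0\neq u\in B^1(\mathbb R_+)}\frac{\int_0^\infty\big(|u'|^2+(t-\xi)^2|u|^2\big)\,dt+\gamma|u(0)|^2}{\|u\|^2_{L^2(\mathbb R_+)}}.$$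 Finally let $\sigma(x)=1$ for $x_2>0$, $\sigma(x)=a$ for $x_2<0$, $\mathbf A_0(x)=(-x_2,0)$, let $\mathcal L_a=-(\nabla-i\sigma\mathbf A_0)^2$ be the self-adjoint magnetic Hamiltonian in $L^2(\mathbb R^2)$, i.e. the operator associated with the quadratic form $u\mapsto\int_{\mathbb R^2}|(\nabla-i\sigma\mathbf A_0)u|^2dx$ on $\{u\in L^2(\mathbb R^2):(\nabla-i\sigma\mathbf A_0)u\in L^2(\mathbb R^2)\}$, and let $\beta_a=\inf\mathrm{sp}(\mathcal L_a)$. **Theorem.** Let $a\in(-1,0)$ and $\gamma=\sqrt{\frac1{2|a|(1-|a|)}}$. For every $\xi\in\mathbb R$, $\mu_a(\xi)$ is the first (smallest) eigenvalue of $\mathfrak h_a[\xi]$, and there exists $\xi<0$ such that $\mu_a(\xi)<|a|$. The function $\xi\mapsto\mu_a(\xi)$ attains a global minimum on $\mathbb R$, and $\min_{\xi\in\mathbb R}\mu_a(\xi)<|a|$; in fact $\min_{\xi\in\mathbb R}\mu_a(\xi)<|a|\,\Theta(\gamma)$. Moreover, $\beta_a$ is the greatest lower bound of the (nonempty, bounded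 below) spectrum of $\mathcal L_a$, and $$\beta_a<|a|\,\Theta(\gamma)<|a|.$$ -/

import Mathlib

open MeasureTheory Set
open scoped ContDiff

noncomputable section

namespace StepField

/-- The Hilbert space `L²(ℝ; ℂ)`. -/
abbrev L2Line : Type := Lp ℂ 2 (volume : Measure ℝ)

/-- The Hilbert space `L²(ℝ²; ℂ)`; points of the plane are pairs `(x₁, x₂)`. -/
abbrev L2Plane : Type := Lp ℂ 2 (volume : Measure (ℝ × ℝ))

/-- `v` is the weak derivative of `u` in the direction `e` on the open set `U`:
`∫ u ∂ₑφ = -∫ v φ` for all `φ ∈ C_c^∞(U; ℂ)`. Used for locally integrable `u` and `v` only. -/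
def HasWeakDerivOn {E : Type*} [NormedAddCommGroup E] [NormedSpace ℝ E] [MeasureSpace E]
    (U : Set E) (e : E) (u v : E → ℂ) : Prop :=
  ∀ φ : E → ℂ, ContDiff ℝ ∞ φ → HasCompactSupport φ → tsupport φ ⊆ U →
    ∫ x, u x * fderiv ℝ φ x e = -∫ x, v x * φ x

/-- `u ∈ B¹(J)` with weak derivative `v`, for an open interval `J`:
`u`, `u' = v` and `t u` belong to `L²(J; ℂ)`. -/
structure MemB1 (J : Set ℝ) (u v : ℝ → ℂ) : Prop where
  memLp : MemLp u 2 (volume.restrict J)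
  memLp_deriv : MemLp v 2 (volume.restrict J)
  memLp_mul : MemLp (fun t : ℝ => (t : ℂ) * u t) 2 (volume.restrict J)
  weakDeriv : HasWeakDerivOn J (1 : ℝ) u v

/-! Unbounded operators, given by their graphs -/

/-- `c` is an eigenvalue of the operator with graph `G = {(u, Tu) : u ∈ dom T}`. -/
def IsEigenvalue {H : Type*} [NormedAddCommGroup H] [NormedSpace ℂ H]
    (G : Set (H × H)) (c : ℂ) : Prop :=
  ∃ u : H, u ≠ 0 ∧ (u, c • u) ∈ G

/-- `c` is in the resolvent set of the operator `T` with graph `G`: the map `T - c : dom T → H` is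
bijective, with a bounded inverse `R`. -/
def IsResolventPoint {H : Type*} [NormedAddCommGroup H] [NormedSpace ℂ H]
    (G : Set (H × H)) (c : ℂ) : Prop :=
  ∃ R : H →L[ℂ] H, (∀ f : H, (R f, f + c • R f) ∈ G) ∧ ∀ p ∈ G, R (p.2 - c • p.1) = p.1

/-- The real part of the spectrum, `sp(T) ∩ ℝ`; it is all of `sp(T)` if `T` is self-adjoint. -/
def realSpectrum {H : Type*} [NormedAddCommGroup H] [NormedSpace ℂ H]
    (G : Set (H × H)) : Set ℝ :=
  {r : ℝ | ¬ IsResolventPoint G (r : ℂ)}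

/-! The Robin operators on the half-line -/

/-- The quotients `q[γ,ξ](u) / ‖u‖²` with
`q[γ,ξ](u) = ∫₀^∞ (|u'|² + |(t - ξ) u|²) dt + γ |u(0)|²` and `0 ≠ u ∈ B¹(ℝ₊)`.
Each class in `B¹(ℝ₊)` has a unique representative that is continuous on `[0, ∞)`; it is the one
that is used, so that `u 0` is the trace of `u` at the end point. -/
def robinQuotients (γ ξ : ℝ) : Set ℝ :=
  {r : ℝ | ∃ u v : ℝ → ℂ, MemB1 (Ioi 0) u v ∧ ContinuousOn u (Ici 0) ∧
    0 < ∫ t in Ioi (0 : ℝ), ‖u t‖ ^ 2 ∧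
    r = ((∫ t in Ioi (0 : ℝ), (‖v t‖ ^ 2 + (t - ξ) ^ 2 * ‖u t‖ ^ 2)) + γ * ‖u 0‖ ^ 2) /
      ∫ t in Ioi (0 : ℝ), ‖u t‖ ^ 2}

/-- `μ(γ, ξ)`, the bottom of the spectrum of `-d²/dt² + (t - ξ)²` on `L²(ℝ₊)` with
`u'(0) = γ u(0)`. -/
def muRobin (γ ξ : ℝ) : ℝ := sInf (robinQuotients γ ξ)

/-- `Θ(γ) = inf_ξ μ(γ, ξ)`. -/
def Theta (γ : ℝ) : ℝ := ⨅ ξ : ℝ, muRobin γ ξ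

/-! The fiber operators on the line -/

/-- The potential `V_a(ξ, t)`. -/
def V (a ξ t : ℝ) : ℝ := if t < 0 then (ξ + a * t) ^ 2 else (ξ + t) ^ 2

/-- The quotients `q_a[ξ](u) / ‖u‖²` with `q_a[ξ](u) = ∫ (|u'|² + V_a(ξ,t) |u|²) dt` and
`0 ≠ u ∈ B¹(ℝ)`. -/
def fiberQuotients (a ξ : ℝ) : Set ℝ :=
  {r : ℝ | ∃ u v : ℝ → ℂ, MemB1 univ u v ∧ 0 < ∫ t : ℝ, ‖u t‖ ^ 2 ∧
    r = (∫ t : ℝ, (‖v t‖ ^ 2 + V a ξ t * ‖u t‖ ^ 2)) / ∫ t : ℝ, ‖u t‖ ^ 2}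

/-- `μ_a(ξ)`, by the min-max principle. -/
def mu (a ξ : ℝ) : ℝ := sInf (fiberQuotients a ξ)

/-- The graph of `𝔥_a[ξ] = -d²/dt² + V_a(ξ, ·)` in `L²(ℝ)`: the pairs `(u, f)` with `u ∈ B¹(ℝ)`,
`f ∈ L²(ℝ)` and `-u'' + V_a(ξ, ·) u = f`, where `u'' = v'` is a weak derivative on all of `ℝ`, so
that `u'(0₊) = u'(0₋)`. -/
def fiberOp (a ξ : ℝ) : Set (L2Line × L2Line) :=
  {p | ∃ v : ℝ → ℂ, MemB1 univ p.1 v ∧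
    HasWeakDerivOn univ (1 : ℝ) v (fun t => (V a ξ t : ℂ) * p.1 t - p.2 t)}

/-! The magnetic Hamiltonian in the plane -/

/-- The step function `σ`, equal to `1` for `x₂ > 0` and to `a` for `x₂ < 0`. -/
def sigma (a : ℝ) (x : ℝ × ℝ) : ℝ := if 0 < x.2 then 1 else a

/-- `u` is in the magnetic Sobolev space of `σ A₀`, `A₀(x) = (-x₂, 0)`, and its magnetic gradient
`(∇ - iσA₀)u = (∂₁u + iσx₂u, ∂₂u)` is `(p, d)`, all in `L²(ℝ²)`. -/
def IsMagGrad (a : ℝ) (u p d : L2Plane) : Prop :=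
  HasWeakDerivOn univ ((1, 0) : ℝ × ℝ) u
    (fun x => p x - Complex.I * ((sigma a x * x.2 : ℝ) : ℂ) * u x) ∧
  HasWeakDerivOn univ ((0, 1) : ℝ × ℝ) u d

/-- The graph of the self-adjoint operator `𝓛_a = -(∇ - iσA₀)²` in `L²(ℝ²)`, that is, of the
operator of the closed quadratic form `u ↦ ∫ |(∇ - iσA₀)u|²`: the pairs `(u, f)` for which `u` is
in the form domain and `⟨(∇ - iσA₀)w, (∇ - iσA₀)u⟩ = ⟨w, f⟩` for all `w` in the form domain. -/
def magneticOp (a : ℝ) : Set (L2Plane × L2Plane) :=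
  {z | ∃ p d : L2Plane, IsMagGrad a z.1 p d ∧
    ∀ w q e : L2Plane, IsMagGrad a w q e → inner ℂ q p + inner ℂ e d = inner ℂ w z.2}

/-- `β_a = inf sp(𝓛_a)`. -/
def beta (a : ℝ) : ℝ := sInf (realSpectrum (magneticOp a))

end StepField

end

/-! Write `A = |a|`, `s = √A`, `g = sγ`. The heart is one strict trial estimate, `exists_mu_lt`:
`μ_a(ξ) < A Θ(γ)` for some `ξ < 0`. On `t < 0` the dilation `t ↦ -s t` turns the fiber form at `ξ =
-s x` into a multiple of the half-line form of `-d²/dt² + (t - x)²`. An almost minimizer of the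
Robin quotient placed there costs about `AΘ` times its mass, less a boundary gain `g|u(0)|²`. It is
continued to `t > 0` by `u(0) exp(-g t)`, whose explicit energy exceeds `AΘ` times its mass by at
most `(g - A/(4g))|u(0)|²` (`trial_energy_le`). The gain wins; the given value of `γ` is the one for
which `2(1 - A)g² = 1`.

An exact Robin minimizer would satisfy `ξ² = Θ + γ²`. Its existence is not needed:
`exists_robin_almost_minimizer` supplies `ξ > γ` and `ξ² ≤ Θ + γ² + 1/2`, and the slack `1/2` uses
up only half of the available gap. If `ξ` is too large, dropping an initial interval still gives an
admissible almost minimizer. The trace is not negligible against the mass because the energy is at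
least the mass minus `ξ|u(0)|²`.

The one-dimensional lower bounds that involve boundary terms come from `|u' - g u|² ≥ 0` with `g`
affine, which gives `|u'|² + (g' + g²)|u|² ≥ (g|u|²)'`. A shifted Gaussian shows `Θ(γ) < 1`. A
minimum of `μ_a` exists because `μ_a` is continuous, at least `ξ²` for `ξ ≥ 0`, and almost at least
`A` as `ξ → -∞`, while some value is below `A`.

For the spectral statements the form domain is a Hilbert space `K` with norm `‖u‖² + q(u)`. If `J`
embeds it into `L²`, the operator is `(J J*)⁻¹ - 1`. Hence `1/‖J J*‖ - 1` lies in the spectrum and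
below every Rayleigh quotient, and it is an eigenvalue if `J` is compact, as it is for the fibers.
In the plane, a fiber minimizer times a wide wave packet has quotient arbitrarily close to `μ_a(ξ)`,
so the spectrum reaches below `AΘ(γ)`. -/

namespace StepField

open Filter Topology ComplexConjugate

/-! ### Indefinite integrals: continuity, product rule, boundary terms at infinity -/

/-- `U` is an indefinite integral of `v` on the set `J`. -/
def IsPrim {E : Type*} [NormedAddCommGroup E] [NormedSpace ℝ E] (J : Set ℝ) (U v : ℝ → E) : Prop :=
  ∀ s ∈ J, ∀ t ∈ J, IntervalIntegrable v volume s t ∧ U t - U s = ∫ x in s..t, v x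

namespace IsPrim

section General

variable {E F : Type*} [NormedAddCommGroup E] [NormedSpace ℝ E] [NormedAddCommGroup F]
  [NormedSpace ℝ F] {J J' : Set ℝ} {U v : ℝ → E}

lemma mono (h : IsPrim J U v) (hJ : J' ⊆ J) : IsPrim J' U v :=
  fun s hs t ht => h s (hJ hs) t (hJ ht)

lemma map [CompleteSpace E] [CompleteSpace F] (h : IsPrim J U v) (L : E →L[ℝ] F) :
    IsPrim J (fun t => L (U t)) (fun t => L (v t)) := by
  intro s hs t ht
  obtain ⟨h1, h2⟩ := h s hs t ht
  refine ⟨⟨L.integrable_comp h1.1, L.integrable_comp h1.2⟩, ?_⟩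
  rw [L.intervalIntegral_comp_comm h1, ← h2, map_sub]

lemma continuousOn_uIcc (h : IsPrim J U v) (hJ : J.OrdConnected) {s t : ℝ} (hs : s ∈ J)
    (ht : t ∈ J) : ContinuousOn U (uIcc s t) := by
  have h1 := intervalIntegral.continuousOn_primitive_interval' (h s hs t ht).1
    (left_mem_uIcc (a := s) (b := t))
  refine (h1.add (continuousOn_const (c := U s))).congr fun x hx => ?_
  simp only [Pi.add_apply]
  rw [← (h s hs x (hJ.uIcc_subset hs ht hx)).2, sub_add_cancel]

lemma continuousOn (h : IsPrim J U v) (hJ : J.OrdConnected) : ContinuousOn U J := by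
  intro t ht
  have key : ∀ s ∈ J, ContinuousWithinAt U (J ∩ uIcc s t) t := fun s hs =>
    ((h.continuousOn_uIcc hJ hs ht) t right_mem_uIcc).mono inter_subset_right
  -- `J` may contain `t` as an end point, so the two sides are treated separately; an empty side
  -- leaves only the point `t`.
  have h1 : ContinuousWithinAt U (J ∩ Iic t) t := by
    by_cases hs : ∃ s ∈ J, s < t
    · obtain ⟨s, hs, hst⟩ := hs
      refine (key s hs).mono_of_mem_nhdsWithin ?_
      rw [uIcc_of_le hst.le]
      filter_upwards [self_mem_nhdsWithin, mem_nhdsWithin_of_mem_nhds (Ici_mem_nhds hst)]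
        with x hx hx' using ⟨hx.1, hx', hx.2⟩
    · push Not at hs
      exact continuousWithinAt_singleton.mono fun x hx => le_antisymm hx.2 (hs x hx.1)
  have h2 : ContinuousWithinAt U (J ∩ Ici t) t := by
    by_cases hs : ∃ s ∈ J, t < s
    · obtain ⟨s, hs, hst⟩ := hs
      refine (key s hs).mono_of_mem_nhdsWithin ?_
      rw [uIcc_of_ge hst.le]
      filter_upwards [self_mem_nhdsWithin, mem_nhdsWithin_of_mem_nhds (Iic_mem_nhds hst)]
        with x hx hx' using ⟨hx.1, hx.2, hx'⟩
    · push Not at hs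
      exact continuousWithinAt_singleton.mono fun x hx => le_antisymm (hs x hx.1) hx.2
  refine (h1.union h2).mono fun x hx => ?_
  rcases le_total x t with h | h
  exacts [Or.inl ⟨hx, h⟩, Or.inr ⟨hx, h⟩]

lemma of_hasDerivAt [CompleteSpace E] (hv : ContinuousOn v J) (hJ : J.OrdConnected)
    (h : ∀ t ∈ J, HasDerivAt U (v t) t) : IsPrim J U v := by
  intro s hs t ht
  have hsub : uIcc s t ⊆ J := hJ.uIcc_subset hs ht
  have hi : IntervalIntegrable v volume s t := (hv.mono hsub).intervalIntegrable
  exact ⟨hi, (intervalIntegral.integral_eq_sub_of_hasDerivAt (fun x hx => h x (hsub hx)) hi).symm⟩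

end General

lemma continuous {U v : ℝ → ℂ} (h : IsPrim univ U v) : Continuous U :=
  continuousOn_univ.mp (h.continuousOn ordConnected_univ)

end IsPrim

lemma _root_.AbsolutelyContinuousOnInterval.congr_uIcc {X : Type*} [PseudoMetricSpace X]
    {f g : ℝ → X} {a b : ℝ} (hf : AbsolutelyContinuousOnInterval f a b)
    (h : ∀ x ∈ uIcc a b, f x = g x) : AbsolutelyContinuousOnInterval g a b := by
  refine Tendsto.congr' ?_ hf
  filter_upwards [mem_inf_of_right (mem_principal_self _)] with E hE
  refine Finset.sum_congr rfl fun i hi => ?_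
  rw [h _ (hE.1 i hi).1, h _ (hE.1 i hi).2]

/-- Real and imaginary parts are treated separately, each multiplied by a constant function. -/
lemma absolutelyContinuous_integral_complex {v : ℝ → ℂ} {s t : ℝ}
    (h : IntervalIntegrable v volume s t) :
    AbsolutelyContinuousOnInterval (fun x => ∫ y in s..x, v y) s t := by
  have hre : IntervalIntegrable (fun x => (v x).re) volume s t := ⟨h.1.re, h.2.re⟩
  have him : IntervalIntegrable (fun x => (v x).im) volume s t := ⟨h.1.im, h.2.im⟩
  have hc : ∀ c : ℂ, AbsolutelyContinuousOnInterval (fun _ : ℝ => c) s t := fun c =>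
    (LipschitzWith.const c).lipschitzOnWith.absolutelyContinuousOnInterval (K := 0)
  have h1 := (hre.absolutelyContinuousOnInterval_intervalIntegral (c := s) left_mem_uIcc).smul (hc 1)
  have h2 := (him.absolutelyContinuousOnInterval_intervalIntegral (c := s) left_mem_uIcc).smul
    (hc Complex.I)
  refine AbsolutelyContinuousOnInterval.congr_uIcc (h1.add h2) fun x hx => ?_
  have hi : IntervalIntegrable v volume s x := h.mono_set (uIcc_subset_uIcc_left hx)
  have hr := Complex.reCLM.intervalIntegral_comp_comm hi
  have hm := Complex.imCLM.intervalIntegral_comp_comm hi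
  simp only [Complex.reCLM_apply, Complex.imCLM_apply] at hr hm
  simp only [Pi.add_apply, Pi.smul_apply', hr, hm]
  apply Complex.ext <;> simp

/-- Integration by parts for indefinite integrals. -/
lemma IsPrim.mul {J : Set ℝ} {U v W w : ℝ → ℂ} (hJ : J.OrdConnected) (hU : IsPrim J U v)
    (hW : IsPrim J W w) : IsPrim J (fun t => U t * W t) (fun t => v t * W t + U t * w t) := by
  intro s hs t ht
  have hcU := hU.continuousOn_uIcc hJ hs ht
  have hcW := hW.continuousOn_uIcc hJ hs ht
  obtain ⟨h1, h2⟩ := hU s hs t ht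
  obtain ⟨h3, h4⟩ := hW s hs t ht
  have hint : IntervalIntegrable (fun t => v t * W t + U t * w t) volume s t :=
    (h1.mul_continuousOn hcW).add (h3.continuousOn_mul hcU)
  refine ⟨hint, ?_⟩
  have hc : ∀ c : ℂ, AbsolutelyContinuousOnInterval (fun _ : ℝ => c) s t := fun c =>
    (LipschitzWith.const c).lipschitzOnWith.absolutelyContinuousOnInterval (K := 0)
  have hsub : uIcc s t ⊆ J := hJ.uIcc_subset hs ht
  have a1 := (absolutelyContinuous_integral_complex h1).add (hc (U s))
  have a2 := (absolutelyContinuous_integral_complex h3).add (hc (W s))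
  -- The product minus the integral of its expected derivative is absolutely continuous with
  -- derivative zero almost everywhere, hence constant.
  have a3 := (a1.smul a2).sub (absolutelyContinuous_integral_complex hint)
  obtain ⟨C, hC⟩ := a3.const_of_ae_hasDerivAt_zero (by
    filter_upwards [h1.ae_hasDerivAt_integral, h3.ae_hasDerivAt_integral,
      hint.ae_hasDerivAt_integral] with x hx1 hx2 hx3 hx
    have d1 := (hx1 hx s left_mem_uIcc).add_const (U s)
    have d2 := (hx2 hx s left_mem_uIcc).add_const (W s)
    have d3 := (d1.mul d2).sub (hx3 hx s left_mem_uIcc)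
    convert! d3 using 1
    rw [← (hU s hs x (hsub hx)).2, ← (hW s hs x (hsub hx)).2]
    ring)
  have e1 := hC s left_mem_uIcc
  have e2 := hC t right_mem_uIcc
  simp only [Pi.sub_apply, Pi.mul_apply, Pi.add_apply, smul_eq_mul, ← h2, ← h4,
    intervalIntegral.integral_same] at e1 e2
  linear_combination e2 - e1

lemma IsPrim.conj {J : Set ℝ} {U v : ℝ → ℂ} (hU : IsPrim J U v) :
    IsPrim J (fun t => conj (U t)) (fun t => conj (v t)) :=
  hU.map Complex.conjCLE.toContinuousLinearMap

lemma isPrim_affine (J : Set ℝ) (hJ : J.OrdConnected) (α β : ℝ) :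
    IsPrim J (fun t => ((α * t + β : ℝ) : ℂ)) (fun _ => (α : ℂ)) := by
  refine IsPrim.of_hasDerivAt continuousOn_const hJ fun t _ => ?_
  have h : HasDerivAt (fun t : ℝ => α * t + β) α t := by
    simpa using ((hasDerivAt_id t).const_mul α).add_const β
  exact h.ofReal_comp

/-- With `g = αt + β` this is `(g|U|²)'`; its last term is the cross term in the expansion of `|v -
gU|²`. -/
lemma IsPrim.affine_mul_norm_sq {J : Set ℝ} {U v : ℝ → ℂ} (hJ : J.OrdConnected)
    (hU : IsPrim J U v) (α β : ℝ) :
    IsPrim J (fun t => (α * t + β) * ‖U t‖ ^ 2)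
      (fun t => α * ‖U t‖ ^ 2 + 2 * (α * t + β) * (conj (U t) * v t).re) := by
  have h := ((isPrim_affine J hJ α β).mul hJ (hU.conj.mul hJ hU)).map Complex.reCLM
  have e : ∀ z : ℂ, conj z * z = ((‖z‖ ^ 2 : ℝ) : ℂ) := fun z => by
    rw [← Complex.normSq_eq_norm_sq, Complex.normSq_eq_conj_mul_self]
  convert! h using 2 with t t
  · rw [e]; simp only [Complex.reCLM_apply, ← Complex.ofReal_mul, Complex.ofReal_re]
  · rw [e]
    simp only [Complex.reCLM_apply, Complex.add_re, Complex.mul_re, Complex.ofReal_re,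
      Complex.ofReal_im, Complex.conj_re, Complex.conj_im, Complex.add_im, Complex.mul_im]
    ring

lemma norm_sub_affine_mul_sq (z w : ℂ) (g : ℝ) :
    ‖w - g * z‖ ^ 2 = ‖w‖ ^ 2 + g ^ 2 * ‖z‖ ^ 2 - 2 * g * (conj z * w).re := by
  simp only [← Complex.normSq_eq_norm_sq, Complex.normSq_apply, Complex.sub_re, Complex.sub_im,
    Complex.mul_re, Complex.mul_im, Complex.ofReal_re, Complex.ofReal_im, Complex.conj_re,
    Complex.conj_im]
  ring

/-- An integrable function with a limit at infinity has limit zero. -/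
lemma eq_zero_of_tendsto_of_integrableOn_Ioi {F : ℝ → ℝ} {s L : ℝ} (hF : Tendsto F atTop (𝓝 L))
    (hi : IntegrableOn F (Ioi s)) : L = 0 := by
  by_contra hL
  have h1 : ∀ᶠ t in atTop, ‖L‖ / 2 < ‖F t‖ :=
    hF.norm.eventually_const_lt (half_lt_self (norm_pos_iff.mpr hL))
  obtain ⟨M, hM⟩ := eventually_atTop.mp h1
  have h2 : IntegrableOn (fun _ : ℝ => ‖L‖ / 2) (Ioi (max s M)) := by
    refine Integrable.mono (hi.mono_set (Ioi_subset_Ioi (le_max_left s M)))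
      aestronglyMeasurable_const ?_
    filter_upwards [ae_restrict_mem measurableSet_Ioi] with t ht
    have := hM t ((le_max_right s M).trans (mem_Ioi.mp ht).le)
    rw [Real.norm_of_nonneg (by positivity)]
    exact this.le
  rw [integrableOn_const_iff] at h2
  simp [hL] at h2

/-- Integrability of `f` gives `F` a limit at infinity, and integrability of `F` forces that limit
to vanish. -/
lemma IsPrim.integral_Ioi {F f : ℝ → ℝ} {s : ℝ} (h : IsPrim (Ici s) F f)
    (hF : IntegrableOn F (Ioi s)) (hf : IntegrableOn f (Ioi s)) :
    ∫ t in Ioi s, f t = -F s := by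
  have h1 := intervalIntegral_tendsto_integral_Ioi s hf tendsto_id
  have h2 : Tendsto F atTop (𝓝 ((∫ t in Ioi s, f t) + F s)) := by
    refine (h1.add_const (F s)).congr' ?_
    filter_upwards [eventually_ge_atTop s] with t ht
    rw [id, ← (h s self_mem_Ici t ht).2, sub_add_cancel]
  linarith [eq_zero_of_tendsto_of_integrableOn_Ioi h2 hF]

lemma IsPrim.integral_Iic {F f : ℝ → ℝ} {s : ℝ} (h : IsPrim (Iic s) F f)
    (hF : IntegrableOn F (Iic s)) (hf : IntegrableOn f (Iic s)) :
    ∫ t in Iic s, f t = F s := by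
  have h1 := intervalIntegral_tendsto_integral_Iic s hf tendsto_id
  have h2 : Tendsto F atBot (𝓝 (F s - (∫ t in Iic s, f t))) := by
    refine ((tendsto_const_nhds (x := F s)).sub h1).congr' ?_
    filter_upwards [eventually_le_atBot s] with t ht
    rw [id, ← (h t ht s self_mem_Iic).2, sub_sub_cancel]
  have h3 : IntegrableOn (fun t => F (-t)) (Ioi (-s)) := by
    have := hF.comp_neg
    simp only [neg_Iic] at this
    exact this.mono_set Ioi_subset_Ici_self
  linarith [eq_zero_of_tendsto_of_integrableOn_Ioi (h2.comp tendsto_neg_atTop_atBot) h3]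

lemma IsPrim.integral_eq_zero {F f : ℝ → ℝ} (h : IsPrim univ F f)
    (hF : Integrable F) (hf : Integrable f) : ∫ t, f t = 0 := by
  rw [← integral_add_compl (measurableSet_Iic (a := (0 : ℝ))) hf, compl_Iic,
    (h.mono (subset_univ _)).integral_Iic hF.integrableOn hf.integrableOn,
    (h.mono (subset_univ _)).integral_Ioi hF.integrableOn hf.integrableOn]
  ring

/-! ### Energy bounds by completing the square -/

section Riccati

variable {U v : ℝ → ℂ} {s t : ℝ} (α β : ℝ)

/-- Expanding `|v - gU|² ≥ 0` with `g = αx + β` bounds `(g|U|²)'` by `|v|² + (g' + g²)|U|²`.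
Equality holds if `U' = gU`, so `g` plays the role of a logarithmic derivative. -/
lemma IsPrim.riccati_Icc {J : Set ℝ} (hJ : J.OrdConnected) (hU : IsPrim J U v) (hs : s ∈ J)
    (ht : t ∈ J) (hst : s ≤ t) (hv : IntervalIntegrable (fun x => ‖v x‖ ^ 2) volume s t) :
    (α * t + β) * ‖U t‖ ^ 2 - (α * s + β) * ‖U s‖ ^ 2 ≤
      ∫ x in s..t, (‖v x‖ ^ 2 + (α + (α * x + β) ^ 2) * ‖U x‖ ^ 2) := by
  obtain ⟨h1, h2⟩ := hU.affine_mul_norm_sq hJ α β s hs t ht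
  have hc := hU.continuousOn_uIcc hJ hs ht
  have hg : ContinuousOn (fun x => (α + (α * x + β) ^ 2) * ‖U x‖ ^ 2) (uIcc s t) := by fun_prop
  rw [h2]
  refine intervalIntegral.integral_mono_on hst h1 (hv.add hg.intervalIntegrable) fun x _ => ?_
  have := norm_sub_affine_mul_sq (U x) (v x) (α * x + β)
  nlinarith [sq_nonneg ‖v x - ((α * x + β : ℝ) : ℂ) * U x‖]

lemma integrable_affine_data {S : Set ℝ} (hu : MemLp U 2 (volume.restrict S))
    (hv : MemLp v 2 (volume.restrict S)) (htu : MemLp (fun t : ℝ => (t : ℂ) * U t) 2 (volume.restrict S)) :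
    IntegrableOn (fun x => (α * x + β) * ‖U x‖ ^ 2) S ∧
    IntegrableOn (fun x => (α * x + β) ^ 2 * ‖U x‖ ^ 2) S ∧
    IntegrableOn (fun x => α * ‖U x‖ ^ 2 + 2 * (α * x + β) * (conj (U x) * v x).re) S := by
  have i0 : IntegrableOn (fun x => ‖U x‖ ^ 2) S := hu.integrable_norm_pow two_ne_zero
  have i2 : IntegrableOn (fun x => ‖v x‖ ^ 2) S := hv.integrable_norm_pow two_ne_zero
  have hg : MemLp (fun x : ℝ => ((α * x + β : ℝ) : ℂ) * U x) 2 (volume.restrict S) := by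
    convert! (htu.const_mul (α : ℂ)).add (hu.const_mul (β : ℂ)) using 2 with x
    simp [Pi.add_apply]; ring
  have i1 : IntegrableOn (fun x => (α * x + β) ^ 2 * ‖U x‖ ^ 2) S := by
    have := hg.integrable_norm_pow two_ne_zero
    simpa only [norm_mul, mul_pow, Complex.norm_real, Real.norm_eq_abs, sq_abs] using! this
  have p1 : IntegrableOn (fun x => (α * x + β) * ‖U x‖ ^ 2) S := by
    have := (hu.star.integrable_mul hg).re
    refine this.congr (ae_of_all _ fun x => ?_)
    have : ((‖U x‖ ^ 2 : ℝ) : ℂ) = conj (U x) * U x := by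
      rw [← Complex.normSq_eq_norm_sq, Complex.normSq_eq_conj_mul_self]
    have h2 : star (U x) * (((α * x + β : ℝ) : ℂ) * U x)
      = (((α * x + β) * ‖U x‖ ^ 2 : ℝ) : ℂ) := by
      rw [Complex.ofReal_mul, this, starRingEnd_apply]; ring
    simp only [Pi.mul_apply, Pi.star_apply, h2]
    simp only [RCLike.re_to_complex, Complex.ofReal_re]
  refine ⟨p1, i1, (i0.const_mul α).add ?_⟩
  have := ((hg.star.integrable_mul hv).re).const_mul 2
  refine this.congr (ae_of_all _ fun x => ?_)
  have h2 : star (((α * x + β : ℝ) : ℂ) * U x) * v x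
      = ((α * x + β : ℝ) : ℂ) * (conj (U x) * v x) := by
    rw [star_mul', ← starRingEnd_apply, ← starRingEnd_apply, Complex.conj_ofReal]; ring
  simp only [Pi.mul_apply, Pi.star_apply, h2]
  simp only [RCLike.re_to_complex, Complex.re_ofReal_mul]
  ring

lemma riccati_mono {S : Set ℝ} (hS : MeasurableSet S) (hu : MemLp U 2 (volume.restrict S))
    (hv : MemLp v 2 (volume.restrict S)) (htu : MemLp (fun t : ℝ => (t : ℂ) * U t) 2 (volume.restrict S)) :
    ∫ x in S, (α * ‖U x‖ ^ 2 + 2 * (α * x + β) * (conj (U x) * v x).re) ≤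
      ∫ x in S, (‖v x‖ ^ 2 + (α + (α * x + β) ^ 2) * ‖U x‖ ^ 2) := by
  obtain ⟨_, i1, i2⟩ := integrable_affine_data α β hu hv htu
  have i0 : IntegrableOn (fun x => ‖U x‖ ^ 2) S := hu.integrable_norm_pow two_ne_zero
  have i3 : IntegrableOn (fun x => ‖v x‖ ^ 2) S := hv.integrable_norm_pow two_ne_zero
  refine setIntegral_mono_on i2 (i3.add ?_) hS fun x _ => ?_
  · simpa only [add_mul] using! (i0.const_mul α).add i1
  · have := norm_sub_affine_mul_sq (U x) (v x) (α * x + β)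
    nlinarith [sq_nonneg ‖v x - ((α * x + β : ℝ) : ℂ) * U x‖]

/-- On a half-line only the boundary term at the finite end point survives. -/
lemma IsPrim.riccati_Ioi (hU : IsPrim (Ici s) U v) (hu : MemLp U 2 (volume.restrict (Ioi s)))
    (hv : MemLp v 2 (volume.restrict (Ioi s)))
    (htu : MemLp (fun t : ℝ => (t : ℂ) * U t) 2 (volume.restrict (Ioi s))) :
    -((α * s + β) * ‖U s‖ ^ 2) ≤
      ∫ x in Ioi s, (‖v x‖ ^ 2 + (α + (α * x + β) ^ 2) * ‖U x‖ ^ 2) := by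
  obtain ⟨i1, _, i2⟩ := integrable_affine_data α β hu hv htu
  rw [← (hU.affine_mul_norm_sq ordConnected_Ici α β).integral_Ioi i1 i2]
  exact riccati_mono α β measurableSet_Ioi hu hv htu

lemma IsPrim.riccati_Iic (hU : IsPrim (Iic s) U v) (hu : MemLp U 2 (volume.restrict (Iic s)))
    (hv : MemLp v 2 (volume.restrict (Iic s)))
    (htu : MemLp (fun t : ℝ => (t : ℂ) * U t) 2 (volume.restrict (Iic s))) :
    (α * s + β) * ‖U s‖ ^ 2 ≤
      ∫ x in Iic s, (‖v x‖ ^ 2 + (α + (α * x + β) ^ 2) * ‖U x‖ ^ 2) := by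
  obtain ⟨i1, _, i2⟩ := integrable_affine_data α β hu hv htu
  rw [← (hU.affine_mul_norm_sq ordConnected_Iic α β).integral_Iic i1 i2]
  exact riccati_mono α β measurableSet_Iic hu hv htu

end Riccati

/-! ### Weak derivatives and indefinite integrals -/

lemma integrable_mul_of_hasCompactSupport {X : Type*} [TopologicalSpace X] [MeasurableSpace X]
    [OpensMeasurableSpace X] {μ : Measure X} {w φ : X → ℂ} (hφ : Continuous φ)
    (hc : HasCompactSupport φ) (hw : IntegrableOn w (tsupport φ) μ) :
    Integrable (fun x => w x * φ x) μ := by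
  have h1 : IntegrableOn (fun x => w x * φ x) (tsupport φ) μ := by
    obtain ⟨C, hC⟩ := hc.exists_bound_of_continuous hφ
    exact hw.mul_bdd hφ.aestronglyMeasurable (ae_of_all _ hC)
  rwa [integrableOn_iff_integrable_of_support_subset] at h1
  exact (Function.support_mul_subset_right _ _).trans (subset_tsupport φ)

lemma exists_Ioo_superset_of_isCompact {Ω K : Set ℝ} (hΩ : IsOpen Ω) (hne : Ω.Nonempty)
    (hK : IsCompact K) (hKΩ : K ⊆ Ω) : ∃ s ∈ Ω, ∃ t ∈ Ω, s < t ∧ K ⊆ Ioo s t := by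
  obtain ⟨x, hx⟩ := hne
  have hK' : IsCompact (insert x K) := hK.insert x
  have hne' : (insert x K).Nonempty := insert_nonempty x K
  have hsub : insert x K ⊆ Ω := insert_subset hx hKΩ
  obtain ⟨s, hs1, hs2⟩ := (mem_nhdsLT_iff_exists_Ioo_subset.mp
    (mem_nhdsWithin_of_mem_nhds (hΩ.mem_nhds (hsub (hK'.sInf_mem hne')))) :
      ∃ l ∈ Iio (sInf (insert x K)), Ioo l _ ⊆ Ω)
  obtain ⟨t, ht1, ht2⟩ := (mem_nhdsGT_iff_exists_Ioo_subset.mp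
    (mem_nhdsWithin_of_mem_nhds (hΩ.mem_nhds (hsub (hK'.sSup_mem hne')))) :
      ∃ l ∈ Ioi (sSup (insert x K)), Ioo _ l ⊆ Ω)
  obtain ⟨s', h1, h2⟩ := exists_between (mem_Iio.mp hs1)
  obtain ⟨t', h3, h4⟩ := exists_between (mem_Ioi.mp ht1)
  have hle : ∀ y ∈ insert x K, s' < y ∧ y < t' := fun y hy =>
    ⟨h2.trans_le (csInf_le hK'.bddBelow hy), (le_csSup hK'.bddAbove hy).trans_lt h3⟩
  exact ⟨s', hs2 ⟨h1, h2⟩, t', ht2 ⟨h3, h4⟩, (hle x (mem_insert x K)).1.trans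
    (hle x (mem_insert x K)).2, fun y hy => hle y (mem_insert_of_mem x hy)⟩

lemma isPrim_of_contDiff {E : Type*} [NormedAddCommGroup E] [NormedSpace ℝ E] [CompleteSpace E]
    {φ : ℝ → E} (hφ : ContDiff ℝ ∞ φ) (J : Set ℝ) : IsPrim J φ (fun x => fderiv ℝ φ x 1) := by
  refine IsPrim.mono (J := univ) ?_ (subset_univ J)
  refine IsPrim.of_hasDerivAt ?_ ordConnected_univ fun t _ => ?_
  · exact ((hφ.continuous_fderiv (by simp)).clm_apply continuous_const).continuousOn
  · exact ((hφ.differentiable (by simp)) t).hasFDerivAt.hasDerivAt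

lemma tsupport_fderiv_apply_subset' {E F : Type*} [NormedAddCommGroup E] [NormedSpace ℝ E]
    [NormedAddCommGroup F] [NormedSpace ℝ F] (φ : E → F) (e : E) :
    Function.support (fun x => fderiv ℝ φ x e) ⊆ tsupport φ :=
  (subset_tsupport _).trans (tsupport_fderiv_apply_subset ℝ e)

lemma IsPrim.hasWeakDerivOn {J Ω : Set ℝ} {U v : ℝ → ℂ} (hJ : J.OrdConnected) (h : IsPrim J U v)
    (hΩ : IsOpen Ω) (hΩJ : Ω ⊆ J) : HasWeakDerivOn Ω (1 : ℝ) U v := by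
  intro φ hφ hc hsupp
  rcases Ω.eq_empty_or_nonempty with rfl | hne
  · have h0 : φ = 0 := by
      rw [← tsupport_eq_empty_iff]; exact subset_empty_iff.mp hsupp
    subst h0; simp
  obtain ⟨s, hs, t, ht, hst, hK⟩ := exists_Ioo_superset_of_isCompact hΩ hne hc hsupp
  have hz : ∀ x, x ∉ Ioo s t → φ x = 0 := fun x hx =>
    image_eq_zero_of_notMem_tsupport fun h => hx (hK h)
  obtain ⟨h1, h2⟩ := h.mul hJ (isPrim_of_contDiff hφ J) s (hΩJ hs) t (hΩJ ht)
  have hUc := h.continuousOn_uIcc hJ (hΩJ hs) (hΩJ ht)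
  obtain ⟨hd, -⟩ := isPrim_of_contDiff hφ J s (hΩJ hs) t (hΩJ ht)
  simp only [hz s (by simp), hz t (by simp)] at h2
  rw [intervalIntegral.integral_add
    ((h s (hΩJ hs) t (hΩJ ht)).1.mul_continuousOn hφ.continuous.continuousOn)
    (hd.continuousOn_mul hUc),
    intervalIntegral.integral_eq_integral_of_support_subset,
    intervalIntegral.integral_eq_integral_of_support_subset] at h2
  · linear_combination -h2
  · exact (Function.support_mul_subset_right _ _).trans
      ((tsupport_fderiv_apply_subset' φ 1).trans (hK.trans Ioo_subset_Ioc_self))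
  · exact (Function.support_mul_subset_right _ _).trans
      ((subset_tsupport φ).trans (hK.trans Ioo_subset_Ioc_self))

lemma HasWeakDerivOn.sub {Ω : Set ℝ} {u v u' v' : ℝ → ℂ} (h : HasWeakDerivOn Ω (1 : ℝ) u v)
    (h' : HasWeakDerivOn Ω (1 : ℝ) u' v') (hu : LocallyIntegrableOn u Ω)
    (hu' : LocallyIntegrableOn u' Ω) (hv : LocallyIntegrableOn v Ω)
    (hv' : LocallyIntegrableOn v' Ω) :
    HasWeakDerivOn Ω (1 : ℝ) (fun x => u x - u' x) (fun x => v x - v' x) := by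
  intro φ hφ hc hsupp
  have hφ' : Continuous (fun x => fderiv ℝ φ x 1) :=
    (hφ.continuous_fderiv (by simp)).clm_apply continuous_const
  have hc' : HasCompactSupport (fun x => fderiv ℝ φ x 1) := hc.fderiv_apply ℝ 1
  have hsupp' := tsupport_fderiv_apply_subset (f := φ) ℝ (1 : ℝ)
  have key : ∀ w : ℝ → ℂ, LocallyIntegrableOn w Ω →
      Integrable (fun x => w x * fderiv ℝ φ x 1) ∧ Integrable (fun x => w x * φ x) := fun w hw =>
    ⟨integrable_mul_of_hasCompactSupport hφ' hc'
      (hw.integrableOn_compact_subset (hsupp'.trans hsupp) hc'),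
    integrable_mul_of_hasCompactSupport hφ.continuous hc (hw.integrableOn_compact_subset hsupp hc)⟩
  simp only [sub_mul]
  rw [integral_sub (key u hu).1 (key u' hu').1, integral_sub (key v hv).2 (key v' hv').2,
    h φ hφ hc hsupp, h' φ hφ hc hsupp]
  ring

/-- The lemma of du Bois-Reymond: a function with vanishing weak derivative on an open interval is
constant. -/
lemma HasWeakDerivOn.exists_ae_eq_const {Ω : Set ℝ} (hΩ : IsOpen Ω) (hconn : Ω.OrdConnected)
    {w : ℝ → ℂ} (hw : LocallyIntegrableOn w Ω)
    (h : HasWeakDerivOn Ω (1 : ℝ) w (fun _ => 0)) : ∃ C : ℂ, ∀ᵐ x, x ∈ Ω → w x = C := by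
  rcases Ω.eq_empty_or_nonempty with rfl | ⟨c, hcΩ⟩
  · exact ⟨0, by simp⟩
  obtain ⟨r, hr, hrΩ⟩ := Metric.isOpen_iff.mp hΩ c hcΩ
  -- `ψ` is a test function of integral one; the constant will be `∫ w ψ`.
  let b : ContDiffBump c := ⟨r / 4, r / 2, by positivity, by linarith⟩
  let ψ : ℝ → ℝ := b.normed volume
  have hψ : ContDiff ℝ ∞ ψ := b.contDiff_normed
  have hψc : HasCompactSupport ψ := b.hasCompactSupport_normed
  have hψs : tsupport ψ ⊆ Ω := by
    rw [b.tsupport_normed_eq]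
    exact (Metric.closedBall_subset_ball (by show r / 2 < r; linarith)).trans hrΩ
  have hψ1 : ∫ x, ψ x = 1 := b.integral_normed
  have key : ∀ η : ℝ → ℝ, Continuous η → HasCompactSupport η → tsupport η ⊆ Ω →
      Integrable (fun x => w x * (η x : ℂ)) := by
    intro η hη hηc hηs
    have hsub : tsupport (fun x => (η x : ℂ)) ⊆ tsupport η :=
      closure_mono fun x hx => by simpa using hx
    exact integrable_mul_of_hasCompactSupport (by fun_prop) (hηc.comp_left Complex.ofReal_zero)
      ((hw.integrableOn_compact_subset hηs hηc).mono_set hsub)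
  set C : ℂ := ∫ x, w x * (ψ x : ℂ) with hC
  refine ⟨C, ?_⟩
  have main := hΩ.ae_eq_zero_of_integral_contDiff_smul_eq_zero
    (f := fun x => w x - C) (μ := volume) (hw.sub ((locallyIntegrable_const C).locallyIntegrableOn Ω)) ?_
  · filter_upwards [main] with x hx hxΩ using sub_eq_zero.mp (hx hxΩ)
  intro η hη hηc hηs
  set m : ℝ := ∫ x, η x with hm
  obtain ⟨s, hs, t, ht, hst, hK⟩ := exists_Ioo_superset_of_isCompact hΩ ⟨c, hcΩ⟩
    (hηc.union hψc) (union_subset hηs hψs)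
  have hηz : ∀ x, x ∉ Ioo s t → η x = 0 := fun x hx =>
    image_eq_zero_of_notMem_tsupport fun h => hx (hK (Or.inl h))
  have hψz : ∀ x, x ∉ Ioo s t → ψ x = 0 := fun x hx =>
    image_eq_zero_of_notMem_tsupport fun h => hx (hK (Or.inr h))
  -- `θ` has integral zero, so its primitive `Φ` again has compact support in `Ω`, and the
  -- hypothesis can be tested with `Φ`.
  let θ : ℝ → ℝ := fun x => η x - m * ψ x
  have hθ : ContDiff ℝ ∞ θ := hη.sub (contDiff_const.mul hψ)
  have hθz : ∀ x, x ∉ Ioo s t → θ x = 0 := fun x hx => by simp [θ, hηz x hx, hψz x hx]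
  have hηi : Integrable η := hη.continuous.integrable_of_hasCompactSupport hηc
  have hψi : Integrable ψ := hψ.continuous.integrable_of_hasCompactSupport hψc
  have hθ0 : ∫ x in s..t, θ x = 0 := by
    rw [intervalIntegral.integral_eq_integral_of_support_subset, integral_sub hηi (hψi.const_mul m),
      integral_const_mul, hψ1, hm]
    · ring
    · intro x hx
      by_contra h'
      exact hx (hθz x fun h'' => h' (Ioo_subset_Ioc_self h''))
  let Φ : ℝ → ℝ := fun x => ∫ y in s..x, θ y
  have hΦd : ∀ x, HasDerivAt Φ (θ x) x := fun x =>
    intervalIntegral.integral_hasDerivAt_right (hθ.continuous.intervalIntegrable _ _)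
      (hθ.continuous.stronglyMeasurableAtFilter _ _) hθ.continuous.continuousAt
  have hΦ : ContDiff ℝ ∞ Φ := by
    rw [contDiff_infty_iff_deriv]
    refine ⟨fun x => (hΦd x).differentiableAt, ?_⟩
    rwa [show deriv Φ = θ from funext fun x => (hΦd x).deriv]
  have hΦz : ∀ x, x ∉ Icc s t → Φ x = 0 := by
    intro x hx
    rcases lt_or_ge x s with hxs | hxs
    · refine intervalIntegral.integral_zero_ae (ae_of_all _ fun y hy => hθz y fun hy' => ?_)
      rw [uIoc_of_ge hxs.le] at hy
      exact absurd hy'.1 (not_lt.mpr hy.2)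
    · have htx : t < x := by by_contra h'; exact hx ⟨hxs, not_lt.mp h'⟩
      have : Φ x = (∫ y in s..t, θ y) + ∫ y in t..x, θ y :=
        (intervalIntegral.integral_add_adjacent_intervals (hθ.continuous.intervalIntegrable _ _)
          (hθ.continuous.intervalIntegrable _ _)).symm
      rw [this, hθ0, zero_add]
      refine intervalIntegral.integral_zero_ae (ae_of_all _ fun y hy => hθz y fun hy' => ?_)
      rw [uIoc_of_le htx.le] at hy
      exact absurd hy'.2 (not_lt.mpr hy.1.le)
  have hΦs : tsupport (fun x => (Φ x : ℂ)) ⊆ Icc s t := by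
    refine closure_minimal (fun x hx => ?_) isClosed_Icc
    by_contra h'
    exact hx (by simp [hΦz x h'])
  have e := h (fun x => (Φ x : ℂ)) (Complex.ofRealCLM.contDiff.comp hΦ)
    (isCompact_Icc.of_isClosed_subset (isClosed_tsupport _) hΦs)
    (hΦs.trans (hconn.out hs ht))
  have hd : ∀ x, fderiv ℝ (fun x => (Φ x : ℂ)) x 1 = (θ x : ℂ) := fun x => by
    rw [fderiv_apply_one_eq_deriv]; exact (hΦd x).ofReal_comp.deriv
  simp only [hd, zero_mul, integral_zero, neg_zero] at e
  have i1 := key η hη.continuous hηc hηs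
  have i2 := key ψ hψ.continuous hψc hψs
  have e2 : ∫ x, w x * (η x : ℂ) = m * C := by
    have : ∀ x, w x * (θ x : ℂ) = w x * (η x : ℂ) - m * (w x * (ψ x : ℂ)) := fun x => by
      simp only [θ, Complex.ofReal_sub, Complex.ofReal_mul]; ring
    simp only [this] at e
    rw [integral_sub i1 (i2.const_mul _), integral_const_mul] at e
    exact sub_eq_zero.mp e
  have : ∀ x, η x • (w x - C) = w x * (η x : ℂ) - C * (η x : ℂ) := fun x => by
    rw [Complex.real_smul]; ring
  simp only [this]
  have i3 : Integrable (fun x => (η x : ℂ)) := hηi.ofReal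
  rw [integral_sub i1 (i3.const_mul C), integral_const_mul, e2, integral_complex_ofReal, hm]
  ring

/-- The difference of `u` and a primitive of `v` has weak derivative zero, hence is almost
everywhere constant. -/
lemma HasWeakDerivOn.exists_isPrim {Ω : Set ℝ} (hΩ : IsOpen Ω) (hconn : Ω.OrdConnected)
    {u v : ℝ → ℂ} (hu : LocallyIntegrableOn u Ω) (hv : LocallyIntegrableOn v Ω)
    (h : HasWeakDerivOn Ω (1 : ℝ) u v) :
    ∃ U : ℝ → ℂ, IsPrim Ω U v ∧ ∀ᵐ x, x ∈ Ω → u x = U x := by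
  rcases Ω.eq_empty_or_nonempty with rfl | ⟨c, hcΩ⟩
  · exact ⟨0, fun s hs => absurd hs (notMem_empty s), by simp⟩
  have hvi : ∀ s ∈ Ω, ∀ t ∈ Ω, IntervalIntegrable v volume s t := fun s hs t ht =>
    ((hv.integrableOn_compact_subset (hconn.uIcc_subset hs ht) isCompact_uIcc)).intervalIntegrable
  let W : ℝ → ℂ := fun x => ∫ y in c..x, v y
  have hW : IsPrim Ω W v := fun s hs t ht => ⟨hvi s hs t ht,
    intervalIntegral.integral_interval_sub_left (hvi c hcΩ t ht) (hvi c hcΩ s hs)⟩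
  have hWc : LocallyIntegrableOn W Ω :=
    (hW.continuousOn hconn).locallyIntegrableOn hΩ.measurableSet
  have h0 := h.sub (hW.hasWeakDerivOn hconn hΩ subset_rfl) hu hWc hv hv
  simp only [sub_self] at h0
  obtain ⟨C, hC⟩ := h0.exists_ae_eq_const hΩ hconn (hu.sub hWc)
  refine ⟨fun x => W x + C, fun s hs t ht => ⟨hvi s hs t ht, ?_⟩, ?_⟩
  · rw [← (hW s hs t ht).2]; ring
  · filter_upwards [hC] with x hx hxΩ
    have := hx hxΩ
    simp only [Pi.sub_apply] at this
    linear_combination this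

lemma locallyIntegrableOn_of_memLp {Ω : Set ℝ} (hΩ : MeasurableSet Ω) {u : ℝ → ℂ}
    (hu : MemLp u 2 (volume.restrict Ω)) : LocallyIntegrableOn u Ω := by
  have := (hu.locallyIntegrable one_le_two)
  intro x hx
  obtain ⟨s, hs, hi⟩ := this x
  refine ⟨Ω ∩ s, inter_mem self_mem_nhdsWithin (mem_nhdsWithin_of_mem_nhds hs), ?_⟩
  rw [IntegrableOn, Measure.restrict_restrict' hΩ] at hi
  rwa [inter_comm]

lemma MemB1.exists_isPrim {u v : ℝ → ℂ} (h : MemB1 univ u v) :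
    ∃ U : ℝ → ℂ, IsPrim univ U v ∧ u =ᵐ[volume] U := by
  obtain ⟨U, hU, hUu⟩ := h.weakDeriv.exists_isPrim isOpen_univ ordConnected_univ
    (locallyIntegrableOn_of_memLp (by measurability) h.memLp)
    (locallyIntegrableOn_of_memLp (by measurability) h.memLp_deriv)
  exact ⟨U, hU, hUu.mono fun x hx => hx (mem_univ x)⟩

/-- Since `v` is square integrable, it is integrable up to the end point. The identity on the open
half-line therefore extends to `0` by continuity, which makes `u 0` usable as a trace. -/
lemma MemB1.isPrim_Ici {u v : ℝ → ℂ} (h : MemB1 (Ioi 0) u v) (hc : ContinuousOn u (Ici 0)) :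
    IsPrim (Ici 0) u v := by
  obtain ⟨U, hU, hUu⟩ := h.weakDeriv.exists_isPrim isOpen_Ioi ordConnected_Ioi
    (locallyIntegrableOn_of_memLp (by measurability) h.memLp)
    (locallyIntegrableOn_of_memLp (by measurability) h.memLp_deriv)
  have hvi : ∀ s ∈ Ici (0 : ℝ), ∀ t ∈ Ici (0 : ℝ), IntervalIntegrable v volume s t := by
    have : ∀ s ∈ Ici (0 : ℝ), ∀ t, IntegrableOn v (Ioc s t) := fun s hs t => by
      have h1 : MemLp v 2 (volume.restrict (Ioc s t)) :=
        h.memLp_deriv.mono_measure (Measure.restrict_mono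
          (fun x hx => lt_of_le_of_lt (mem_Ici.mp hs) hx.1) le_rfl)
      exact h1.integrable one_le_two
    exact fun s hs t ht => ⟨this s hs t, this t ht s⟩
  have h1 : EqOn u U (Ioi 0) := by
    refine Measure.eqOn_open_of_ae_eq (μ := volume) ?_ isOpen_Ioi
      (hc.mono Ioi_subset_Ici_self) (hU.continuousOn ordConnected_Ioi)
    filter_upwards [ae_restrict_of_ae hUu, ae_restrict_mem measurableSet_Ioi] with x hx hx'
      using hx hx'
  have hW : IsPrim (Ici 0) (fun x => ∫ y in (0 : ℝ)..x, v y) v := fun s hs t ht => ⟨hvi s hs t ht,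
    intervalIntegral.integral_interval_sub_left (hvi 0 self_mem_Ici t ht) (hvi 0 self_mem_Ici s hs)⟩
  have h2 : EqOn (fun x => u x - ∫ y in (0 : ℝ)..x, v y)
      (fun _ => u 1 - ∫ y in (0 : ℝ)..1, v y) (Ici 0) := by
    refine EqOn.of_subset_closure (s := Ioi 0) (fun x hx => ?_)
      (hc.sub (hW.continuousOn ordConnected_Ici)) continuousOn_const Ioi_subset_Ici_self
      (by rw [closure_Ioi])
    have hone : (1 : ℝ) ∈ Ioi (0 : ℝ) := mem_Ioi.mpr one_pos
    simp only [h1 hx, h1 hone]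
    have e1 := (hU 1 hone x hx).2
    have e2 := (hW 1 (Ioi_subset_Ici_self hone) x (Ioi_subset_Ici_self hx)).2
    simp only at e2
    linear_combination e1 - e2
  intro s hs t ht
  refine ⟨hvi s hs t ht, ?_⟩
  have e1 := h2 hs
  have e2 := h2 ht
  have e3 := (hW s hs t ht).2
  simp only at e1 e2 e3
  linear_combination e2 - e1 + e3

/-! ### Operators of closed forms as `(J J*)⁻¹ - 1` -/

section AbstractForm

variable {H : Type*} [NormedAddCommGroup H] [InnerProductSpace ℂ H]

/-- The graph of `B⁻¹ - 1`. -/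
def invGraph (B : H →L[ℂ] H) : Set (H × H) := {z | B (z.1 + z.2) = z.1}

section Bounded

variable [CompleteSpace H] {B : H →L[ℂ] H}

/-- For `r < 0` the resolvent of `B⁻¹ - 1` at `r` is `(1 - (1 + r)B)⁻¹ B`. The inverse exists
because `0 ≤ B ≤ 1` makes `1 - (1 + r)B` coercive, with constant `min (-r) 1`. -/
lemma nonneg_of_mem_realSpectrum_invGraph (hB : B.IsPositive) (hB1 : ‖B‖ ≤ 1) {r : ℝ}
    (hr : r ∈ realSpectrum (invGraph B)) : 0 ≤ r := by
  by_contra! hneg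
  refine hr ?_
  set M : H →L[ℂ] H := 1 - ((1 + r : ℝ) : ℂ) • B with hM
  have hpos : ∀ x, (0 : ℝ) ≤ (inner ℂ (B x) x : ℂ).re := fun x => hB.re_inner_nonneg_left x
  have hle : ∀ x, (inner ℂ (B x) x : ℂ).re ≤ ‖x‖ ^ 2 := fun x => by
    calc (inner ℂ (B x) x : ℂ).re ≤ ‖B x‖ * ‖x‖ := re_inner_le_norm (𝕜 := ℂ) (B x) x
      _ ≤ (1 * ‖x‖) * ‖x‖ := by
        gcongr
        exact B.le_of_opNorm_le hB1 x
      _ = ‖x‖ ^ 2 := by ring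
  obtain ⟨c, hc, hcr, hc1⟩ : ∃ c : ℝ, 0 < c ∧ c ≤ -r ∧ c ≤ 1 :=
    ⟨min (-r) 1, lt_min (by linarith) one_pos, min_le_left _ _, min_le_right _ _⟩
  have hMapp : ∀ x, M x = x - ((1 + r : ℝ) : ℂ) • B x := fun x => rfl
  have hunit : IsUnit M := by
    refine ContinuousLinearMap.isUnit_of_forall_le_norm_inner_map M (c := ⟨c, hc.le⟩) hc fun x => ?_
    refine le_trans ?_ (RCLike.re_le_norm _)
    have : (inner ℂ (M x) x : ℂ).re = ‖x‖ ^ 2 - (1 + r) * (inner ℂ (B x) x : ℂ).re := by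
      simp only [hMapp, inner_sub_left, inner_smul_left, Complex.conj_ofReal, Complex.sub_re,
        Complex.re_ofReal_mul]
      congr 1
      exact (inner_self_eq_norm_sq (𝕜 := ℂ) x)
    change ‖x‖ ^ 2 * c ≤ (inner ℂ (M x) x : ℂ).re
    rw [this]
    rcases le_total 0 (1 + r) with h0 | h0
    · nlinarith [mul_le_mul_of_nonneg_left (hle x) h0, sq_nonneg ‖x‖]
    · nlinarith [mul_nonneg (neg_nonneg.mpr h0) (hpos x), sq_nonneg ‖x‖]
  obtain ⟨Mu, hMu⟩ := hunit
  set N : H →L[ℂ] H := ↑Mu⁻¹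
  have hMN : ∀ x, M (N x) = x := fun x => by
    have := congrArg (fun T : H →L[ℂ] H => T x) Mu.mul_inv
    rwa [hMu] at this
  have hNM : ∀ x, N (M x) = x := fun x => by
    have := congrArg (fun T : H →L[ℂ] H => T x) Mu.inv_mul
    rwa [hMu] at this
  refine ⟨N.comp B, fun f => ?_, fun z hz => ?_⟩
  · have h1 := hMN (B f)
    rw [hMapp, sub_eq_iff_eq_add] at h1
    change B (N (B f) + (f + (r : ℂ) • N (B f))) = N (B f)
    rw [map_add, map_add, map_smul]
    conv_rhs => rw [h1]
    push_cast
    module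
  · have hz' : B (z.1 + z.2) = z.1 := hz
    change N (B (z.2 - (r : ℂ) • z.1)) = z.1
    conv_rhs => rw [← hNM z.1, hMapp]
    congr 1
    conv_rhs => lhs; rw [← hz']
    rw [map_add, map_sub, map_smul]
    push_cast
    module

/-- The norm of a positive operator lies in its spectrum, and a resolvent of `B⁻¹ - 1` at `1/‖B‖ -
1` would invert `‖B‖ - B`. -/
lemma one_div_norm_sub_one_mem_realSpectrum (hB : B.IsPositive) (h0 : 0 < ‖B‖) :
    1 / ‖B‖ - 1 ∈ realSpectrum (invGraph B) := by
  rintro ⟨R, hR, hR'⟩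
  set l : ℝ := ‖B‖ with hl
  have hnt : Nontrivial H := by
    by_contra h
    rw [not_nontrivial_iff_subsingleton] at h
    have : B = 0 := Subsingleton.elim _ _
    simp [hl, this] at h0
  have hl0 : (l : ℂ) ≠ 0 := by exact_mod_cast h0.ne'
  have hB0 : 0 ≤ B := (ContinuousLinearMap.nonneg_iff_isPositive B).mpr hB
  have hspec : l ∈ spectrum ℝ B := CStarAlgebra.norm_mem_spectrum_of_nonneg hB0
  refine hspec ?_
  set N : H →L[ℂ] H := algebraMap ℝ (H →L[ℂ] H) l - B with hN
  have hNapp : ∀ x, N x = (l : ℂ) • x - B x := fun x => by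
    rw [hN, Algebra.algebraMap_eq_smul_one, Complex.coe_smul]
    rfl
  -- From `B⁻¹ - 1/l = l⁻¹(l - B)B⁻¹` one gets `R = l B(l - B)⁻¹`, and solving for `(l - B)⁻¹` gives
  -- this formula.
  set S : H →L[ℂ] H := (l : ℂ)⁻¹ • (1 + (l : ℂ)⁻¹ • R) with hS
  have hSN : S * N = 1 := by
    ext f
    have hz : (B f, f - B f) ∈ invGraph B := by
      change B (B f + (f - B f)) = B f; congr 1; abel
    have h1 : R (f - B f - ((1 / l - 1 : ℝ) : ℂ) • B f) = B f := hR' _ hz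
    have h2 : R (N f) = (l : ℂ) • B f := by
      conv_rhs => rw [← h1, ← map_smul]
      congr 1
      rw [hNapp]
      push_cast
      rw [sub_smul, smul_sub, smul_sub, smul_sub, smul_smul, mul_one_div_cancel hl0]
      module
    change (l : ℂ)⁻¹ • (N f + (l : ℂ)⁻¹ • R (N f)) = f
    rw [h2, smul_smul, inv_mul_cancel₀ hl0, one_smul, hNapp, sub_add_cancel, smul_smul,
      inv_mul_cancel₀ hl0, one_smul]
  -- Only a left inverse has been found; taking adjoints turns it into a right inverse.
  have hNsa : star N = N := by
    rw [hN, star_sub, hB.isSelfAdjoint.star_eq, ← algebraMap_star_comm]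
    simp
  have hNS : N * star S = 1 := by
    have := congrArg star hSN
    rwa [star_mul, hNsa, star_one] at this
  exact ⟨⟨N, S, by rw [← left_inv_eq_right_inv hSN hNS] at hNS; exact hNS, hSN⟩, rfl⟩

/-- By the Fredholm alternative the nonzero spectral value `‖B‖` of the compact operator `B` is an
eigenvalue. -/
lemma exists_invGraph_eigenvector (hB : B.IsPositive) (hBc : IsCompactOperator B) (h0 : 0 < ‖B‖) :
    ∃ u : H, u ≠ 0 ∧ (u, ((1 / ‖B‖ - 1 : ℝ) : ℂ) • u) ∈ invGraph B := by
  have hnt : Nontrivial H := by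
    by_contra h
    rw [not_nontrivial_iff_subsingleton] at h
    have : B = 0 := Subsingleton.elim _ _
    simp [this] at h0
  have hl0 : ((‖B‖ : ℝ) : ℂ) ≠ 0 := by exact_mod_cast h0.ne'
  have hB0 : 0 ≤ B := (ContinuousLinearMap.nonneg_iff_isPositive B).mpr hB
  have hspec : ((‖B‖ : ℝ) : ℂ) ∈ spectrum ℂ B :=
    spectrum.algebraMap_mem ℂ (CStarAlgebra.norm_mem_spectrum_of_nonneg hB0)
  obtain ⟨u, hu⟩ := ((hBc.hasEigenvalue_iff_mem_spectrum hl0).mpr hspec).exists_hasEigenvector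
  have hBu : B u = ((‖B‖ : ℝ) : ℂ) • u := hu.apply_eq_smul
  refine ⟨u, hu.2, ?_⟩
  change B (u + ((1 / ‖B‖ - 1 : ℝ) : ℂ) • u) = u
  rw [map_add, map_smul, hBu, smul_smul, ← add_smul]
  convert one_smul ℂ u
  push_cast
  field_simp
  ring

end Bounded

section Embedding

variable {L : Type*} [NormedAddCommGroup L] [InnerProductSpace ℂ L] [CompleteSpace H]
  [CompleteSpace L] (J : L →L[ℂ] H)

/-- The operator `J J*`. -/
noncomputable def embInv : H →L[ℂ] H := J.comp (ContinuousLinearMap.adjoint J)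

/-- The vector `k = J*(z.1 + z.2)` is characterized by the weak equation, so membership in the graph
is the variational definition of the operator. -/
lemma mem_invGraph_embInv_iff (z : H × H) : z ∈ invGraph (embInv J) ↔
    ∃ k : L, J k = z.1 ∧ ∀ l : L, inner ℂ l k = inner ℂ (J l) (z.1 + z.2) := by
  constructor
  · intro h
    exact ⟨_, h, fun l => ContinuousLinearMap.adjoint_inner_right J l _⟩
  · rintro ⟨k, h1, h2⟩
    have : ContinuousLinearMap.adjoint J (z.1 + z.2) = k := by
      refine ext_inner_left ℂ fun l => ?_
      rw [ContinuousLinearMap.adjoint_inner_right, h2]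
    exact (congrArg J this).trans h1

lemma isPositive_embInv : (embInv J).IsPositive :=
  ContinuousLinearMap.isPositive_self_comp_adjoint J

lemma norm_embInv : ‖embInv J‖ = ‖J‖ * ‖J‖ := by
  have h := ContinuousLinearMap.norm_adjoint_comp_self (ContinuousLinearMap.adjoint J)
  rwa [ContinuousLinearMap.adjoint_adjoint, LinearIsometryEquiv.norm_map] at h

lemma norm_embInv_le (hJ : ∀ k, ‖J k‖ ≤ ‖k‖) : ‖embInv J‖ ≤ 1 := by
  have h : ‖J‖ ≤ 1 := J.opNorm_le_bound zero_le_one (by simpa using hJ)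
  rw [norm_embInv]
  exact mul_le_one₀ h (norm_nonneg _) h

lemma norm_sq_le_embInv (k : L) : ‖J k‖ ^ 2 ≤ ‖embInv J‖ * ‖k‖ ^ 2 := by
  rw [norm_embInv]
  calc ‖J k‖ ^ 2 ≤ (‖J‖ * ‖k‖) ^ 2 := by gcongr; exact J.le_opNorm k
    _ = _ := by ring

lemma norm_embInv_pos {k : L} (hk : J k ≠ 0) : 0 < ‖embInv J‖ := by
  rw [norm_embInv]
  have : J ≠ 0 := by rintro rfl; exact hk rfl
  have := norm_pos_iff.mpr this
  positivity

lemma one_div_embInv_le {k : L} (hk : J k ≠ 0) :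
    1 / ‖embInv J‖ ≤ ‖k‖ ^ 2 / ‖J k‖ ^ 2 := by
  have h2 : 0 < ‖J k‖ ^ 2 := by positivity
  rw [div_le_div_iff₀ (norm_embInv_pos J hk) h2]
  linarith [norm_sq_le_embInv J k]

end Embedding

/-- Triples `(u, p, d)` of vectors, with the Hilbert space structure of the orthogonal sum. -/
abbrev Triple (H : Type*) : Type _ := WithLp 2 (H × WithLp 2 (H × H))

/-- The triple with the given components. -/
abbrev triple {H : Type*} (u p d : H) : Triple H := WithLp.toLp 2 (u, WithLp.toLp 2 (p, d))

lemma inner_triple (u p d u' p' d' : H) :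
    inner ℂ (triple u p d) (triple u' p' d') = inner ℂ u u' + (inner ℂ p p' + inner ℂ d d') := by
  simp [WithLp.prod_inner_apply]

lemma norm_sq_triple {H : Type*} [NormedAddCommGroup H] (u p d : H) :
    ‖triple u p d‖ ^ 2 = ‖u‖ ^ 2 + (‖p‖ ^ 2 + ‖d‖ ^ 2) := by
  simp [WithLp.prod_norm_sq_eq_of_L2]

/-- The graph of the operator of the quadratic form `‖p‖² + ‖d‖²`, where `(p, d)` is the generalized
gradient of `u` if `(u, p, d) ∈ K`. -/
def formOp (K : Submodule ℂ (Triple H)) : Set (H × H) :=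
  {z | ∃ p d : H, triple z.1 p d ∈ K ∧
    ∀ w q e : H, triple w q e ∈ K → inner ℂ q p + inner ℂ e d = inner ℂ w z.2}

/-- The Rayleigh quotients of the form. -/
def formQuotients (K : Submodule ℂ (Triple H)) : Set ℝ :=
  {r | ∃ u p d : H, triple u p d ∈ K ∧ u ≠ 0 ∧ r = (‖p‖ ^ 2 + ‖d‖ ^ 2) / ‖u‖ ^ 2}

/-- The first component, on a subspace of triples. -/
noncomputable def formEmb (K : Submodule ℂ (Triple H)) : K →L[ℂ] H :=
  (WithLp.fstL 2 ℂ H (WithLp 2 (H × H))).comp K.subtypeL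

variable (K : Submodule ℂ (Triple H))

lemma exists_triple_eq (k : K) : ∃ (u p d : H) (h : triple u p d ∈ K), k = ⟨triple u p d, h⟩ :=
  ⟨(k : Triple H).fst, (k : Triple H).snd.fst, (k : Triple H).snd.snd, k.2, rfl⟩

lemma formEmb_mk {u p d : H} (h : triple u p d ∈ K) : formEmb K ⟨triple u p d, h⟩ = u := rfl

lemma norm_sq_mk {u p d : H} (h : triple u p d ∈ K) :
    ‖(⟨triple u p d, h⟩ : K)‖ ^ 2 = ‖u‖ ^ 2 + (‖p‖ ^ 2 + ‖d‖ ^ 2) := norm_sq_triple u p d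

lemma norm_formEmb_apply_le (k : K) : ‖formEmb K k‖ ≤ ‖k‖ := by
  obtain ⟨u, p, d, h, rfl⟩ := exists_triple_eq K k
  refine le_of_sq_le_sq ?_ (norm_nonneg _)
  rw [formEmb_mk, norm_sq_mk]
  nlinarith [sq_nonneg ‖p‖, sq_nonneg ‖d‖]

variable [CompleteSpace H] [CompleteSpace K]

/-- The inner product of `K` is that of the form plus `⟨w, u⟩`. The extra term is the shift by one
in `invGraph`. -/
lemma formOp_eq : formOp K = invGraph (embInv (L := K) (formEmb K)) := by
  ext z
  rw [mem_invGraph_embInv_iff]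
  have key : ∀ {u p d w q e : H} (h : triple u p d ∈ K) (h' : triple w q e ∈ K),
      (inner ℂ (⟨triple w q e, h'⟩ : K) (⟨triple u p d, h⟩ : K) : ℂ) =
        inner ℂ w u + (inner ℂ q p + inner ℂ e d) := fun h h' => inner_triple _ _ _ _ _ _
  constructor
  · rintro ⟨p, d, hK, h⟩
    refine ⟨⟨triple z.1 p d, hK⟩, rfl, fun l => ?_⟩
    obtain ⟨w, q, e, hw, rfl⟩ := exists_triple_eq K l
    rw [key hK hw, h w q e hw, formEmb_mk, inner_add_right]
  · rintro ⟨k, h1, h2⟩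
    obtain ⟨u, p, d, hK, rfl⟩ := exists_triple_eq K k
    rw [formEmb_mk] at h1
    subst h1
    refine ⟨p, d, hK, fun w q e hw => ?_⟩
    have h3 := h2 ⟨triple w q e, hw⟩
    rw [key hK hw, formEmb_mk, inner_add_right] at h3
    exact add_left_cancel h3

lemma nonneg_of_mem_realSpectrum_formOp {r : ℝ} (hr : r ∈ realSpectrum (formOp K)) : 0 ≤ r := by
  rw [formOp_eq] at hr
  exact nonneg_of_mem_realSpectrum_invGraph (isPositive_embInv (L := K) _)
    (norm_embInv_le (L := K) _ (norm_formEmb_apply_le K)) hr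

lemma one_div_sub_one_le_of_mem_formQuotients {r : ℝ} (hr : r ∈ formQuotients K) :
    0 < ‖embInv (L := K) (formEmb K)‖ ∧ 1 / ‖embInv (L := K) (formEmb K)‖ - 1 ≤ r := by
  obtain ⟨u, p, d, h, hu, rfl⟩ := hr
  have hk : formEmb K ⟨triple u p d, h⟩ ≠ 0 := hu
  refine ⟨norm_embInv_pos (L := K) _ hk, ?_⟩
  have h1 := one_div_embInv_le (L := K) _ hk
  rw [formEmb_mk, norm_sq_mk] at h1
  have h2 : ‖u‖ ^ 2 ≠ 0 := by positivity
  rw [sub_le_iff_le_add, div_add_one h2]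
  exact h1.trans (le_of_eq (by ring))

/-- The half of the variational principle that needs no compactness; the spectral point is `1/‖J J*‖
- 1`. -/
lemma exists_mem_realSpectrum_formOp_le {r : ℝ} (hr : r ∈ formQuotients K) :
    ∃ s ∈ realSpectrum (formOp K), s ≤ r := by
  obtain ⟨h0, h1⟩ := one_div_sub_one_le_of_mem_formQuotients K hr
  refine ⟨_, ?_, h1⟩
  rw [formOp_eq]
  exact one_div_norm_sub_one_mem_realSpectrum (isPositive_embInv (L := K) _) h0

/-- Testing the eigenvalue equation with the eigenvector itself shows that its Rayleigh quotient is
the lower bound `1/‖J J*‖ - 1`, which is thus attained. -/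
lemma exists_isLeast_formQuotients (hJ : IsCompactOperator (formEmb K))
    (hne : (formQuotients K).Nonempty) :
    ∃ (m : ℝ) (u p d : H), IsLeast (formQuotients K) m ∧ u ≠ 0 ∧ triple u p d ∈ K ∧
      ∀ w q e : H, triple w q e ∈ K → inner ℂ q p + inner ℂ e d = inner ℂ w ((m : ℂ) • u) := by
  obtain ⟨r₀, hr₀⟩ := hne
  have hpos := (one_div_sub_one_le_of_mem_formQuotients K hr₀).1
  have hBc : IsCompactOperator (embInv (L := K) (formEmb K)) := hJ.comp_clm _
  obtain ⟨u, hu, hmem⟩ := exists_invGraph_eigenvector (isPositive_embInv (L := K) _) hBc hpos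
  rw [← formOp_eq] at hmem
  obtain ⟨p, d, hK, hform⟩ := hmem
  set m : ℝ := 1 / ‖embInv (L := K) (formEmb K)‖ - 1 with hm
  refine ⟨m, u, p, d, ⟨⟨u, p, d, hK, hu, ?_⟩, fun r hr =>
    (one_div_sub_one_le_of_mem_formQuotients K hr).2⟩, hu, hK, hform⟩
  have h1 := congrArg Complex.re (hform u p d hK)
  rw [inner_smul_right, Complex.add_re, Complex.re_ofReal_mul] at h1
  have hn : ∀ x : H, (inner ℂ x x : ℂ).re = ‖x‖ ^ 2 := fun x => inner_self_eq_norm_sq (𝕜 := ℂ) x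
  rw [hn, hn, hn] at h1
  have : ‖u‖ ^ 2 ≠ 0 := by positivity
  rw [h1, mul_div_cancel_right₀ _ this]

end AbstractForm

/-! ### Pairings in `L²` and test functions -/

section Pairing

variable {X : Type*} [MeasurableSpace X] {μ : Measure X}

/-- The conjugate cancels the one in the inner product, so orthogonality to such vectors is a
bilinear weak equation. -/
lemma inner_toLp_star {α : X → ℂ} (hα : MemLp α 2 μ) (u : Lp ℂ 2 μ) :
    inner ℂ (hα.star.toLp (star α)) u = ∫ x, u x * α x ∂μ := by
  rw [L2.inner_def]
  refine integral_congr_ae ?_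
  filter_upwards [hα.star.coeFn_toLp] with x hx
  rw [hx, RCLike.inner_apply, Pi.star_apply, ← starRingEnd_apply, Complex.conj_conj]

lemma norm_sq_L2 (u : Lp ℂ 2 μ) : ‖u‖ ^ 2 = ∫ x, ‖u x‖ ^ 2 ∂μ := by
  rw [← inner_self_eq_norm_sq (𝕜 := ℂ), L2.inner_def, ← integral_re (L2.integrable_inner u u)]
  refine integral_congr_ae (ae_of_all _ fun x => ?_)
  exact inner_self_eq_norm_sq (𝕜 := ℂ) (u x)

lemma norm_sq_toLp {u : X → ℂ} (hu : MemLp u 2 μ) : ‖hu.toLp u‖ ^ 2 = ∫ x, ‖u x‖ ^ 2 ∂μ := by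
  rw [norm_sq_L2]
  refine integral_congr_ae ?_
  filter_upwards [hu.coeFn_toLp] with x hx
  rw [hx]

end Pairing

lemma mem_span_orthogonal_iff {H : Type*} [NormedAddCommGroup H] [InnerProductSpace ℂ H]
    (S : Set H) (x : H) : x ∈ (Submodule.span ℂ S)ᗮ ↔ ∀ s ∈ S, inner ℂ s x = 0 := by
  rw [Submodule.mem_orthogonal]
  refine ⟨fun h s hs => h s (Submodule.subset_span hs), fun h s hs => ?_⟩
  induction hs using Submodule.span_induction with
  | mem s hs => exact h s hs
  | zero => exact inner_zero_left _
  | add s t _ _ hs ht => rw [inner_add_left, hs, ht, add_zero]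
  | smul c s _ hs => rw [inner_smul_left, hs, mul_zero]

lemma HasWeakDerivOn.congr {E : Type*} [NormedAddCommGroup E] [NormedSpace ℝ E] [MeasureSpace E]
    {U : Set E} {e : E} {u v u' v' : E → ℂ} (h : HasWeakDerivOn U e u v) (hu : u =ᵐ[volume] u')
    (hv : v =ᵐ[volume] v') : HasWeakDerivOn U e u' v' := by
  intro φ h1 h2 h3
  have e1 : ∫ x, u' x * fderiv ℝ φ x e = ∫ x, u x * fderiv ℝ φ x e :=
    integral_congr_ae (hu.mono fun x hx => by simp only [hx])
  have e2 : ∫ x, v' x * φ x = ∫ x, v x * φ x :=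
    integral_congr_ae (hv.mono fun x hx => by simp only [hx])
  rw [e1, e2, h φ h1 h2 h3]

/-- Smooth functions with compact support. -/
structure IsTest {E : Type*} [NormedAddCommGroup E] [NormedSpace ℝ E] (φ : E → ℂ) : Prop where
  contDiff : ContDiff ℝ ∞ φ
  hasCompactSupport : HasCompactSupport φ

namespace IsTest

variable {E : Type*} [NormedAddCommGroup E] [NormedSpace ℝ E] {φ : E → ℂ}

lemma continuous_deriv (h : IsTest φ) (e : E) : Continuous (fun x => fderiv ℝ φ x e) :=
  (h.contDiff.continuous_fderiv (by simp)).clm_apply continuous_const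

variable [MeasurableSpace E] [BorelSpace E] {μ : Measure E}
  [IsFiniteMeasureOnCompacts μ]

lemma memLp (h : IsTest φ) : MemLp φ 2 μ :=
  h.contDiff.continuous.memLp_of_hasCompactSupport h.hasCompactSupport

lemma memLp_deriv (h : IsTest φ) (e : E) : MemLp (fun x => fderiv ℝ φ x e) 2 μ :=
  (h.continuous_deriv e).memLp_of_hasCompactSupport (h.hasCompactSupport.fderiv_apply ℝ e)

lemma memLp_mul (h : IsTest φ) {w : E → ℂ} (hw : Continuous w) :
    MemLp (fun x => w x * φ x) 2 μ :=
  (hw.mul h.contDiff.continuous).memLp_of_hasCompactSupport h.hasCompactSupport.mul_left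

end IsTest

/-! ### The form domain of the fiber operator -/

/-- The continuous function `σ(t) t`. -/
noncomputable def ramp (a t : ℝ) : ℝ := max t 0 + a * min t 0

lemma continuous_ramp (a : ℝ) : Continuous (ramp a) := by unfold ramp; fun_prop

lemma ramp_of_nonneg (a : ℝ) {t : ℝ} (ht : 0 ≤ t) : ramp a t = t := by simp [ramp, ht]

lemma ramp_of_nonpos (a : ℝ) {t : ℝ} (ht : t ≤ 0) : ramp a t = a * t := by simp [ramp, ht]

lemma V_eq (a ξ t : ℝ) : V a ξ t = (ξ + ramp a t) ^ 2 := by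
  unfold V
  split_ifs with h
  · rw [ramp_of_nonpos a h.le]
  · rw [ramp_of_nonneg a (not_lt.mp h)]

lemma sigma_mul (a : ℝ) (x : ℝ × ℝ) : sigma a x * x.2 = ramp a x.2 := by
  unfold sigma
  split_ifs with h
  · rw [ramp_of_nonneg a h.le, one_mul]
  · rw [ramp_of_nonpos a (not_lt.mp h)]

lemma abs_ramp_le {a : ℝ} (ha : |a| ≤ 1) (t : ℝ) : |ramp a t| ≤ |t| := by
  rcases le_total 0 t with h | h
  · rw [ramp_of_nonneg a h]
  · rw [ramp_of_nonpos a h, abs_mul]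
    exact mul_le_of_le_one_left (abs_nonneg t) ha

lemma le_abs_ramp {a : ℝ} (ha : |a| ≤ 1) (t : ℝ) : |a| * |t| ≤ |ramp a t| := by
  rcases le_total 0 t with h | h
  · rw [ramp_of_nonneg a h]
    exact mul_le_of_le_one_left (abs_nonneg t) ha
  · rw [ramp_of_nonpos a h, abs_mul]

/-- The form domain of `𝔥_a[ξ]`: triples `(u, u', (ξ + σ t) u)`. -/
noncomputable def fiberSpace (a ξ : ℝ) : Submodule ℂ (Triple L2Line) :=
  (Submodule.span ℂ ({s | ∃ (φ : ℝ → ℂ) (h : IsTest φ),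
      s = triple ((h.memLp_deriv 1).star.toLp _) (h.memLp.star.toLp _) 0} ∪
    {s | ∃ (φ : ℝ → ℂ) (h : IsTest φ), s = triple
      ((h.memLp_mul (w := fun t => ((ξ + ramp a t : ℝ) : ℂ))
        (Complex.continuous_ofReal.comp (continuous_const.add (continuous_ramp a)))).star.toLp _) 0
      (-(h.memLp.star.toLp _))}))ᗮ

instance (a ξ : ℝ) : CompleteSpace (fiberSpace a ξ) :=
  (Submodule.isClosed_orthogonal _).completeSpace_coe

/-- Orthogonality to the first family of vectors says `u' = v` weakly; orthogonality to the second
says `m = (ξ + σt)u`. Defined as an orthogonal complement, the space is closed without further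
argument. -/
lemma mem_fiberSpace_iff (a ξ : ℝ) (u v m : L2Line) : triple u v m ∈ fiberSpace a ξ ↔
    HasWeakDerivOn univ (1 : ℝ) u v ∧ m =ᵐ[volume] fun t => ((ξ + ramp a t : ℝ) : ℂ) * u t := by
  set w : ℝ → ℂ := fun t => ((ξ + ramp a t : ℝ) : ℂ) with hw
  have hwc : Continuous w :=
    Complex.continuous_ofReal.comp (continuous_const.add (continuous_ramp a))
  have key1 : ∀ (φ : ℝ → ℂ) (h : IsTest φ), inner ℂ (triple ((h.memLp_deriv 1).star.toLp _)
      (h.memLp.star.toLp _) (0 : L2Line)) (triple u v m) =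
      (∫ t, u t * fderiv ℝ φ t 1) + ∫ t, v t * φ t := fun φ h => by
    rw [inner_triple, inner_toLp_star (h.memLp_deriv 1), inner_toLp_star h.memLp, inner_zero_left,
      add_zero]
  have key2 : ∀ (φ : ℝ → ℂ) (h : IsTest φ), inner ℂ (triple ((h.memLp_mul hwc).star.toLp _)
      (0 : L2Line) (-(h.memLp.star.toLp _))) (triple u v m) =
      (∫ t, u t * (w t * φ t)) - ∫ t, m t * φ t := fun φ h => by
    rw [inner_triple, inner_toLp_star (h.memLp_mul hwc), inner_neg_left, inner_toLp_star h.memLp,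
      inner_zero_left, zero_add,
      sub_eq_add_neg]
  rw [fiberSpace, mem_span_orthogonal_iff]
  constructor
  · intro h
    refine ⟨fun φ h1 h2 _ => ?_, ?_⟩
    · have := h _ (Or.inl ⟨φ, ⟨h1, h2⟩, rfl⟩)
      rw [key1 φ ⟨h1, h2⟩] at this
      exact eq_neg_of_add_eq_zero_left this
    · refine ae_eq_of_integral_contDiff_smul_eq ((Lp.memLp m).locallyIntegrable one_le_two) ?_ ?_
      · exact ((Lp.memLp u).locallyIntegrable one_le_two).continuous_mul hwc
      · intro g hg hgc
        have ht : IsTest (fun t => (g t : ℂ)) :=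
          ⟨Complex.ofRealCLM.contDiff.comp hg, hgc.comp_left Complex.ofReal_zero⟩
        have := h _ (Or.inr ⟨_, ht, rfl⟩)
        rw [key2 _ ht] at this
        simp only [Complex.real_smul]
        rw [sub_eq_zero] at this
        calc ∫ t, (g t : ℂ) * m t = ∫ t, m t * (g t : ℂ) := by simp only [mul_comm]
          _ = ∫ t, u t * (w t * (g t : ℂ)) := this.symm
          _ = _ := by congr 1; ext t; ring
  · rintro ⟨h1, h2⟩ s (⟨φ, h, rfl⟩ | ⟨φ, h, rfl⟩)
    · rw [key1 φ h, h1 φ h.contDiff h.hasCompactSupport (subset_univ _), neg_add_cancel]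
    · rw [key2 φ h, sub_eq_zero]
      refine integral_congr_ae ?_
      filter_upwards [h2] with t ht
      rw [ht]; ring

lemma norm_sq_fiberSpace {a ξ : ℝ} {u v m : L2Line} (h : triple u v m ∈ fiberSpace a ξ) :
    ‖v‖ ^ 2 + ‖m‖ ^ 2 = ∫ t, (‖v t‖ ^ 2 + V a ξ t * ‖u t‖ ^ 2) := by
  have hm := ((mem_fiberSpace_iff a ξ u v m).mp h).2
  rw [norm_sq_L2, norm_sq_L2, ← integral_add ((Lp.memLp v).integrable_norm_pow two_ne_zero)
    ((Lp.memLp m).integrable_norm_pow two_ne_zero)]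
  refine integral_congr_ae ?_
  filter_upwards [hm] with t ht
  rw [ht, norm_mul, Complex.norm_real, mul_pow, Real.norm_eq_abs, sq_abs, V_eq]

/-- As `a ≠ 0`, the bound `|a||t| ≤ |σt| ≤ |ξ + σt| + |ξ|` controls `t u` by `m` and `u`. -/
lemma memB1_of_mem_fiberSpace {a ξ : ℝ} (ha : a ∈ Ioo (-1 : ℝ) 0) {u v m : L2Line}
    (h : triple u v m ∈ fiberSpace a ξ) : MemB1 univ u v := by
  obtain ⟨h1, h2⟩ := (mem_fiberSpace_iff a ξ u v m).mp h
  refine ⟨by simpa using Lp.memLp u, by simpa using Lp.memLp v, ?_, h1⟩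
  rw [Measure.restrict_univ]
  have hpos : 0 < |a| := abs_pos.mpr ha.2.ne
  have ha1 : |a| ≤ 1 := abs_le.mpr ⟨ha.1.le, ha.2.le.trans zero_le_one⟩
  have hb : MemLp (fun t => |a|⁻¹ * (‖m t‖ + |ξ| * ‖u t‖)) 2 volume :=
    ((Lp.memLp m).norm.add ((Lp.memLp u).norm.const_mul |ξ|)).const_mul |a|⁻¹
  refine hb.of_le ((Complex.continuous_ofReal.aestronglyMeasurable).mul
    (Lp.memLp u).aestronglyMeasurable) ?_
  filter_upwards [h2] with t ht
  refine le_trans ?_ (Real.le_norm_self _)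
  rw [ht, inv_mul_eq_div, le_div_iff₀ hpos]
  simp only [norm_mul, Complex.norm_real, Real.norm_eq_abs]
  have e1 := le_abs_ramp ha1 t
  have e2 : |ramp a t| ≤ |ξ + ramp a t| + |ξ| := by
    have := abs_sub (ξ + ramp a t) ξ
    rwa [add_sub_cancel_left] at this
  nlinarith [norm_nonneg (u t)]

lemma MemB1.exists_mem_fiberSpace {a : ℝ} (ξ : ℝ) (ha : a ∈ Ioo (-1 : ℝ) 0) {u v : ℝ → ℂ}
    (h : MemB1 univ u v) : ∃ u' v' m : L2Line, triple u' v' m ∈ fiberSpace a ξ ∧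
      u' =ᵐ[volume] u ∧ v' =ᵐ[volume] v := by
  have hu : MemLp u 2 volume := by simpa using h.memLp
  have hv : MemLp v 2 volume := by simpa using h.memLp_deriv
  have htu : MemLp (fun t : ℝ => (t : ℂ) * u t) 2 volume := by simpa using h.memLp_mul
  have ha1 : |a| ≤ 1 := abs_le.mpr ⟨ha.1.le, ha.2.le.trans zero_le_one⟩
  have hm : MemLp (fun t : ℝ => ((ξ + ramp a t : ℝ) : ℂ) * u t) 2 volume := by
    have h1 : MemLp (fun t : ℝ => ((ramp a t : ℝ) : ℂ) * u t) 2 volume := by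
      refine htu.of_le ((Complex.continuous_ofReal.comp
        (continuous_ramp a)).aestronglyMeasurable.mul hu.aestronglyMeasurable)
        (ae_of_all _ fun t => ?_)
      rw [norm_mul, norm_mul, Complex.norm_real, Complex.norm_real]
      exact mul_le_mul_of_nonneg_right (abs_ramp_le ha1 t) (norm_nonneg _)
    convert! (hu.const_mul (ξ : ℂ)).add h1 using 2 with t
    simp only [Pi.add_apply]; push_cast; ring
  refine ⟨hu.toLp u, hv.toLp v, hm.toLp _, ?_, hu.coeFn_toLp, hv.coeFn_toLp⟩
  rw [mem_fiberSpace_iff]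
  refine ⟨h.weakDeriv.congr hu.coeFn_toLp.symm hv.coeFn_toLp.symm, ?_⟩
  · filter_upwards [hm.coeFn_toLp, hu.coeFn_toLp] with t e1 e2
    rw [e1, e2]

lemma fiberQuotients_eq {a : ℝ} (ξ : ℝ) (ha : a ∈ Ioo (-1 : ℝ) 0) :
    fiberQuotients a ξ = formQuotients (fiberSpace a ξ) := by
  ext r
  constructor
  · rintro ⟨u, v, h, hpos, rfl⟩
    obtain ⟨u', v', m, hK, e1, e2⟩ := h.exists_mem_fiberSpace ξ ha
    have hn : ‖u'‖ ^ 2 = ∫ t, ‖u t‖ ^ 2 := by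
      rw [norm_sq_L2]
      exact integral_congr_ae (e1.mono fun t ht => by simp only [ht])
    refine ⟨u', v', m, hK, ?_, ?_⟩
    · rintro rfl
      rw [norm_zero] at hn
      rw [← hn] at hpos
      simp at hpos
    · rw [hn, norm_sq_fiberSpace hK]
      congr 1
      refine integral_congr_ae ?_
      filter_upwards [e1, e2] with t h1 h2
      rw [h1, h2]
  · rintro ⟨u, v, m, hK, hu, rfl⟩
    refine ⟨u, v, memB1_of_mem_fiberSpace ha hK, ?_, ?_⟩
    · rw [← norm_sq_L2]; positivity
    · rw [norm_sq_fiberSpace hK, norm_sq_L2 u]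

/-! ### Compactness of the embedding of the fiber form domain -/

lemma isCompactOperator_of_forall_exists_finiteDimensional {L H : Type*} [NormedAddCommGroup L]
    [NormedSpace ℂ L] [NormedAddCommGroup H] [InnerProductSpace ℂ H] [CompleteSpace H]
    (J : L →L[ℂ] H) (h : ∀ ε > 0, ∃ W : Submodule ℂ H, FiniteDimensional ℂ W ∧
      ∀ k : L, ∃ w ∈ W, ‖J k - w‖ ≤ ε * ‖k‖) : IsCompactOperator J := by
  -- The orthogonal projections onto these spaces, composed with `J`, have finite rank and converge
  -- to `J` in norm.
  choose W hW hwk using fun n : ℕ => h (1 / ((n : ℝ) + 1)) (by positivity)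
  refine isCompactOperator_of_tendsto (F := fun n => (W n).starProjection.comp J) (l := atTop)
    ?_ (Eventually.of_forall fun n => ?_)
  · rw [tendsto_iff_norm_sub_tendsto_zero]
    refine squeeze_zero (fun _ => norm_nonneg _) (fun n => ?_)
      tendsto_one_div_add_atTop_nhds_zero_nat
    refine ContinuousLinearMap.opNorm_le_bound _ (by positivity) fun k => ?_
    obtain ⟨w, hw, hle⟩ := hwk n k
    refine le_trans ?_ hle
    have h1 : ‖J k - (W n).starProjection (J k)‖ ≤ ‖J k - w‖ := by
      rw [Submodule.starProjection_minimal]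
      exact ciInf_le ⟨0, by rintro _ ⟨x, rfl⟩; exact norm_nonneg _⟩ (⟨w, hw⟩ : W n)
    rw [norm_sub_rev] at h1
    exact h1
  · have h1 : IsCompactOperator (W n).subtypeL := by
      have : ProperSpace (W n) := FiniteDimensional.proper_rclike ℂ (W n)
      exact isCompactOperator_id.clm_comp _
    exact h1.comp_clm ((W n).orthogonalProjectionOnto.comp J)

lemma IsPrim.norm_sub_sq_le {J : Set ℝ} {U v : ℝ → ℂ} (hU : IsPrim J U v) {s t : ℝ} (hs : s ∈ J)
    (ht : t ∈ J) (hst : s ≤ t) (hv : IntervalIntegrable (fun x => ‖v x‖ ^ 2) volume s t) :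
    ‖U t - U s‖ ^ 2 ≤ (t - s) * ∫ x in s..t, ‖v x‖ ^ 2 := by
  obtain ⟨h1, h2⟩ := hU s hs t ht
  rcases hst.eq_or_lt with rfl | hlt
  · simp
  set B := ∫ x in s..t, ‖v x‖ with hB
  have h3 : ‖U t - U s‖ ≤ B := by
    rw [h2]; exact intervalIntegral.norm_integral_le_integral_norm hst
  have hl : 0 < t - s := sub_pos.mpr hlt
  -- The variance of `‖v‖` over the interval is nonnegative; this is the Cauchy–Schwarz inequality
  -- in the form needed.
  have h4 : 0 ≤ ∫ x in s..t, (‖v x‖ - B / (t - s)) ^ 2 :=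
    intervalIntegral.integral_nonneg hst fun x _ => sq_nonneg _
  have h5 : ∫ x in s..t, (‖v x‖ - B / (t - s)) ^ 2 =
      (∫ x in s..t, ‖v x‖ ^ 2) - 2 * (B / (t - s)) * B + (t - s) * (B / (t - s)) ^ 2 := by
    have : ∀ x, (‖v x‖ - B / (t - s)) ^ 2 =
        ‖v x‖ ^ 2 - 2 * (B / (t - s)) * ‖v x‖ + (B / (t - s)) ^ 2 := fun x => by ring
    simp only [this]
    rw [intervalIntegral.integral_add (hv.sub (h1.norm.const_mul _)) intervalIntegrable_const,
      intervalIntegral.integral_sub hv (h1.norm.const_mul _), intervalIntegral.integral_const_mul,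
      intervalIntegral.integral_const, smul_eq_mul, hB]
  rw [h5] at h4
  have h6 : B ^ 2 ≤ (t - s) * ∫ x in s..t, ‖v x‖ ^ 2 := by
    have : (∫ x in s..t, ‖v x‖ ^ 2) - 2 * (B / (t - s)) * B + (t - s) * (B / (t - s)) ^ 2 =
      ((t - s) * (∫ x in s..t, ‖v x‖ ^ 2) - B ^ 2) / (t - s) := by field_simp; ring
    rw [this, div_nonneg_iff] at h4
    rcases h4 with h4 | h4 <;> linarith [h4.1, h4.2]
  exact (pow_le_pow_left₀ (norm_nonneg _) h3 2).trans h6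

/-- The step function with value `c k` on `(x k, x (k + 1)]`, `k < N`. -/
noncomputable def stepFun (x : ℕ → ℝ) (N : ℕ) (c : ℕ → ℂ) (t : ℝ) : ℂ :=
  ∑ k ∈ Finset.range N, (Ioc (x k) (x (k + 1))).indicator (fun _ => c k) t

lemma stepFun_of_mem {x : ℕ → ℝ} (hx : Monotone x) {N : ℕ} (c : ℕ → ℂ) {k : ℕ} (hk : k < N) {t : ℝ}
    (ht : t ∈ Ioc (x k) (x (k + 1))) : stepFun x N c t = c k := by
  rw [stepFun, Finset.sum_eq_single k]
  · rw [indicator_of_mem ht]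
  · intro j _ hj
    refine indicator_of_notMem (fun h => ?_) _
    exact (disjoint_left.mp (hx.pairwise_disjoint_on_Ioc_succ hj)) h ht
  · intro h; exact absurd (Finset.mem_range.mpr hk) h

lemma stepFun_of_notMem {x : ℕ → ℝ} (hx : Monotone x) {N : ℕ} (c : ℕ → ℂ) {t : ℝ}
    (ht : t ∉ Ioc (x 0) (x N)) : stepFun x N c t = 0 := by
  refine Finset.sum_eq_zero fun k hk => indicator_of_notMem (fun h => ht ?_) _
  exact ⟨(hx (Nat.zero_le k)).trans_lt h.1, h.2.trans (hx (Finset.mem_range.mp hk))⟩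

lemma memLp_stepFun (x : ℕ → ℝ) (N : ℕ) (c : ℕ → ℂ) : MemLp (stepFun x N c) 2 volume := by
  unfold stepFun
  exact memLp_finsetSum (Finset.range N) fun k _ =>
    memLp_indicator_const 2 measurableSet_Ioc (c k) (Or.inr measure_Ioc_lt_top.ne)

/-- The space of step functions on a grid. -/
noncomputable def stepSpace (x : ℕ → ℝ) (N : ℕ) : Submodule ℂ L2Line :=
  Submodule.span ℂ ((fun k => indicatorConstLp 2 (measurableSet_Ioc (a := x k) (b := x (k + 1)))
    measure_Ioc_lt_top.ne (1 : ℂ)) '' (Finset.range N : Set ℕ))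

instance (x : ℕ → ℝ) (N : ℕ) : FiniteDimensional ℂ (stepSpace x N) :=
  FiniteDimensional.span_of_finite ℂ ((Finset.finite_toSet _).image _)

lemma toLp_stepFun_mem (x : ℕ → ℝ) (N : ℕ) (c : ℕ → ℂ) :
    (memLp_stepFun x N c).toLp (stepFun x N c) ∈ stepSpace x N := by
  suffices h : ∀ M ≤ N, (memLp_stepFun x M c).toLp (stepFun x M c) ∈ stepSpace x N from h N le_rfl
  intro M
  induction M with
  | zero =>
    intro _
    have : (memLp_stepFun x 0 c).toLp (stepFun x 0 c) = 0 := by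
      rw [Lp.ext_iff]
      filter_upwards [(memLp_stepFun x 0 c).coeFn_toLp, Lp.coeFn_zero ℂ 2 volume] with t h1 h2
      rw [h1, h2]; simp [stepFun]
    rw [this]; exact Submodule.zero_mem _
  | succ M ih =>
    intro hM
    have h2 : MemLp ((Ioc (x M) (x (M + 1))).indicator (fun _ => (1 : ℂ))) 2 volume :=
      memLp_indicator_const 2 measurableSet_Ioc 1 (Or.inr measure_Ioc_lt_top.ne)
    have : (memLp_stepFun x (M + 1) c).toLp (stepFun x (M + 1) c) =
        (memLp_stepFun x M c).toLp (stepFun x M c) + c M • h2.toLp _ := by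
      rw [← MemLp.toLp_const_smul, ← MemLp.toLp_add]
      refine MemLp.toLp_congr _ _ (ae_of_all _ fun t => ?_)
      simp only [stepFun, Finset.sum_range_succ, Pi.add_apply, Pi.smul_apply, smul_eq_mul]
      congr 1
      by_cases h : t ∈ Ioc (x M) (x (M + 1)) <;> simp [h]
    rw [this]
    refine Submodule.add_mem _ (ih (by omega)) (Submodule.smul_mem _ _ ?_)
    exact Submodule.subset_span ⟨M, by simpa using hM, rfl⟩

/-- On a cell of length `l`, Cauchy–Schwarz bounds the pointwise squared error by `l` times the
energy of the cell; integration adds the second factor `l`. -/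
lemma IsPrim.integral_sub_stepFun_le {U v : ℝ → ℂ} (hU : IsPrim univ U v)
    (hv : Integrable (fun t => ‖v t‖ ^ 2)) (y l : ℝ) (hl : 0 < l) (N : ℕ) :
    ∫ t in Ioc y (y + N * l), ‖U t - stepFun (fun k => y + k * l) N (fun k => U (y + k * l)) t‖ ^ 2 ≤
      l ^ 2 * ∫ t, ‖v t‖ ^ 2 := by
  set x : ℕ → ℝ := fun k => y + k * l with hx
  have hmono : Monotone x := fun i j hij => by
    simp only [hx]
    have : (i : ℝ) ≤ j := by exact_mod_cast hij
    nlinarith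
  have hstep : ∀ k, x (k + 1) = x k + l := fun k => by simp only [hx]; push_cast; ring
  set g : ℝ → ℝ := fun t => ‖U t - stepFun x N (fun k => U (x k)) t‖ ^ 2 with hg
  have hvi : ∀ s t, IntervalIntegrable (fun x => ‖v x‖ ^ 2) volume s t :=
    fun s t => hv.intervalIntegrable
  have hUc : Continuous U := hU.continuous
  have key : ∀ k < N, IntervalIntegrable g volume (x k) (x (k + 1)) ∧
      ∫ t in x k..x (k + 1), g t ≤ l ^ 2 * ∫ t in x k..x (k + 1), ‖v t‖ ^ 2 := by
    intro k hk
    have hle : x k ≤ x (k + 1) := hmono (Nat.le_succ k)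
    have hcongr : ∀ t ∈ Ioc (x k) (x (k + 1)), g t = ‖U t - U (x k)‖ ^ 2 := fun t ht => by
      simp only [hg, stepFun_of_mem hmono (fun k => U (x k)) hk ht]
    have hi : IntervalIntegrable (fun t => ‖U t - U (x k)‖ ^ 2) volume (x k) (x (k + 1)) :=
      Continuous.intervalIntegrable (by fun_prop) _ _
    refine ⟨hi.congr (fun t ht => ?_), ?_⟩
    · rw [uIoc_of_le hle] at ht
      exact (hcongr t ht).symm
    · calc ∫ t in x k..x (k + 1), g t = ∫ t in x k..x (k + 1), ‖U t - U (x k)‖ ^ 2 :=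
            intervalIntegral.integral_congr_ae (ae_of_all _ fun t ht => by
              rw [uIoc_of_le hle] at ht; exact hcongr t ht)
        _ ≤ ∫ t in x k..x (k + 1), l * ∫ t in x k..x (k + 1), ‖v t‖ ^ 2 := by
            refine intervalIntegral.integral_mono_on hle hi intervalIntegrable_const fun t ht => ?_
            refine (hU.norm_sub_sq_le (mem_univ _) (mem_univ _) ht.1 (hvi _ _)).trans ?_
            have h1 : ∫ s in x k..t, ‖v s‖ ^ 2 ≤ ∫ s in x k..x (k + 1), ‖v s‖ ^ 2 :=
              intervalIntegral.integral_mono_interval le_rfl ht.1 ht.2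
                (ae_of_all _ fun s => sq_nonneg _) (hvi _ _)
            have h2 : 0 ≤ ∫ s in x k..t, ‖v s‖ ^ 2 :=
              intervalIntegral.integral_nonneg ht.1 fun s _ => sq_nonneg _
            have h3 : t - x k ≤ l := by linarith [ht.2, hstep k]
            exact mul_le_mul h3 h1 h2 hl.le
        _ = _ := by rw [intervalIntegral.integral_const, hstep k, smul_eq_mul]; ring
  have hx0 : x 0 = y := by simp [hx]
  have hxN : y ≤ x N := hx0 ▸ hmono (Nat.zero_le N)
  change ∫ t in Ioc y (x N), g t ≤ _
  rw [← intervalIntegral.integral_of_le hxN]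
  conv_lhs => rw [← hx0]
  rw [← intervalIntegral.sum_integral_adjacent_intervals fun k hk => (key k hk).1]
  calc _ ≤ ∑ k ∈ Finset.range N, l ^ 2 * ∫ t in x k..x (k + 1), ‖v t‖ ^ 2 :=
        Finset.sum_le_sum fun k hk => (key k (Finset.mem_range.mp hk)).2
    _ = l ^ 2 * ∫ t in y..x N, ‖v t‖ ^ 2 := by
        rw [← Finset.mul_sum, intervalIntegral.sum_integral_adjacent_intervals fun k _ => hvi _ _, hx0]
    _ ≤ _ := by
        refine mul_le_mul_of_nonneg_left ?_ (sq_nonneg l)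
        rw [intervalIntegral.integral_of_le hxN]
        exact setIntegral_le_integral hv (ae_of_all _ fun t => sq_nonneg _)

/-- Inside a large interval `u` is close to a step function on a grid of width `ε`, with error
controlled by `v`. Outside it the potential is at least `ε⁻²`, so `|u| ≤ ε|m|`. -/
lemma isCompactOperator_formEmb_fiberSpace {a : ℝ} (ξ : ℝ) (ha : a ∈ Ioo (-1 : ℝ) 0) :
    IsCompactOperator (formEmb (fiberSpace a ξ)) := by
  refine isCompactOperator_of_forall_exists_finiteDimensional (L := fiberSpace a ξ) _
    fun ε hε => ?_
  have hpos : 0 < |a| := abs_pos.mpr ha.2.ne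
  have ha1 : |a| ≤ 1 := abs_le.mpr ⟨ha.1.le, ha.2.le.trans zero_le_one⟩
  -- For `|t| ≥ R` one has `|σt| ≥ |a|R = |ξ| + 1/ε`, hence `|ξ + σt| ≥ 1/ε`.
  set R : ℝ := (|ξ| + 1 / ε) / |a| with hR
  have hR0 : 0 < R := by positivity
  obtain ⟨N, hN⟩ := exists_nat_ge (2 * R / ε)
  have hN' : 2 * R ≤ N * ε := (div_le_iff₀ hε).mp hN
  refine ⟨stepSpace (fun k => -R + k * ε) N, inferInstance, fun k => ?_⟩
  obtain ⟨u, v, m, h, rfl⟩ := exists_triple_eq (fiberSpace a ξ) k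
  obtain ⟨U, hU, huU⟩ := (memB1_of_mem_fiberSpace ha h).exists_isPrim
  have hm := ((mem_fiberSpace_iff a ξ u v m).mp h).2
  set w := stepFun (fun k => -R + k * ε) N (fun k => U (-R + k * ε)) with hw
  have hwL : MemLp w 2 volume := memLp_stepFun _ _ _
  refine ⟨hwL.toLp w, toLp_stepFun_mem _ _ _, ?_⟩
  refine le_of_sq_le_sq ?_ (by positivity)
  rw [formEmb_mk, mul_pow, norm_sq_mk]
  have hv2 : Integrable (fun t => ‖v t‖ ^ 2) := (Lp.memLp v).integrable_norm_pow two_ne_zero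
  have hm2 : Integrable (fun t => ‖m t‖ ^ 2) := (Lp.memLp m).integrable_norm_pow two_ne_zero
  have hUL : MemLp U 2 volume := (memLp_congr_ae huU).mp (Lp.memLp u)
  have hi : Integrable (fun t => ‖U t - w t‖ ^ 2) := (hUL.sub hwL).integrable_norm_pow two_ne_zero
  have e1 : ‖u - hwL.toLp w‖ ^ 2 = ∫ t, ‖U t - w t‖ ^ 2 := by
    rw [norm_sq_L2]
    refine integral_congr_ae ?_
    filter_upwards [Lp.coeFn_sub u (hwL.toLp w), hwL.coeFn_toLp, huU] with t h1 h2 h3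
    rw [h1, Pi.sub_apply, h2, h3]
  have e2 := hU.integral_sub_stepFun_le hv2 (-R) ε hε N
  have e3 : ∫ t in (Ioc (-R) (-R + N * ε))ᶜ, ‖U t - w t‖ ^ 2 ≤ ε ^ 2 * ∫ t, ‖m t‖ ^ 2 := by
    calc _ ≤ ∫ t in (Ioc (-R) (-R + N * ε))ᶜ, ε ^ 2 * ‖m t‖ ^ 2 := by
          refine setIntegral_mono_ae_restrict hi.integrableOn (hm2.const_mul _).integrableOn ?_
          filter_upwards [ae_restrict_mem measurableSet_Ioc.compl, ae_restrict_of_ae hm,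
            ae_restrict_of_ae huU] with t ht h2 h3
          have hmono : Monotone (fun k : ℕ => -R + k * ε) := fun i j hij => by
            have : (i : ℝ) ≤ j := by exact_mod_cast hij
            simp only; nlinarith
          have hw0 : w t = 0 := stepFun_of_notMem hmono _ (by simpa using ht)
          rw [hw0, sub_zero, ← h3, h2, norm_mul, Complex.norm_real, Real.norm_eq_abs, ← mul_pow]
          refine pow_le_pow_left₀ (norm_nonneg _) ?_ 2
          rw [← mul_assoc]
          refine le_mul_of_one_le_left (norm_nonneg _) ?_
          have ht' : R ≤ |t| := by
            by_contra hlt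
            rw [not_le, abs_lt] at hlt
            exact ht ⟨hlt.1, by linarith [hlt.2]⟩
          have b1 := le_abs_ramp ha1 t
          have b2 : |ramp a t| ≤ |ξ + ramp a t| + |ξ| := by
            have := abs_sub (ξ + ramp a t) ξ
            rwa [add_sub_cancel_left] at this
          have b3 : |a| * R = |ξ| + 1 / ε := by rw [hR]; field_simp
          have b4 : |a| * R ≤ |a| * |t| := by gcongr
          have b5 : 1 / ε ≤ |ξ + ramp a t| := by linarith
          rw [div_le_iff₀ hε] at b5
          linarith
      _ = ε ^ 2 * ∫ t in (Ioc (-R) (-R + N * ε))ᶜ, ‖m t‖ ^ 2 := integral_const_mul _ _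
      _ ≤ _ := mul_le_mul_of_nonneg_left
          (setIntegral_le_integral hm2 (ae_of_all _ fun t => sq_nonneg _)) (sq_nonneg ε)
  rw [e1, ← integral_add_compl measurableSet_Ioc hi, norm_sq_L2 v, norm_sq_L2 m]
  nlinarith [mul_nonneg (sq_nonneg ε) (sq_nonneg ‖u‖)]

/-! ### The first eigenvalue of the fiber operator -/

lemma continuous_V (a ξ : ℝ) : Continuous (V a ξ) := by
  rw [show V a ξ = fun t => (ξ + ramp a t) ^ 2 from funext (V_eq a ξ)]
  exact (continuous_const.add (continuous_ramp a)).pow 2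

lemma IsTest.triple_mem_fiberSpace (a ξ : ℝ) {φ : ℝ → ℂ} (h : IsTest φ) :
    triple (h.memLp.toLp φ) ((h.memLp_deriv 1).toLp _)
      ((h.memLp_mul (w := fun t => ((ξ + ramp a t : ℝ) : ℂ))
        (Complex.continuous_ofReal.comp (continuous_const.add (continuous_ramp a)))).toLp _) ∈
      fiberSpace a ξ := by
  rw [mem_fiberSpace_iff]
  constructor
  · exact ((isPrim_of_contDiff h.contDiff univ).hasWeakDerivOn ordConnected_univ isOpen_univ
      subset_rfl).congr h.memLp.coeFn_toLp.symm (h.memLp_deriv 1).coeFn_toLp.symm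
  · filter_upwards [h.memLp.coeFn_toLp, (h.memLp_mul (w := fun t => ((ξ + ramp a t : ℝ) : ℂ))
      (Complex.continuous_ofReal.comp (continuous_const.add (continuous_ramp a)))).coeFn_toLp]
      with t h1 h2
    rw [h1, h2]

lemma exists_isTest_pos : ∃ φ : ℝ → ℂ, IsTest φ ∧ 0 < ∫ t, ‖φ t‖ ^ 2 := by
  let b : ContDiffBump (0 : ℝ) := ⟨1, 2, one_pos, one_lt_two⟩
  have hb : IsTest (fun t => (b t : ℂ)) :=
    ⟨Complex.ofRealCLM.contDiff.comp b.contDiff,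
      b.hasCompactSupport.comp_left Complex.ofReal_zero⟩
  refine ⟨_, hb, ?_⟩
  refine Continuous.integral_pos_of_hasCompactSupport_nonneg_nonzero (x := 0) ?_ ?_ ?_ ?_
  · have := hb.contDiff.continuous; fun_prop
  · exact hb.hasCompactSupport.comp_left (g := fun z : ℂ => ‖z‖ ^ 2) (by simp)
  · exact fun t => sq_nonneg _
  · have : b (0 : ℝ) = 1 := b.one_of_mem_closedBall (by simp [b.rIn_pos.le])
    simp [this]

lemma formQuotients_fiberSpace_nonempty (a ξ : ℝ) : (formQuotients (fiberSpace a ξ)).Nonempty := by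
  obtain ⟨φ, h, hpos⟩ := exists_isTest_pos
  refine ⟨_, _, _, _, h.triple_mem_fiberSpace a ξ, fun h0 => ?_, rfl⟩
  have h1 := norm_sq_toLp (h.memLp (μ := volume))
  rw [h0] at h1
  rw [← h1] at hpos
  simp at hpos

/-- The weak second derivative makes `v` itself an indefinite integral. Then `∫ (conj u · v)' = 0`
says that the form of `u` equals `r‖u‖²`. -/
lemma mem_fiberQuotients_of_isEigenvalue {a ξ : ℝ} (ha : a ∈ Ioo (-1 : ℝ) 0) {r : ℝ}
    (h : IsEigenvalue (fiberOp a ξ) (r : ℂ)) : r ∈ fiberQuotients a ξ := by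
  obtain ⟨u, hu, v, hB, hv⟩ := h
  simp only at hB hv
  have hsm : (fun t => (V a ξ t : ℂ) * u t - ((r : ℂ) • u) t) =ᵐ[volume]
      fun t => ((V a ξ t - r : ℝ) : ℂ) * u t := by
    filter_upwards [Lp.coeFn_smul (r : ℂ) u] with t ht
    rw [ht]; simp only [Pi.smul_apply, smul_eq_mul]; push_cast; ring
  have hv2 := hv.congr (ae_eq_refl _) hsm
  have hVc : Continuous (fun t => ((V a ξ t - r : ℝ) : ℂ)) :=
    Complex.continuous_ofReal.comp ((continuous_V a ξ).sub continuous_const)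
  have hvL : MemLp v 2 volume := by simpa using hB.memLp_deriv
  obtain ⟨U, hU, huU⟩ := hB.exists_isPrim
  obtain ⟨W, hW, hvW⟩ := hv2.exists_isPrim isOpen_univ ordConnected_univ
    ((hvL.locallyIntegrable one_le_two).locallyIntegrableOn _)
    ((((Lp.memLp u).locallyIntegrable one_le_two).continuous_mul hVc).locallyIntegrableOn _)
  replace hvW : v =ᵐ[volume] W := hvW.mono fun t ht => ht (mem_univ t)
  have hP := ((hU.conj).mul ordConnected_univ hW).map Complex.reCLM
  set f : ℝ → ℝ := fun t => (conj (v t) * W t + conj (U t) * (((V a ξ t - r : ℝ) : ℂ) * u t)).re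
    with hf
  have hfe : f =ᵐ[volume] fun t => (‖v t‖ ^ 2 + V a ξ t * ‖u t‖ ^ 2) - r * ‖u t‖ ^ 2 := by
    filter_upwards [huU, hvW] with t h1 h2
    simp only [hf, ← h1, ← h2]
    simp only [← Complex.normSq_eq_norm_sq, Complex.normSq_apply, Complex.add_re, Complex.mul_re,
      Complex.mul_im, Complex.ofReal_re, Complex.ofReal_im, Complex.conj_re, Complex.conj_im]
    ring
  obtain ⟨u', v', m, hK, e1, e2⟩ := hB.exists_mem_fiberSpace ξ ha
  have hm := ((mem_fiberSpace_iff a ξ u' v' m).mp hK).2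
  have i1 : Integrable (fun t => ‖v t‖ ^ 2) := hvL.integrable_norm_pow two_ne_zero
  have i2 : Integrable (fun t => V a ξ t * ‖u t‖ ^ 2) := by
    refine ((Lp.memLp m).integrable_norm_pow two_ne_zero).congr ?_
    filter_upwards [hm, e1] with t h1 h2
    rw [h1, h2, norm_mul, Complex.norm_real, mul_pow, Real.norm_eq_abs, sq_abs, V_eq]
  have i3 : Integrable (fun t => ‖u t‖ ^ 2) := (Lp.memLp u).integrable_norm_pow two_ne_zero
  have i12 : Integrable (fun t => ‖v t‖ ^ 2 + V a ξ t * ‖u t‖ ^ 2) := i1.add i2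
  have hfi : Integrable f := (i12.sub (i3.const_mul r)).congr hfe.symm
  have hFi : Integrable (fun t => (conj (U t) * W t).re) := by
    have hUL : MemLp U 2 volume := (memLp_congr_ae huU).mp (Lp.memLp u)
    have hWL : MemLp W 2 volume := (memLp_congr_ae hvW).mp hvL
    exact (hUL.star.integrable_mul hWL).re
  have h0 : ∫ t, f t = 0 := IsPrim.integral_eq_zero (F := fun t => (conj (U t) * W t).re) hP hFi hfi
  rw [integral_congr_ae hfe, integral_sub i12 (i3.const_mul r), integral_const_mul,
    sub_eq_zero] at h0
  have hpos : 0 < ∫ t, ‖u t‖ ^ 2 := by rw [← norm_sq_L2]; positivity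
  refine ⟨u, v, hB, hpos, ?_⟩
  rw [eq_div_iff hpos.ne', ← h0]

lemma IsTest.star {φ : ℝ → ℂ} (h : IsTest φ) : IsTest (star φ) :=
  ⟨Complex.conjCLE.contDiff.comp h.contDiff, h.hasCompactSupport.comp_left (star_zero ℂ)⟩

lemma fderiv_star_apply {φ : ℝ → ℂ} (h : IsTest φ) :
    (fun t => fderiv ℝ (star φ) t 1) = star (fun t => fderiv ℝ φ t 1) := by
  ext t
  have hφ := (h.contDiff.differentiable (by simp)) t
  have h1 := hφ.hasFDerivAt.star.fderiv
  change fderiv ℝ (fun t => star (φ t)) t 1 = _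
  rw [h1]
  rfl

/-- The form identity is tested with the conjugate of `φ`, since the inner product is conjugate
linear in its first argument. -/
lemma hasWeakDerivOn_of_form_eq {a ξ c : ℝ} {u v m : L2Line}
    (hm : m =ᵐ[volume] fun t => ((ξ + ramp a t : ℝ) : ℂ) * u t)
    (hform : ∀ w q e : L2Line, triple w q e ∈ fiberSpace a ξ →
      inner ℂ q v + inner ℂ e m = inner ℂ w ((c : ℂ) • u)) :
    HasWeakDerivOn univ (1 : ℝ) v (fun t => (V a ξ t : ℂ) * u t - ((c : ℂ) • u) t) := by
  intro φ h1 h2 _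
  have ht : IsTest φ := ⟨h1, h2⟩
  have htc := ht.star
  have key := hform _ _ _ (htc.triple_mem_fiberSpace a ξ)
  set w : ℝ → ℂ := fun t => ((ξ + ramp a t : ℝ) : ℂ) with hw
  have hwc : Continuous w :=
    Complex.continuous_ofReal.comp (continuous_const.add (continuous_ramp a))
  have k1 : inner ℂ ((htc.memLp_deriv 1).toLp _) v = ∫ t, v t * fderiv ℝ φ t 1 := by
    rw [← inner_toLp_star (ht.memLp_deriv 1)]
    congr 1
    exact MemLp.toLp_congr _ _ (ae_of_all _ fun t => congrFun (fderiv_star_apply ht) t)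
  have k2 : inner ℂ ((htc.memLp_mul hwc).toLp _) m = ∫ t, m t * (w t * φ t) := by
    rw [← inner_toLp_star (ht.memLp_mul hwc)]
    congr 1
    refine MemLp.toLp_congr _ _ (ae_of_all _ fun t => ?_)
    simp only [Pi.star_apply, star_mul', hw]
    rw [← starRingEnd_apply, ← starRingEnd_apply, Complex.conj_ofReal]
  have k3 : inner ℂ (htc.memLp.toLp _) ((c : ℂ) • u) = ∫ t, ((c : ℂ) • u) t * φ t :=
    inner_toLp_star ht.memLp _
  rw [k1, k2, k3] at key
  have i1 : Integrable (fun t => m t * (w t * φ t)) := (Lp.memLp m).integrable_mul (ht.memLp_mul hwc)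
  have i2 : Integrable (fun t => ((c : ℂ) • u) t * φ t) :=
    (Lp.memLp ((c : ℂ) • u)).integrable_mul ht.memLp
  have k4 : ∫ t, ((V a ξ t : ℂ) * u t - ((c : ℂ) • u) t) * φ t =
      (∫ t, m t * (w t * φ t)) - ∫ t, ((c : ℂ) • u) t * φ t := by
    rw [← integral_sub i1 i2]
    refine integral_congr_ae ?_
    filter_upwards [hm] with t h
    rw [h, V_eq]; simp only [hw]; push_cast; ring
  rw [k4, ← key]
  ring

lemma isEigenvalue_mu {a : ℝ} (ha : a ∈ Ioo (-1 : ℝ) 0) (ξ : ℝ) :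
    IsLeast (fiberQuotients a ξ) (mu a ξ) ∧ IsEigenvalue (fiberOp a ξ) (mu a ξ : ℂ) := by
  obtain ⟨c, u, v, m, hleast, hu, hK, hform⟩ := exists_isLeast_formQuotients (fiberSpace a ξ)
    (isCompactOperator_formEmb_fiberSpace ξ ha) (formQuotients_fiberSpace_nonempty a ξ)
  rw [← fiberQuotients_eq ξ ha] at hleast
  have hmu : mu a ξ = c := hleast.csInf_eq
  rw [hmu]
  exact ⟨hleast, u, hu, v, memB1_of_mem_fiberSpace ha hK,
    hasWeakDerivOn_of_form_eq ((mem_fiberSpace_iff a ξ u v m).mp hK).2 hform⟩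

lemma isLeast_isEigenvalue_mu {a : ℝ} (ha : a ∈ Ioo (-1 : ℝ) 0) (ξ : ℝ) :
    IsLeast {r : ℝ | IsEigenvalue (fiberOp a ξ) (r : ℂ)} (mu a ξ) :=
  ⟨(isEigenvalue_mu ha ξ).2, fun _ hr =>
    (isEigenvalue_mu ha ξ).1.2 (mem_fiberQuotients_of_isEigenvalue ha hr)⟩

/-! ### The function `μ_a`: continuity, behaviour at infinity, existence of a minimum -/

lemma MemB1.integrable_fiber {a : ℝ} (ha : a ∈ Ioo (-1 : ℝ) 0) {u v : ℝ → ℂ}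
    (h : MemB1 univ u v) : Integrable (fun t => ‖u t‖ ^ 2) ∧ Integrable (fun t => ‖v t‖ ^ 2) ∧
      ∀ ξ, Integrable (fun t => V a ξ t * ‖u t‖ ^ 2) := by
  have hu : MemLp u 2 volume := by simpa using h.memLp
  have hv : MemLp v 2 volume := by simpa using h.memLp_deriv
  refine ⟨hu.integrable_norm_pow two_ne_zero, hv.integrable_norm_pow two_ne_zero, fun ξ => ?_⟩
  obtain ⟨u', v', m, hK, e1, e2⟩ := h.exists_mem_fiberSpace ξ ha
  have hm := ((mem_fiberSpace_iff a ξ u' v' m).mp hK).2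
  refine ((Lp.memLp m).integrable_norm_pow two_ne_zero).congr ?_
  filter_upwards [hm, e1] with t h1 h2
  rw [h1, h2, norm_mul, Complex.norm_real, mul_pow, Real.norm_eq_abs, sq_abs, V_eq]

lemma mu_le_of_memB1 {a : ℝ} (ha : a ∈ Ioo (-1 : ℝ) 0) (ξ : ℝ) {u v : ℝ → ℂ}
    (h : MemB1 univ u v) : mu a ξ * ∫ t, ‖u t‖ ^ 2 ≤ ∫ t, (‖v t‖ ^ 2 + V a ξ t * ‖u t‖ ^ 2) := by
  have h0 : 0 ≤ ∫ t, ‖u t‖ ^ 2 := integral_nonneg fun t => sq_nonneg _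
  rcases h0.eq_or_lt with h0 | h0
  · rw [← h0, mul_zero]
    refine integral_nonneg fun t => ?_
    simp only [Pi.zero_apply, V_eq]; positivity
  · rw [← le_div_iff₀ h0]
    exact (isEigenvalue_mu ha ξ).1.2 ⟨u, v, h, h0, rfl⟩

lemma le_mu_of_forall {a : ℝ} (ha : a ∈ Ioo (-1 : ℝ) 0) {ξ c : ℝ}
    (h : ∀ u v : ℝ → ℂ, MemB1 univ u v →
      c * ∫ t, ‖u t‖ ^ 2 ≤ ∫ t, (‖v t‖ ^ 2 + V a ξ t * ‖u t‖ ^ 2)) : c ≤ mu a ξ := by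
  obtain ⟨u, v, hB, h0, e⟩ := (isEigenvalue_mu ha ξ).1.1
  rw [e, le_div_iff₀ h0]
  exact h u v hB

lemma mu_nonneg {a : ℝ} (ha : a ∈ Ioo (-1 : ℝ) 0) (ξ : ℝ) : 0 ≤ mu a ξ :=
  le_mu_of_forall ha fun u v _ => by
    rw [zero_mul]
    refine integral_nonneg fun t => ?_
    simp only [Pi.zero_apply, V_eq]; positivity

/-- Since `a < 0`, the function `σt` is nonnegative on both sides, so the potential is at least
`ξ²`. -/
lemma sq_le_mu {a : ℝ} (ha : a ∈ Ioo (-1 : ℝ) 0) {ξ : ℝ} (hξ : 0 ≤ ξ) : ξ ^ 2 ≤ mu a ξ := by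
  refine le_mu_of_forall ha fun u v h => ?_
  obtain ⟨i1, i2, i3⟩ := h.integrable_fiber ha
  rw [← integral_const_mul]
  refine integral_mono (i1.const_mul _) (i2.add (i3 ξ)) fun t => ?_
  have : ξ ≤ ξ + ramp a t := by
    rcases le_total 0 t with ht | ht
    · rw [ramp_of_nonneg a ht]; linarith
    · rw [ramp_of_nonpos a ht]; nlinarith [ha.2]
  have h2 : ξ ^ 2 ≤ V a ξ t := by rw [V_eq]; exact pow_le_pow_left₀ hξ this 2
  simp only
  nlinarith [sq_nonneg ‖v t‖, mul_le_mul_of_nonneg_right h2 (sq_nonneg ‖u t‖)]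

/-- With `y = ξ + σt` and `d = |ξ' - ξ|`, the inequality `2|y|d ≤ d(y² + 1)` compares the potentials
pointwise. The minimizer at `ξ` then serves as trial function at `ξ'`. -/
lemma mu_le_add {a : ℝ} (ha : a ∈ Ioo (-1 : ℝ) 0) (ξ ξ' : ℝ) :
    mu a ξ' ≤ (1 + |ξ' - ξ|) * mu a ξ + (|ξ' - ξ| ^ 2 + |ξ' - ξ|) := by
  set d := |ξ' - ξ| with hd
  have hd0 : 0 ≤ d := abs_nonneg _
  obtain ⟨u, v, hB, h0, e⟩ := (isEigenvalue_mu ha ξ).1.1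
  obtain ⟨i1, i2, i3⟩ := hB.integrable_fiber ha
  have h1 := mu_le_of_memB1 ha ξ' hB
  rw [← mul_le_mul_iff_of_pos_right h0]
  refine h1.trans ?_
  have i23 : ∀ ξ, Integrable (fun t => ‖v t‖ ^ 2 + V a ξ t * ‖u t‖ ^ 2) := fun ξ => i2.add (i3 ξ)
  rw [e, add_mul, mul_assoc, div_mul_cancel₀ _ h0.ne', ← integral_const_mul, ← integral_const_mul,
    ← integral_add ((i23 ξ).const_mul _) (i1.const_mul _)]
  refine integral_mono (i23 ξ') (((i23 ξ).const_mul _).add (i1.const_mul _))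
    fun t => ?_
  have h2 : V a ξ' t ≤ (1 + d) * V a ξ t + (d ^ 2 + d) := by
    rw [V_eq, V_eq]
    set y := ξ + ramp a t
    have e1 : ξ' + ramp a t = y + (ξ' - ξ) := by simp only [y]; ring
    have e2 : (ξ' - ξ) ^ 2 = d ^ 2 := (sq_abs _).symm
    have e3 : 2 * y * (ξ' - ξ) ≤ d * y ^ 2 + d := by
      have : y * (ξ' - ξ) ≤ |y| * d := (le_abs_self _).trans (abs_mul _ _).le
      nlinarith [mul_nonneg hd0 (sq_nonneg (|y| - 1)), sq_abs y]
    rw [e1]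
    nlinarith
  simp only
  nlinarith [mul_nonneg hd0 (sq_nonneg ‖v t‖), mul_le_mul_of_nonneg_right h2 (sq_nonneg ‖u t‖)]

lemma continuous_mu {a : ℝ} (ha : a ∈ Ioo (-1 : ℝ) 0) : Continuous (mu a) := by
  rw [continuous_iff_continuousAt]
  intro ξ
  have hpos : ∀ x : ℝ, (1 + |x - ξ|) ≠ 0 := fun x => by positivity
  have hl : Tendsto (fun x => (mu a ξ - (|x - ξ| ^ 2 + |x - ξ|)) / (1 + |x - ξ|)) (𝓝 ξ)
      (𝓝 (mu a ξ)) := by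
    have : Continuous (fun x => (mu a ξ - (|x - ξ| ^ 2 + |x - ξ|)) / (1 + |x - ξ|)) := by
      fun_prop (disch := exact hpos _)
    simpa using this.tendsto ξ
  have hr : Tendsto (fun x => (1 + |x - ξ|) * mu a ξ + (|x - ξ| ^ 2 + |x - ξ|)) (𝓝 ξ)
      (𝓝 (mu a ξ)) := by
    have : Continuous (fun x => (1 + |x - ξ|) * mu a ξ + (|x - ξ| ^ 2 + |x - ξ|)) := by fun_prop
    simpa using this.tendsto ξ
  refine tendsto_of_tendsto_of_tendsto_of_le_of_le hl hr (fun x => ?_) (fun x => mu_le_add ha ξ x)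
  have := mu_le_add ha x ξ
  rw [abs_sub_comm ξ x] at this
  have h0 : 0 < 1 + |x - ξ| := by positivity
  simp only
  rw [div_le_iff₀ h0]
  linarith

/-- Far to the left, `μ_a` is almost bounded below by `|a|`. -/
lemma mul_abs_le_mu {a : ℝ} (ha : a ∈ Ioo (-1 : ℝ) 0) {θ m : ℝ} (hθ0 : 0 < θ) (hθ1 : θ < 1)
    (hm : 0 < m) (hθm : 8 ≤ (1 - θ ^ 2) * m ^ 2) : θ * |a| ≤ mu a (-m) := by
  obtain ⟨ha1, ha0⟩ := ha
  have hA : |a| = -a := abs_of_neg ha0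
  set A := |a| with hAdef
  have haA : a = -A := by linarith
  have hA0 : 0 < A := by linarith
  have hA1 : A < 1 := by linarith
  refine le_mu_of_forall ⟨ha1, ha0⟩ fun u v hB => ?_
  obtain ⟨i1, i2, i3⟩ := hB.integrable_fiber ⟨ha1, ha0⟩
  obtain ⟨U, hU, huU⟩ := hB.exists_isPrim
  have hUm : MemLp U 2 volume := (memLp_congr_ae huU).mp (by simpa using hB.memLp)
  have hvm : MemLp v 2 volume := by simpa using hB.memLp_deriv
  have htm : MemLp (fun t : ℝ => (t : ℂ) * U t) 2 volume := by
    have h1 : MemLp (fun t : ℝ => (t : ℂ) * u t) 2 volume := by simpa using hB.memLp_mul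
    exact (memLp_congr_ae (huU.mono fun t ht => by simp only [ht])).mp h1
  -- The square is completed with the continuous piecewise affine `g` equal to `-θ(m + At)` on the
  -- left, `t` in the middle and `θ(m - t)` on the right. The pieces meet at `s₁` and `s₂`, so the
  -- boundary terms cancel in the sum. It remains to check `g' + g² ≤ V - θA` on each piece.
  set s₁ : ℝ := -(θ * m / (1 + θ * A)) with hs1
  set s₂ : ℝ := θ * m / (1 + θ) with hs2
  have hp1 : 0 < 1 + θ * A := by positivity
  have hp2 : 0 < 1 + θ := by positivity
  have hs12 : s₁ ≤ s₂ := by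
    have h1 : 0 ≤ θ * m / (1 + θ * A) := by positivity
    have h2 : 0 ≤ s₂ := by positivity
    linarith
  have e1 : s₁ * (1 + θ * A) = -(θ * m) := by rw [hs1]; field_simp
  have e2 : s₂ * (1 + θ) = θ * m := by rw [hs2]; field_simp
  set W : ℝ → ℝ := fun t => ‖v t‖ ^ 2 + (V a (-m) t - θ * A) * ‖U t‖ ^ 2 with hW
  have hWi : Integrable W := by
    have : Integrable (fun t => (‖v t‖ ^ 2 + V a (-m) t * ‖u t‖ ^ 2) - θ * A * ‖u t‖ ^ 2) :=
      (i2.add (i3 (-m))).sub (i1.const_mul _)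
    refine this.congr ?_
    filter_upwards [huU] with t ht
    simp only [hW, ht]; ring
  have hVl : ∀ t ≤ 0, V a (-m) t = (m + A * t) ^ 2 := fun t ht => by
    rw [V_eq, ramp_of_nonpos a ht, haA]; ring
  have hVr : ∀ t, 0 ≤ t → V a (-m) t = (m - t) ^ 2 := fun t ht => by
    rw [V_eq, ramp_of_nonneg a ht]; ring
  have hs1n : s₁ ≤ 0 := by rw [hs1]; exact neg_nonpos.mpr (by positivity)
  have hs2n : 0 ≤ s₂ := by positivity
  have hUi2 : ∀ α β : ℝ, Integrable (fun x => ‖v x‖ ^ 2 + (α + (α * x + β) ^ 2) * ‖U x‖ ^ 2) := by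
    intro α β
    have h1 := (integrable_affine_data (S := univ) α β (by simpa using hUm) (by simpa using hvm)
      (by simpa using htm)).2.1
    rw [integrableOn_univ] at h1
    refine (i2.add (((hUm.integrable_norm_pow two_ne_zero).const_mul α).add h1)).congr
      (ae_of_all _ fun x => ?_)
    simp only [Pi.add_apply]; ring
  have left : s₁ * ‖U s₁‖ ^ 2 ≤ ∫ t in Iic s₁, W t := by
    have h := (hU.mono (subset_univ (Iic s₁))).riccati_Iic (-(θ * A)) (-(θ * m)) (hUm.restrict _)
      (hvm.restrict _) (htm.restrict _)
    have e3 : -(θ * A) * s₁ + -(θ * m) = s₁ := by linarith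
    rw [e3] at h
    refine h.trans (setIntegral_mono_on (hUi2 _ _).integrableOn hWi.integrableOn measurableSet_Iic
      fun t ht => ?_)
    simp only [hW]
    rw [hVl t ((mem_Iic.mp ht).trans hs1n)]
    have : -(θ * A) + (-(θ * A) * t + -(θ * m)) ^ 2 ≤ (m + A * t) ^ 2 - θ * A := by
      nlinarith [sq_nonneg (m + A * t), mul_nonneg (mul_nonneg (sub_nonneg.mpr hθ1.le) (by linarith : 0 ≤ 1 + θ)) (sq_nonneg (m + A * t))]
    gcongr
  have right : -(s₂ * ‖U s₂‖ ^ 2) ≤ ∫ t in Ioi s₂, W t := by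
    have h := (hU.mono (subset_univ (Ici s₂))).riccati_Ioi (-θ) (θ * m) (hUm.restrict _)
      (hvm.restrict _) (htm.restrict _)
    have e3 : -θ * s₂ + θ * m = s₂ := by linarith
    rw [e3] at h
    refine h.trans (setIntegral_mono_on (hUi2 _ _).integrableOn hWi.integrableOn measurableSet_Ioi
      fun t ht => ?_)
    simp only [hW]
    rw [hVr t (hs2n.trans (mem_Ioi.mp ht).le)]
    have : -θ + (-θ * t + θ * m) ^ 2 ≤ (m - t) ^ 2 - θ * A := by
      nlinarith [mul_nonneg (mul_nonneg (sub_nonneg.mpr hθ1.le) (by linarith : 0 ≤ 1 + θ)) (sq_nonneg (m - t))]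
    gcongr
  have mid : s₂ * ‖U s₂‖ ^ 2 - s₁ * ‖U s₁‖ ^ 2 ≤ ∫ t in s₁..s₂, W t := by
    have h := hU.riccati_Icc 1 0 ordConnected_univ (mem_univ s₁) (mem_univ s₂) hs12
      i2.intervalIntegrable
    simp only [one_mul, add_zero] at h
    refine h.trans (intervalIntegral.integral_mono_on hs12 ?_ hWi.intervalIntegrable fun t ht => ?_)
    · have := (hUi2 1 0).intervalIntegrable (a := s₁) (b := s₂)
      simpa only [one_mul, add_zero] using this
    simp only [hW]
    -- Here `y² = V`. The difference of the two sides is at least `(1 - θ²)y² - 2 ≥ (1 - θ²)m²/4 -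
    -- 2`, which explains the constant `8`.
    have aux : ∀ y : ℝ, m ≤ 2 * y → t ^ 2 ≤ θ ^ 2 * y ^ 2 → 1 + t ^ 2 ≤ y ^ 2 - θ * A := by
      intro y hy hty
      have h1 : m ^ 2 ≤ 4 * y ^ 2 := by nlinarith
      have h2 : 0 ≤ 1 - θ ^ 2 := by nlinarith
      nlinarith [mul_le_mul_of_nonneg_left h1 h2]
    have : 1 + t ^ 2 ≤ V a (-m) t - θ * A := by
      rcases le_total 0 t with h0 | h0
      · rw [hVr t h0]
        have h1 : t * (1 + θ) ≤ θ * m := by nlinarith [ht.2]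
        refine aux _ (by nlinarith) ?_
        rw [← mul_pow]; exact pow_le_pow_left₀ h0 (by linarith) 2
      · rw [hVl t h0]
        have h1 : -t * (1 + θ * A) ≤ θ * m := by nlinarith [ht.1]
        refine aux _ ?_ ?_
        · nlinarith [mul_pos hθ0 hA0, mul_le_mul_of_nonneg_left h1 hA0.le]
        · rw [← mul_pow, ← neg_sq t]; exact pow_le_pow_left₀ (by linarith) (by linarith) 2
    gcongr
  have tot : 0 ≤ ∫ t, W t := by
    rw [← integral_add_compl (measurableSet_Iic (a := s₁)) hWi, compl_Iic,
      ← Ioc_union_Ioi_eq_Ioi hs12, setIntegral_union (Ioc_disjoint_Ioi le_rfl) measurableSet_Ioi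
        hWi.integrableOn hWi.integrableOn, ← intervalIntegral.integral_of_le hs12]
    linarith
  have fin : ∫ t, W t = (∫ t, (‖v t‖ ^ 2 + V a (-m) t * ‖u t‖ ^ 2)) - θ * A * ∫ t, ‖u t‖ ^ 2 := by
    have i23 : Integrable (fun t => ‖v t‖ ^ 2 + V a (-m) t * ‖u t‖ ^ 2) := i2.add (i3 (-m))
    rw [← integral_const_mul, ← integral_sub i23 (i1.const_mul _)]
    refine integral_congr_ae ?_
    filter_upwards [huU] with t ht
    simp only [hW, ht]; ring
  linarith

/-- A value below `|a|` cannot be approached at infinity: far to the left `μ_a ≥ θ|a|` with `θ < 1`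
chosen above `μ_a(ξ₀)/|a|`, and to the right of `1` one has `μ_a ≥ 1`. -/
lemma exists_forall_mu_le {a : ℝ} (ha : a ∈ Ioo (-1 : ℝ) 0) {ξ₀ : ℝ} (h : mu a ξ₀ < |a|) :
    ∃ ζ : ℝ, ∀ ξ : ℝ, mu a ζ ≤ mu a ξ := by
  have hA0 : 0 < |a| := abs_pos.mpr ha.2.ne
  have hA1 : |a| < 1 := by rw [abs_of_neg ha.2]; linarith [ha.1]
  refine (continuous_mu ha).exists_forall_le' ξ₀ ?_
  rw [cocompact_eq_atBot_atTop, eventually_sup]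
  constructor
  · obtain ⟨θ, hθ1, hθ2⟩ := exists_between ((div_lt_one hA0).mpr h)
    have hθ0 : 0 < θ := (div_nonneg (mu_nonneg ha ξ₀) hA0.le).trans_lt hθ1
    have hc : 0 < 1 - θ ^ 2 := by nlinarith
    filter_upwards [eventually_le_atBot (-(8 / (1 - θ ^ 2) + 1))] with ξ hξ
    have hp : 0 < 8 / (1 - θ ^ 2) := by positivity
    have hm : 8 / (1 - θ ^ 2) + 1 ≤ -ξ := by linarith
    have h1 : 8 ≤ (1 - θ ^ 2) * (-ξ) ^ 2 := by
      have h2 : 8 / (1 - θ ^ 2) ≤ (-ξ) ^ 2 := by nlinarith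
      rw [div_le_iff₀ hc] at h2; linarith
    have := mul_abs_le_mu ha hθ0 hθ2 (by linarith) h1
    rw [neg_neg] at this
    rw [div_lt_iff₀ hA0] at hθ1
    linarith
  · filter_upwards [eventually_ge_atTop 1] with ξ hξ
    have := sq_le_mu ha (zero_le_one.trans hξ)
    nlinarith

/-! ### Robin forms on the half-line -/

/-- `u ∈ B¹(ℝ₊)`, represented by a function that is continuous up to the end point. -/
structure IsHalfLine (u v : ℝ → ℂ) : Prop where
  prim : IsPrim (Ici 0) u v
  memLp : MemLp u 2 (volume.restrict (Ioi 0))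
  memLp_deriv : MemLp v 2 (volume.restrict (Ioi 0))
  memLp_mul : MemLp (fun t : ℝ => (t : ℂ) * u t) 2 (volume.restrict (Ioi 0))

lemma isHalfLine_iff {u v : ℝ → ℂ} :
    IsHalfLine u v ↔ MemB1 (Ioi 0) u v ∧ ContinuousOn u (Ici 0) :=
  ⟨fun h => ⟨⟨h.memLp, h.memLp_deriv, h.memLp_mul,
    h.prim.hasWeakDerivOn ordConnected_Ici isOpen_Ioi Ioi_subset_Ici_self⟩,
    h.prim.continuousOn ordConnected_Ici⟩,
    fun h => ⟨h.1.isPrim_Ici h.2, h.1.memLp, h.1.memLp_deriv, h.1.memLp_mul⟩⟩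

/-- The mass of `u` on the half-line. -/
noncomputable def halfMass (u : ℝ → ℂ) : ℝ := ∫ t in Ioi (0 : ℝ), ‖u t‖ ^ 2

/-- The energy `∫₀^∞ (|v|² + |(t - ξ) u|²) dt`. -/
noncomputable def halfEnergy (ξ : ℝ) (u v : ℝ → ℂ) : ℝ :=
  ∫ t in Ioi (0 : ℝ), (‖v t‖ ^ 2 + (t - ξ) ^ 2 * ‖u t‖ ^ 2)

lemma mem_robinQuotients_iff {γ ξ r : ℝ} : r ∈ robinQuotients γ ξ ↔ ∃ u v : ℝ → ℂ,
    IsHalfLine u v ∧ 0 < halfMass u ∧ r = (halfEnergy ξ u v + γ * ‖u 0‖ ^ 2) / halfMass u := by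
  simp only [robinQuotients, mem_ofPred_eq, isHalfLine_iff, halfMass, halfEnergy, and_assoc]

lemma halfMass_nonneg (u : ℝ → ℂ) : 0 ≤ halfMass u := integral_nonneg fun _ => sq_nonneg _

lemma halfEnergy_nonneg (ξ : ℝ) (u v : ℝ → ℂ) : 0 ≤ halfEnergy ξ u v :=
  integral_nonneg fun _ => by positivity

namespace IsHalfLine

variable {u v : ℝ → ℂ}

lemma integrableOn_sq (h : IsHalfLine u v) : IntegrableOn (fun t => ‖u t‖ ^ 2) (Ioi 0) :=
  h.memLp.integrable_norm_pow two_ne_zero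

lemma integrableOn_deriv_sq (h : IsHalfLine u v) : IntegrableOn (fun t => ‖v t‖ ^ 2) (Ioi 0) :=
  h.memLp_deriv.integrable_norm_pow two_ne_zero

lemma integrableOn_energy (h : IsHalfLine u v) (ξ : ℝ) :
    IntegrableOn (fun t => ‖v t‖ ^ 2 + (t - ξ) ^ 2 * ‖u t‖ ^ 2) (Ioi 0) := by
  refine h.integrableOn_deriv_sq.add ?_
  have := (integrable_affine_data 1 (-ξ) h.memLp h.memLp_deriv h.memLp_mul).2.1
  simpa only [one_mul, ← sub_eq_add_neg] using this

/-- The square is completed with `g = ξ - t`, the logarithmic derivative of the Gaussian centred at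
`ξ`. -/
lemma le_halfEnergy (h : IsHalfLine u v) (ξ : ℝ) :
    halfMass u - ξ * ‖u 0‖ ^ 2 ≤ halfEnergy ξ u v := by
  have h1 := h.prim.riccati_Ioi (-1) ξ h.memLp h.memLp_deriv h.memLp_mul
  have h2 : ∫ t in Ioi (0 : ℝ), (‖v t‖ ^ 2 + (-1 + (-1 * t + ξ) ^ 2) * ‖u t‖ ^ 2) =
      halfEnergy ξ u v - halfMass u := by
    rw [halfEnergy, halfMass, ← integral_sub (h.integrableOn_energy ξ) h.integrableOn_sq]
    congr 1; ext t; ring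
  rw [h2] at h1
  linarith

end IsHalfLine

lemma nonneg_of_mem_robinQuotients {γ ξ r : ℝ} (hγ : 0 ≤ γ) (hr : r ∈ robinQuotients γ ξ) :
    0 ≤ r := by
  obtain ⟨u, v, _, _, rfl⟩ := mem_robinQuotients_iff.mp hr
  have := halfEnergy_nonneg ξ u v
  have := halfMass_nonneg u
  positivity

lemma muRobin_nonneg {γ : ℝ} (hγ : 0 ≤ γ) (ξ : ℝ) : 0 ≤ muRobin γ ξ :=
  Real.sInf_nonneg fun _ => nonneg_of_mem_robinQuotients hγ

lemma Theta_nonneg {γ : ℝ} (hγ : 0 ≤ γ) : 0 ≤ Theta γ := Real.iInf_nonneg (muRobin_nonneg hγ)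

/-- Nonnegativity of `γ` bounds all quotients below, so both infima are genuine and not default
values. -/
lemma Theta_le {γ ξ r : ℝ} (hγ : 0 ≤ γ) (hr : r ∈ robinQuotients γ ξ) : Theta γ ≤ r := by
  have h1 : Theta γ ≤ muRobin γ ξ :=
    ciInf_le ⟨0, by rintro _ ⟨x, rfl⟩; exact muRobin_nonneg hγ x⟩ ξ
  exact h1.trans (csInf_le ⟨0, fun _ => nonneg_of_mem_robinQuotients hγ⟩ hr)

lemma integral_pow_mul_exp_neg_mul_Ioi (n : ℕ) {r : ℝ} (hr : 0 < r) :
    ∫ t in Ioi (0 : ℝ), t ^ n * Real.exp (-(r * t)) = n.factorial / r ^ (n + 1) := by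
  have h := Real.integral_rpow_mul_exp_neg_mul_Ioi (a := n + 1) (by positivity) hr
  rw [Real.Gamma_nat_eq_factorial, add_sub_cancel_right] at h
  simp only [Real.rpow_natCast] at h
  rw [h, ← Nat.cast_succ, Real.rpow_natCast]
  simp [div_eq_inv_mul]

lemma integrableOn_pow_mul_exp_neg_mul (n : ℕ) {r : ℝ} (hr : 0 < r) :
    IntegrableOn (fun t : ℝ => t ^ n * Real.exp (-(r * t))) (Ioi 0) := by
  refine Integrable.of_integral_ne_zero ?_
  rw [integral_pow_mul_exp_neg_mul_Ioi n hr]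
  positivity

/-- A function with exponential decay on the half-line. -/
lemma isHalfLine_exp (c : ℂ) {g : ℝ} (hg : 0 < g) : IsHalfLine
    (fun t => c * (Real.exp (-(g * t)) : ℂ)) (fun t => -(g : ℂ) * (c * (Real.exp (-(g * t)) : ℂ))) := by
  have hcont : Continuous (fun t : ℝ => c * (Real.exp (-(g * t)) : ℂ)) := by fun_prop
  have hn : ∀ t : ℝ, ‖c * (Real.exp (-(g * t)) : ℂ)‖ ^ 2 = ‖c‖ ^ 2 * Real.exp (-(2 * g * t)) := by
    intro t
    rw [norm_mul, Complex.norm_real, Real.norm_eq_abs, Real.abs_exp, mul_pow, ← Real.exp_nat_mul]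
    congr 2; push_cast; ring
  have h2g : 0 < 2 * g := by positivity
  have hu : MemLp (fun t : ℝ => c * (Real.exp (-(g * t)) : ℂ)) 2 (volume.restrict (Ioi 0)) := by
    rw [memLp_two_iff_integrable_sq_norm hcont.aestronglyMeasurable]
    simp only [hn]
    have := (integrableOn_pow_mul_exp_neg_mul 0 h2g).const_mul (‖c‖ ^ 2)
    simpa using this
  refine ⟨IsPrim.of_hasDerivAt (by fun_prop) ordConnected_Ici fun t _ => ?_, hu, hu.const_mul _, ?_⟩
  · have h1 : HasDerivAt (fun t : ℝ => Real.exp (-(g * t))) (Real.exp (-(g * t)) * -g) t := by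
      have := (((hasDerivAt_id t).const_mul g).neg).exp
      simpa using this
    refine (h1.ofReal_comp.const_mul c).congr_deriv ?_
    push_cast; ring
  · rw [memLp_two_iff_integrable_sq_norm (by fun_prop)]
    have := (integrableOn_pow_mul_exp_neg_mul 2 h2g).const_mul (‖c‖ ^ 2)
    refine this.congr (ae_of_all _ fun t => ?_)
    simp only
    rw [norm_mul, mul_pow, hn, Complex.norm_real, Real.norm_eq_abs, sq_abs]
    ring

lemma halfMass_exp (c : ℂ) {g : ℝ} (hg : 0 < g) :
    halfMass (fun t => c * (Real.exp (-(g * t)) : ℂ)) = ‖c‖ ^ 2 / (2 * g) := by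
  have h2g : 0 < 2 * g := by positivity
  have hn : ∀ t : ℝ, ‖c * (Real.exp (-(g * t)) : ℂ)‖ ^ 2 =
      ‖c‖ ^ 2 * (t ^ 0 * Real.exp (-(2 * g * t))) := by
    intro t
    rw [norm_mul, Complex.norm_real, Real.norm_eq_abs, Real.abs_exp, mul_pow, ← Real.exp_nat_mul,
      pow_zero, one_mul]
    congr 2; push_cast; ring
  simp only [halfMass, hn]
  rw [integral_const_mul, integral_pow_mul_exp_neg_mul_Ioi 0 h2g]
  simp [div_eq_mul_inv]

lemma halfEnergy_exp (c : ℂ) {g : ℝ} (hg : 0 < g) (x : ℝ) :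
    halfEnergy x (fun t => c * (Real.exp (-(g * t)) : ℂ))
      (fun t => -(g : ℂ) * (c * (Real.exp (-(g * t)) : ℂ))) =
    ‖c‖ ^ 2 * (g / 2 + x ^ 2 / (2 * g) - x / (2 * g ^ 2) + 1 / (4 * g ^ 3)) := by
  have h2g : 0 < 2 * g := by positivity
  have hn : ∀ t : ℝ, ‖c * (Real.exp (-(g * t)) : ℂ)‖ ^ 2 = ‖c‖ ^ 2 * Real.exp (-(2 * g * t)) := by
    intro t
    rw [norm_mul, Complex.norm_real, Real.norm_eq_abs, Real.abs_exp, mul_pow, ← Real.exp_nat_mul]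
    congr 2; push_cast; ring
  have e : ∀ t : ℝ, ‖-(g : ℂ) * (c * (Real.exp (-(g * t)) : ℂ))‖ ^ 2 +
      (t - x) ^ 2 * ‖c * (Real.exp (-(g * t)) : ℂ)‖ ^ 2 =
      ‖c‖ ^ 2 * (g ^ 2 + x ^ 2) * (t ^ 0 * Real.exp (-(2 * g * t))) -
      ‖c‖ ^ 2 * (2 * x) * (t ^ 1 * Real.exp (-(2 * g * t))) +
      ‖c‖ ^ 2 * (t ^ 2 * Real.exp (-(2 * g * t))) := by
    intro t
    rw [norm_mul, mul_pow, hn, norm_neg, Complex.norm_real, Real.norm_eq_abs, sq_abs]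
    ring
  simp only [halfEnergy, e]
  have i := fun n (k : ℝ) => (integrableOn_pow_mul_exp_neg_mul n h2g).const_mul k
  rw [integral_add, integral_sub (i 0 _) (i 1 _), integral_const_mul, integral_const_mul,
    integral_const_mul, integral_pow_mul_exp_neg_mul_Ioi 0 h2g,
    integral_pow_mul_exp_neg_mul_Ioi 1 h2g, integral_pow_mul_exp_neg_mul_Ioi 2 h2g]
  · simp only [Nat.factorial]
    push_cast
    field_simp
    ring
  · exact (i 0 _).sub (i 1 _)
  · exact i 2 _

lemma robinQuotients_nonempty (γ ξ : ℝ) : (robinQuotients γ ξ).Nonempty :=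
  ⟨_, mem_robinQuotients_iff.mpr ⟨_, _, isHalfLine_exp 1 one_pos, by
    rw [halfMass_exp 1 one_pos]; norm_num, rfl⟩⟩

/-- The Gaussian `exp (-t² / 2)`. -/
noncomputable def gauss (t : ℝ) : ℂ := (Real.exp (-(t ^ 2 / 2)) : ℂ)

lemma norm_gauss_sq (t : ℝ) : ‖gauss t‖ ^ 2 = Real.exp (-1 * t ^ 2) := by
  rw [gauss, Complex.norm_real, Real.norm_eq_abs, Real.abs_exp, ← Real.exp_nat_mul]
  congr 1; push_cast; ring

lemma contDiff_gauss : ContDiff ℝ ∞ gauss := by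
  have h : ContDiff ℝ ∞ (fun t : ℝ => Real.exp (-(t ^ 2 / 2))) := by fun_prop
  exact Complex.ofRealCLM.contDiff.comp h

lemma hasDerivAt_gauss (t : ℝ) : HasDerivAt gauss (-(t : ℂ) * gauss t) t := by
  have h1 : HasDerivAt (fun t : ℝ => Real.exp (-(t ^ 2 / 2))) (Real.exp (-(t ^ 2 / 2)) * -t) t := by
    have := ((((hasDerivAt_id t).pow 2).div_const 2).neg).exp
    refine this.congr_deriv ?_
    simp
  refine h1.ofReal_comp.congr_deriv ?_
  simp only [gauss]; push_cast; ring

lemma memLp_gauss : MemLp gauss 2 volume := by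
  rw [memLp_two_iff_integrable_sq_norm contDiff_gauss.continuous.aestronglyMeasurable]
  simp only [norm_gauss_sq]
  exact integrable_exp_neg_mul_sq one_pos

lemma memLp_mul_gauss : MemLp (fun t : ℝ => (t : ℂ) * gauss t) 2 volume := by
  have hc : Continuous (fun t : ℝ => (t : ℂ) * gauss t) :=
    Complex.continuous_ofReal.mul contDiff_gauss.continuous
  rw [memLp_two_iff_integrable_sq_norm hc.aestronglyMeasurable]
  have h := integrable_rpow_mul_exp_neg_mul_sq one_pos (s := 2) (by norm_num)
  refine h.congr (ae_of_all _ fun t => ?_)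
  simp only
  rw [norm_mul, mul_pow, norm_gauss_sq, Complex.norm_real, Real.norm_eq_abs, sq_abs]
  norm_cast

/-- For the Gaussian centred at `ξ`, completing the square gives equality: the energy is the mass
minus `ξ|u(0)|²`. The Robin quotient is thus `1 - (ξ - γ)|u(0)|²` over the mass, and `ξ = γ + 1`
makes it less than one. -/
lemma Theta_lt_one {γ : ℝ} (hγ : 0 ≤ γ) : Theta γ < 1 := by
  set ξ := γ + 1 with hξ
  set u : ℝ → ℂ := fun t => gauss (t - ξ) with hu
  set v : ℝ → ℂ := fun t => -((t - ξ : ℝ) : ℂ) * gauss (t - ξ) with hv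
  have mp : MeasurePreserving (fun t : ℝ => t - ξ) volume volume := measurePreserving_sub_right _ ξ
  have mu : MemLp u 2 volume := memLp_gauss.comp_measurePreserving mp
  have mv : MemLp (fun t : ℝ => ((t - ξ : ℝ) : ℂ) * u t) 2 volume :=
    memLp_mul_gauss.comp_measurePreserving mp
  have hcu : Continuous u := contDiff_gauss.continuous.comp (by fun_prop)
  have hL : IsHalfLine u v := by
    refine ⟨IsPrim.of_hasDerivAt ?_ ordConnected_Ici fun t _ => ?_, mu.restrict _, ?_, ?_⟩
    · exact Continuous.continuousOn ((by fun_prop : Continuous fun t : ℝ => -((t - ξ : ℝ) : ℂ)).mul hcu)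
    · exact (hasDerivAt_gauss (t - ξ)).comp_sub_const t ξ
    · refine (mv.neg.restrict _).ae_eq (ae_of_all _ fun t => ?_)
      simp only [hv, hu, Pi.neg_apply, neg_mul]
    · refine ((mv.add (mu.const_mul (ξ : ℂ))).restrict _).ae_eq (ae_of_all _ fun t => ?_)
      simp only [Pi.add_apply]; push_cast; ring
  have h0 : 0 < ‖u 0‖ ^ 2 := by
    rw [hu]; simp only [norm_gauss_sq]; positivity
  have hvn : ∀ t, ‖v t‖ ^ 2 = (t - ξ) ^ 2 * ‖u t‖ ^ 2 := fun t => by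
    simp only [hv, hu]
    rw [norm_mul, mul_pow, norm_neg, Complex.norm_real, Real.norm_eq_abs, sq_abs]
  have hE : halfEnergy ξ u v = halfMass u - ξ * ‖u 0‖ ^ 2 := by
    obtain ⟨i1, _, i3⟩ := integrable_affine_data 1 (-ξ) hL.memLp hL.memLp_deriv hL.memLp_mul
    have h1 := (hL.prim.affine_mul_norm_sq ordConnected_Ici 1 (-ξ)).integral_Ioi i1 i3
    have h2 : ∫ t in Ioi (0 : ℝ), (1 * ‖u t‖ ^ 2 + 2 * (1 * t + -ξ) * (conj (u t) * v t).re) =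
        halfMass u - halfEnergy ξ u v := by
      rw [halfEnergy, halfMass, ← integral_sub hL.integrableOn_sq (hL.integrableOn_energy ξ)]
      congr 1; ext t
      have : (conj (u t) * v t).re = -(t - ξ) * ‖u t‖ ^ 2 := by
        have : conj (u t) * v t = ((-(t - ξ) * ‖u t‖ ^ 2 : ℝ) : ℂ) := by
          have e : conj (u t) * u t = ((‖u t‖ ^ 2 : ℝ) : ℂ) := by
            rw [← Complex.normSq_eq_norm_sq, Complex.normSq_eq_conj_mul_self]
          have e2 : v t = -((t - ξ : ℝ) : ℂ) * u t := rfl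
          rw [e2, Complex.ofReal_mul, ← e]; push_cast; ring
        rw [this, Complex.ofReal_re]
      rw [this, hvn]; ring
    rw [h2] at h1
    linarith
  have hM : 0 < halfMass u := by
    have := halfEnergy_nonneg ξ u v
    have : 0 < ξ * ‖u 0‖ ^ 2 := by positivity
    linarith
  refine (Theta_le hγ (ξ := ξ) (mem_robinQuotients_iff.mpr ⟨u, v, hL, hM, rfl⟩)).trans_lt ?_
  rw [div_lt_one hM, hE, hξ]
  linarith

/-! ### Gluing two half-line functions -/

lemma IsPrim.union_Iic_Ici {U v : ℝ → ℂ} {c : ℝ} (h1 : IsPrim (Iic c) U v)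
    (h2 : IsPrim (Ici c) U v) : IsPrim univ U v := by
  have key : ∀ t, IntervalIntegrable v volume c t ∧ U t - U c = ∫ x in c..t, v x := fun t => by
    rcases le_total t c with h | h
    · exact h1 c self_mem_Iic t h
    · exact h2 c self_mem_Ici t h
  intro s _ t _
  obtain ⟨is, es⟩ := key s
  obtain ⟨it, et⟩ := key t
  refine ⟨is.symm.trans it, ?_⟩
  rw [← intervalIntegral.integral_add_adjacent_intervals is.symm it,
    intervalIntegral.integral_symm, ← es, ← et]
  ring

/-- The derivative may be changed at one point, which leaves the value at the interface free. -/
lemma IsPrim.congr_of_ne {J : Set ℝ} {U v U' v' : ℝ → ℂ} (hJ : J.OrdConnected) {c : ℝ}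
    (h : IsPrim J U v) (hU : ∀ t ∈ J, U t = U' t) (hv : ∀ t ∈ J, t ≠ c → v t = v' t) :
    IsPrim J U' v' := by
  intro s hs t ht
  obtain ⟨h1, h2⟩ := h s hs t ht
  have hc : ∀ᵐ x : ℝ, x ≠ c := by simp [ae_iff]
  have hae : ∀ᵐ x : ℝ, x ∈ uIoc s t → v x = v' x :=
    hc.mono fun x hx hxst => hv x (hJ.uIcc_subset hs ht (uIoc_subset_uIcc hxst)) hx
  refine ⟨h1.congr_ae ((ae_restrict_iff' measurableSet_uIoc).mpr hae), ?_⟩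
  rw [← hU s hs, ← hU t ht, h2]
  exact intervalIntegral.integral_congr_ae hae

lemma IsPrim.comp_affine {c : ℝ} (hc : c ≠ 0) (d : ℝ) {J : Set ℝ} {U v : ℝ → ℂ}
    (h : IsPrim J U v) :
    IsPrim ((fun x => c * x + d) ⁻¹' J) (fun t => U (c * t + d))
      (fun t => (c : ℂ) * v (c * t + d)) := by
  intro s hs t ht
  obtain ⟨h1, h2⟩ := h _ hs _ ht
  constructor
  · have h3 := (h1.comp_add_right d).comp_mul_left (c := c)
    simp only [add_sub_cancel_right, mul_div_cancel_left₀ _ hc] at h3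
    exact h3.const_mul _
  · rw [h2, ← intervalIntegral.smul_integral_comp_mul_add, intervalIntegral.integral_const_mul,
      Complex.real_smul]

lemma measurableEmbedding_affine {c : ℝ} (hc : c ≠ 0) (d : ℝ) : MeasurableEmbedding (fun x : ℝ => c * x + d) :=
  ((Homeomorph.mulLeft₀ c hc).trans (Homeomorph.addRight d)).measurableEmbedding

lemma map_volume_affine {c : ℝ} (hc : c ≠ 0) (d : ℝ) :
    Measure.map (fun x : ℝ => c * x + d) volume = ENNReal.ofReal |c⁻¹| • volume := by
  have : (fun x : ℝ => c * x + d) = (fun x => x + d) ∘ (fun x => c * x) := rfl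
  rw [this, ← Measure.map_map (by fun_prop) (by fun_prop), Real.map_volume_mul_left hc,
    Measure.map_smul, (measurePreserving_add_right volume d).map_eq]

lemma memLp_comp_affine {c : ℝ} (hc : c ≠ 0) (d : ℝ) {S : Set ℝ} {f : ℝ → ℂ}
    (hf : MemLp f 2 (volume.restrict S)) : MemLp (fun x => f (c * x + d)) 2
      (volume.restrict ((fun x => c * x + d) ⁻¹' S)) := by
  have hm := measurableEmbedding_affine hc d
  refine (hm.memLp_map_measure_iff (g := f)).mp ?_
  rw [← hm.restrict_map, map_volume_affine hc d, Measure.restrict_smul]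
  exact hf.smul_measure ENNReal.ofReal_ne_top

lemma setIntegral_comp_affine {c : ℝ} (hc : c ≠ 0) (d : ℝ) (S : Set ℝ) (f : ℝ → ℝ) :
    ∫ x in (fun x => c * x + d) ⁻¹' S, f (c * x + d) = |c⁻¹| * ∫ x in S, f x := by
  rw [← (measurableEmbedding_affine hc d).setIntegral_map f S, map_volume_affine hc d,
    Measure.restrict_smul, integral_smul_measure, ENNReal.toReal_ofReal (abs_nonneg _),
    smul_eq_mul]

lemma memLp_mul_comp_affine {c : ℝ} (hc : c ≠ 0) (d : ℝ) {S : Set ℝ} {f : ℝ → ℂ}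
    (hf : MemLp f 2 (volume.restrict S))
    (htf : MemLp (fun t : ℝ => (t : ℂ) * f t) 2 (volume.restrict S)) :
    MemLp (fun x : ℝ => (x : ℂ) * f (c * x + d)) 2
      (volume.restrict ((fun x => c * x + d) ⁻¹' S)) := by
  have h1 := memLp_comp_affine hc d hf
  have h2 := memLp_comp_affine hc d htf
  refine ((h2.sub (h1.const_mul (d : ℂ))).const_mul ((c : ℂ)⁻¹)).ae_eq (ae_of_all _ fun x => ?_)
  have hc' : (c : ℂ) ≠ 0 := Complex.ofReal_ne_zero.mpr hc
  simp only [Pi.sub_apply]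
  push_cast
  field_simp
  ring

/-- Two functions on the half-line with the same trace, the first one scaled by `s = √|a|`, are
glued to a function on the line. -/
lemma exists_memB1_glue {a s : ℝ} (hs : 0 < s) (has : s ^ 2 = -a) (x : ℝ) {u v u' v' : ℝ → ℂ}
    (h : IsHalfLine u v) (h' : IsHalfLine u' v') (h0 : u 0 = u' 0) :
    ∃ w z : ℝ → ℂ, MemB1 univ w z ∧ ∫ t, ‖w t‖ ^ 2 = s⁻¹ * halfMass u + halfMass u' ∧
      ∫ t, (‖z t‖ ^ 2 + V a (-(s * x)) t * ‖w t‖ ^ 2) =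
        s * halfEnergy x u v + halfEnergy (s * x) u' v' := by
  classical
  have hc : -s ≠ 0 := neg_ne_zero.mpr hs.ne'
  have hpre1 : (fun t => -s * t + 0) ⁻¹' Ici 0 = Iic 0 := by
    ext t
    simp only [mem_preimage, mem_Ici, mem_Iic, add_zero]
    constructor <;> intro h <;> nlinarith
  have hpre2 : (fun t => -s * t + 0) ⁻¹' Ioi 0 = Iio 0 := by
    ext t
    simp only [mem_preimage, mem_Ioi, mem_Iio, add_zero]
    constructor <;> intro h <;> nlinarith
  have hres : volume.restrict (Iio (0 : ℝ)) = volume.restrict (Iic 0) := restrict_Iio_eq_restrict_Iic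
  -- With `a = -s²` the left potential is `(-(s x) + a t)² = s²((-s t) - x)²`, and the derivative
  -- also scales by `s`. The energy density gains `s²`, the measure `s⁻¹`.
  set f : ℝ → ℂ := fun t => u (-s * t + 0) with hf
  set g : ℝ → ℂ := fun t => ((-s : ℝ) : ℂ) * v (-s * t + 0) with hg
  have p1 : IsPrim (Iic 0) f g := by
    have := h.prim.comp_affine hc 0
    rwa [hpre1] at this
  have m1 : MemLp f 2 (volume.restrict (Iic 0)) := by
    have := memLp_comp_affine hc 0 h.memLp
    rwa [hpre2, hres] at this
  have m2 : MemLp g 2 (volume.restrict (Iic 0)) := by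
    have := (memLp_comp_affine hc 0 h.memLp_deriv).const_mul ((-s : ℝ) : ℂ)
    rwa [hpre2, hres] at this
  have m3 : MemLp (fun t : ℝ => (t : ℂ) * f t) 2 (volume.restrict (Iic 0)) := by
    have := memLp_mul_comp_affine hc 0 h.memLp h.memLp_mul
    rwa [hpre2, hres] at this
  have hcompl : (Iic (0 : ℝ))ᶜ = Ioi 0 := compl_Iic
  have hf0 : f 0 = u' 0 := by simp only [hf, mul_zero, add_zero, h0]
  set w := (Iic (0 : ℝ)).piecewise f u' with hw
  set z := (Iic (0 : ℝ)).piecewise g v' with hz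
  have hwl : ∀ t ≤ 0, w t = f t := fun t ht => piecewise_eq_of_mem _ _ _ ht
  have hzl : ∀ t ≤ 0, z t = g t := fun t ht => piecewise_eq_of_mem _ _ _ ht
  have hwr : ∀ t, 0 < t → w t = u' t := fun t ht => piecewise_eq_of_notMem _ _ _ (not_le.mpr ht)
  have hzr : ∀ t, 0 < t → z t = v' t := fun t ht => piecewise_eq_of_notMem _ _ _ (not_le.mpr ht)
  have hp : IsPrim univ w z := by
    refine IsPrim.union_Iic_Ici (c := 0) ?_ ?_
    · exact p1.congr_of_ne ordConnected_Iic (c := 0) (fun t ht => (hwl t ht).symm)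
        fun t ht _ => (hzl t ht).symm
    · refine h'.prim.congr_of_ne ordConnected_Ici (c := 0) (fun t ht => ?_)
        fun t ht ht0 => (hzr t (lt_of_le_of_ne ht ht0.symm)).symm
      rcases (mem_Ici.mp ht).eq_or_lt with rfl | ht
      · rw [hwl 0 le_rfl, hf0]
      · exact (hwr t ht).symm
  have mw : MemLp w 2 volume := m1.piecewise measurableSet_Iic (by rw [hcompl]; exact h'.memLp)
  have mz : MemLp z 2 volume :=
    m2.piecewise measurableSet_Iic (by rw [hcompl]; exact h'.memLp_deriv)
  have mtw : MemLp (fun t : ℝ => (t : ℂ) * w t) 2 volume := by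
    have := m3.piecewise measurableSet_Iic (by rw [hcompl]; exact h'.memLp_mul)
    refine this.ae_eq (ae_of_all _ fun t => ?_)
    simp only [hw, piecewise]
    split_ifs <;> rfl
  have hB : MemB1 univ w z := ⟨by simpa using mw, by simpa using mz, by simpa using mtw,
    hp.hasWeakDerivOn ordConnected_univ isOpen_univ (subset_univ _)⟩
  have split : ∀ F : ℝ → ℝ, Integrable F → ∫ t, F t = (∫ t in Iio 0, F t) + ∫ t in Ioi 0, F t := by
    intro F hF
    rw [← integral_add_compl measurableSet_Iic hF, hcompl, integral_Iic_eq_integral_Iio]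
  have left : ∀ F : ℝ → ℝ, ∫ t in Iio 0, F (-s * t + 0) = s⁻¹ * ∫ t in Ioi 0, F t := by
    intro F
    rw [← hpre2, setIntegral_comp_affine hc 0, abs_inv, abs_neg, abs_of_pos hs]
  have i1 := mw.integrable_norm_pow two_ne_zero
  have i2 : Integrable (fun t => ‖z t‖ ^ 2 + V a (-(s * x)) t * ‖w t‖ ^ 2) := by
    have hV : Integrable (fun t => V a (-(s * x)) t * ‖w t‖ ^ 2) := by
      have e1 : IntegrableOn (fun t => V a (-(s * x)) t * ‖w t‖ ^ 2) (Iic 0) := by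
        refine ((integrable_affine_data a (-(s * x)) m1 m2 m3).2.1).congr_fun (fun t ht => ?_)
          measurableSet_Iic
        simp only
        rw [V_eq, ramp_of_nonpos a ht, hwl t ht, add_comm]
      have e2 : IntegrableOn (fun t => V a (-(s * x)) t * ‖w t‖ ^ 2) (Ioi 0) := by
        refine ((integrable_affine_data 1 (-(s * x)) h'.memLp h'.memLp_deriv
          h'.memLp_mul).2.1).congr_fun (fun t ht => ?_) measurableSet_Ioi
        simp only
        rw [V_eq, ramp_of_nonneg a (mem_Ioi.mp ht).le, hwr t ht, one_mul, add_comm]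
      rw [← integrableOn_univ, ← Iic_union_Ioi (a := (0 : ℝ))]
      exact e1.union e2
    exact (mz.integrable_norm_pow two_ne_zero).add hV
  refine ⟨w, z, hB, ?_, ?_⟩
  · rw [split _ i1, halfMass, halfMass, ← left]
    congr 1
    · exact setIntegral_congr_fun measurableSet_Iio fun t ht => by
        simp only [hwl t (mem_Iio.mp ht).le, hf]
    · exact setIntegral_congr_fun measurableSet_Ioi fun t ht => by simp only [hwr t ht]
  · rw [split _ i2, halfEnergy, halfEnergy]
    congr 1
    · have e : s * ∫ t in Ioi 0, (‖v t‖ ^ 2 + (t - x) ^ 2 * ‖u t‖ ^ 2) =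
          s⁻¹ * ∫ t in Ioi 0, s ^ 2 * (‖v t‖ ^ 2 + (t - x) ^ 2 * ‖u t‖ ^ 2) := by
        rw [integral_const_mul]; field_simp
      rw [e, ← left]
      refine setIntegral_congr_fun measurableSet_Iio fun t ht => ?_
      have ht' : t ≤ 0 := (mem_Iio.mp ht).le
      simp only [hwl t ht', hzl t ht', hf, hg]
      rw [V_eq, ramp_of_nonpos a ht', norm_mul, mul_pow, Complex.norm_real, norm_neg,
        Real.norm_eq_abs, sq_abs]
      have ea : a = -s ^ 2 := by linarith
      rw [ea]; ring
    · refine setIntegral_congr_fun measurableSet_Ioi fun t ht => ?_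
      simp only [hwr t ht, hzr t ht]
      rw [V_eq, ramp_of_nonneg a (mem_Ioi.mp ht).le]
      ring

/-! ### Truncation and Robin almost minimizers -/

lemma IsHalfLine.shift {u v : ℝ → ℂ} (h : IsHalfLine u v) {d : ℝ} (hd : 0 ≤ d) :
    IsHalfLine (fun t => u (t + d)) (fun t => v (t + d)) := by
  have hp1 : Ici 0 ⊆ (fun t => 1 * t + d) ⁻¹' Ici 0 := fun t ht => by
    simp only [mem_preimage, mem_Ici, one_mul] at *; linarith
  have hp2 : Ioi 0 ⊆ (fun t => 1 * t + d) ⁻¹' Ioi 0 := fun t ht => by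
    simp only [mem_preimage, mem_Ioi, one_mul] at *; linarith
  have hle := Measure.restrict_mono hp2 (le_refl (volume : Measure ℝ))
  refine ⟨?_, ?_, ?_, ?_⟩
  · simpa using (h.prim.comp_affine one_ne_zero d).mono hp1
  · simpa using (memLp_comp_affine one_ne_zero d h.memLp).mono_measure hle
  · simpa using (memLp_comp_affine one_ne_zero d h.memLp_deriv).mono_measure hle
  · simpa using (memLp_mul_comp_affine one_ne_zero d h.memLp h.memLp_mul).mono_measure hle

lemma setIntegral_Ioi_comp_add_right (f : ℝ → ℝ) (d : ℝ) :
    ∫ t in Ioi 0, f (t + d) = ∫ t in Ioi d, f t := by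
  have h := setIntegral_comp_affine one_ne_zero d (Ioi d) f
  have hp : (fun t => 1 * t + d) ⁻¹' Ioi d = Ioi 0 := by
    ext t; simp
  rw [hp] at h
  simpa using h

lemma setIntegral_Ioi_split {f : ℝ → ℝ} (hf : IntegrableOn f (Ioi 0)) {d : ℝ} (hd : 0 ≤ d) :
    ∫ t in Ioi 0, f t = (∫ t in 0..d, f t) + ∫ t in Ioi 0, f (t + d) := by
  rw [setIntegral_Ioi_comp_add_right, intervalIntegral.integral_of_le hd,
    ← setIntegral_union (Ioc_disjoint_Ioi le_rfl) measurableSet_Ioi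
      (hf.mono_set Ioc_subset_Ioi_self) (hf.mono_set (Ioi_subset_Ioi hd)),
    Ioc_union_Ioi_eq_Ioi hd]

/-- The Robin form of `(u, v)`, minus its value at the function restricted to `[d, ∞)`. -/
lemma IsHalfLine.shift_le {u v : ℝ → ℂ} (h : IsHalfLine u v) {γ R d : ℝ} (hR : 0 ≤ R)
    (hd : 0 ≤ d) :
    halfEnergy R (fun t => u (t + d)) (fun t => v (t + d)) + γ * ‖u d‖ ^ 2 +
      (R ^ 2 - γ ^ 2) * ∫ t in 0..d, ‖u t‖ ^ 2 ≤ halfEnergy (R + d) u v + γ * ‖u 0‖ ^ 2 := by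
  have hi := h.integrableOn_energy (R + d)
  have e1 := setIntegral_Ioi_split hi hd
  have e2 : ∫ t in Ioi 0, (‖v (t + d)‖ ^ 2 + (t + d - (R + d)) ^ 2 * ‖u (t + d)‖ ^ 2) =
      halfEnergy R (fun t => u (t + d)) (fun t => v (t + d)) := by
    rw [halfEnergy]; congr 1; ext t; ring
  have hI : ∀ {F : ℝ → ℝ}, IntegrableOn F (Ioi 0) → IntervalIntegrable F volume 0 d :=
    fun hF => (intervalIntegrable_iff_integrableOn_Ioc_of_le hd).mpr
      (hF.mono_set Ioc_subset_Ioi_self)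
  have hv := hI h.integrableOn_deriv_sq
  have hu := hI h.integrableOn_sq
  -- With constant `g = γ` the energy on `[0, d]` moves the Robin term from `0` to `d`. There the
  -- potential is at least `R²`, which leaves the surplus `R² - γ²`.
  have r := h.prim.riccati_Icc 0 γ ordConnected_Ici self_mem_Ici (mem_Ici.mpr hd) hd hv
  simp only [zero_mul, zero_add] at r
  have m : (∫ t in 0..d, (‖v t‖ ^ 2 + γ ^ 2 * ‖u t‖ ^ 2)) +
      (R ^ 2 - γ ^ 2) * ∫ t in 0..d, ‖u t‖ ^ 2 ≤
      ∫ t in 0..d, (‖v t‖ ^ 2 + (t - (R + d)) ^ 2 * ‖u t‖ ^ 2) := by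
    rw [← intervalIntegral.integral_const_mul,
      ← intervalIntegral.integral_add (hv.add (hu.const_mul _)) (hu.const_mul _)]
    refine intervalIntegral.integral_mono_on hd ((hv.add (hu.const_mul _)).add (hu.const_mul _))
      (hI hi) fun t ht => ?_
    have : R ^ 2 ≤ (t - (R + d)) ^ 2 := by nlinarith [ht.2]
    nlinarith [mul_le_mul_of_nonneg_right this (sq_nonneg ‖u t‖)]
  have e3 : halfEnergy (R + d) u v =
      (∫ t in 0..d, (‖v t‖ ^ 2 + (t - (R + d)) ^ 2 * ‖u t‖ ^ 2)) +
        halfEnergy R (fun t => u (t + d)) (fun t => v (t + d)) := by rw [halfEnergy, e1, e2]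
  rw [e3]
  linarith

/-- Almost minimizers of the Robin quotient, with control of the parameter `ξ`. -/
lemma exists_robin_almost_minimizer {γ δ : ℝ} (hγ : 0 ≤ γ) (hδ : 0 < δ) (hδ2 : δ < 1 / 2)
    (hδ1 : Theta γ + δ < 1) : ∃ (ξ : ℝ) (u v : ℝ → ℂ), IsHalfLine u v ∧ 0 < halfMass u ∧
      γ < ξ ∧ ξ ^ 2 ≤ Theta γ + γ ^ 2 + 1 / 2 ∧
      halfEnergy ξ u v + γ * ‖u 0‖ ^ 2 ≤ (Theta γ + δ) * halfMass u := by
  have hΘ := Theta_nonneg hγ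
  obtain ⟨ξ, hξ⟩ := exists_lt_of_ciInf_lt (lt_add_of_pos_right (Theta γ) hδ)
  obtain ⟨r, hr, hrlt⟩ := exists_lt_of_csInf_lt (robinQuotients_nonempty γ ξ) hξ
  obtain ⟨u, v, h, hM, rfl⟩ := mem_robinQuotients_iff.mp hr
  rw [div_lt_iff₀ hM] at hrlt
  -- If `ξ ≤ γ`, `le_halfEnergy` would make the quotient at least one.
  have hγξ : γ < ξ := by
    have := h.le_halfEnergy ξ
    have h2 : (Theta γ + δ) * halfMass u < halfMass u := mul_lt_of_lt_one_left hM hδ1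
    by_contra hc
    nlinarith [mul_nonneg (sub_nonneg.mpr (not_lt.mp hc)) (sq_nonneg ‖u 0‖)]
  -- If `ξ = R + d`, the discarded interval contributes at least `R² - γ² = Θ + 1/2` per unit mass.
  -- This exceeds `Θ + δ`, so the truncated function is still an almost minimizer, now with
  -- parameter `R`.
  set R := √(Theta γ + γ ^ 2 + 1 / 2) with hRdef
  have hR2 : R ^ 2 = Theta γ + γ ^ 2 + 1 / 2 := Real.sq_sqrt (by positivity)
  have hR0 : 0 ≤ R := Real.sqrt_nonneg _
  rcases le_total ξ R with hc | hc
  · refine ⟨ξ, u, v, h, hM, hγξ, ?_, hrlt.le⟩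
    rw [← hR2]
    exact pow_le_pow_left₀ (hγ.trans hγξ.le) hc 2
  obtain ⟨d, rfl⟩ : ∃ d, ξ = R + d := ⟨ξ - R, by ring⟩
  have hd : 0 ≤ d := by linarith
  have key := h.shift_le (γ := γ) hR0 hd
  have hmass : halfMass u = (∫ t in 0..d, ‖u t‖ ^ 2) + halfMass (fun t => u (t + d)) :=
    setIntegral_Ioi_split h.integrableOn_sq hd
  have hn : 0 ≤ ∫ t in 0..d, ‖u t‖ ^ 2 :=
    intervalIntegral.integral_nonneg hd fun t _ => sq_nonneg _
  set n := ∫ t in 0..d, ‖u t‖ ^ 2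
  have hq := halfEnergy_nonneg R (fun t => u (t + d)) (fun t => v (t + d))
  have hud : 0 ≤ γ * ‖u d‖ ^ 2 := by positivity
  rw [hR2] at key
  rw [hmass] at hrlt hM
  have hup : halfEnergy R (fun t => u (t + d)) (fun t => v (t + d)) + γ * ‖u d‖ ^ 2 ≤
      (Theta γ + δ) * halfMass (fun t => u (t + d)) + (δ - 1 / 2) * n := by nlinarith
  have hneg : (δ - 1 / 2) * n ≤ 0 := mul_nonpos_of_nonpos_of_nonneg (by linarith) hn
  refine ⟨R, _, _, h.shift hd, ?_, ?_, hR2.le, ?_⟩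
  -- If nothing were left after truncation, the discarded mass would be positive and `hup` would
  -- bound a nonnegative quantity by a negative one.
  · rcases (halfMass_nonneg fun t => u (t + d)).eq_or_lt with h0 | h0
    · rw [← h0] at hup hM
      nlinarith
    · exact h0
  · exact lt_of_pow_lt_pow_left₀ 2 hR0 (by linarith)
  · rw [zero_add]
    linarith

/-! ### The strict trial estimate -/

/-- The left side is the excess energy of `exp(-g t)` over `AΘ` times its mass. The normalization of
`g` gives `1/(4g³) = (1 - A)/(2g)`, and `x ≥ g` gives `-x/(2g²) ≤ -1/(2g)`. Together they save
`A/(2g)`, of which the slack `A/2` in `x²` costs half. -/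
lemma trial_energy_le {A Θ g x : ℝ} (hg : 0 < g) (hg2 : g ^ 2 * (2 * (1 - A)) = 1) (hgx : g ≤ x)
    (hx : x ^ 2 ≤ A * Θ + g ^ 2 + A / 2) :
    g / 2 + x ^ 2 / (2 * g) - x / (2 * g ^ 2) + 1 / (4 * g ^ 3) - A * Θ / (2 * g) ≤
      g - A / (4 * g) := by
  have e : 1 / (4 * g ^ 3) = (1 - A) / (2 * g) := by
    rw [div_eq_div_iff (by positivity) (by positivity)]
    linear_combination (-(2 * g)) * hg2
  have e1 : 1 / (2 * g) ≤ x / (2 * g ^ 2) := by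
    rw [div_le_div_iff₀ (by positivity) (by positivity)]
    nlinarith
  have e2 : x ^ 2 / (2 * g) - A * Θ / (2 * g) ≤ (g ^ 2 + A / 2) / (2 * g) := by
    rw [← sub_div]
    exact div_le_div_of_nonneg_right (by linarith) (by positivity)
  have e3 : (g ^ 2 + A / 2) / (2 * g) = g / 2 + A / (4 * g) := by field_simp; ring
  have e4 : (1 - A) / (2 * g) = 1 / (2 * g) - 2 * (A / (4 * g)) := by field_simp; ring
  rw [e]
  linarith

lemma exists_mu_lt {a : ℝ} (ha : a ∈ Ioo (-1 : ℝ) 0) :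
    ∃ ξ < 0, mu a ξ < |a| * Theta √(1 / (2 * |a| * (1 - |a|))) := by
  have hA0 : 0 < |a| := abs_pos.mpr ha.2.ne
  have hA1 : |a| < 1 := by rw [abs_of_neg ha.2]; linarith [ha.1]
  have haA : a = -|a| := by rw [abs_of_neg ha.2, neg_neg]
  set A := |a| with hA
  set γ := √(1 / (2 * A * (1 - A))) with hγ
  have h1A : 0 < 1 - A := by linarith
  have hγ0 : 0 < γ := Real.sqrt_pos.mpr (by positivity)
  have hγ2 : γ ^ 2 = 1 / (2 * A * (1 - A)) := Real.sq_sqrt (by positivity)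
  set s := √A with hs
  have hs0 : 0 < s := Real.sqrt_pos.mpr hA0
  have hs2 : s ^ 2 = A := Real.sq_sqrt hA0.le
  have hsa : s ^ 2 = -a := by linarith
  set g := s * γ with hg
  have hg0 : 0 < g := by positivity
  have hg2 : g ^ 2 * (2 * (1 - A)) = 1 := by
    rw [hg, mul_pow, hs2, hγ2]; field_simp
  set Θ := Theta γ with hΘ
  have hΘ0 : 0 ≤ Θ := Theta_nonneg hγ0.le
  have hΘ1 : Θ < 1 := Theta_lt_one hγ0.le
  have h1Θ : 0 < 1 - Θ := by linarith
  -- The first two bounds meet the conditions of `exists_robin_almost_minimizer` and keep the trace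
  -- bounded below; the third makes the error `sδN` smaller than the saving `|u(0)|² A/(4g)`.
  set δ := min (1 / 4) (min ((1 - Θ) / 4) ((1 - Θ) * A / (32 * g * s))) with hδ
  have hδ0 : 0 < δ := by rw [hδ]; positivity
  have hδ1 : δ ≤ 1 / 4 := min_le_left _ _
  have hδ2 : δ ≤ (1 - Θ) / 4 := (min_le_right _ _).trans (min_le_left _ _)
  have hδ3 : δ ≤ (1 - Θ) * A / (32 * g * s) := (min_le_right _ _).trans (min_le_right _ _)
  obtain ⟨ξ, u, v, hL, hM, hγξ, hξ2, hQ⟩ :=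
    exists_robin_almost_minimizer hγ0.le hδ0 (by linarith) (by linarith : Theta γ + δ < 1)
  have hlow := hL.le_halfEnergy ξ
  rw [← hΘ] at hξ2 hQ
  set N := halfMass u
  set p := ‖u 0‖ ^ 2 with hp
  have hp0 : 0 ≤ p := sq_nonneg _
  -- The upper bound on the Robin form is combined with `le_halfEnergy`. Since `ξ - γ` is bounded,
  -- the trace controls the mass.
  have hp1 : (1 - Θ - δ) * N ≤ (ξ - γ) * p := by linarith
  -- Indeed `(ξ - γ)² ≤ ξ² - γ² ≤ Θ + 1/2 < 2`.
  have hξγ : ξ - γ ≤ 2 := by nlinarith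
  have hp2 : (1 - Θ) / 4 * N < p := by nlinarith [mul_pos h1Θ hM, mul_le_mul_of_nonneg_right hδ2 hM.le]
  obtain ⟨w, z, hB, hmass, hen⟩ := exists_memB1_glue hs0 hsa ξ hL
    (isHalfLine_exp (u 0) hg0) (by simp)
  rw [halfMass_exp _ hg0] at hmass
  rw [halfEnergy_exp _ hg0] at hen
  refine ⟨-(s * ξ), neg_lt_zero.mpr (mul_pos hs0 (hγ0.trans hγξ)), ?_⟩
  have hmu := mu_le_of_memB1 ha (-(s * ξ)) hB
  have hw0 : 0 < ∫ t, ‖w t‖ ^ 2 := by rw [hmass]; positivity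
  rw [← mul_lt_mul_iff_of_pos_right hw0]
  refine hmu.trans_lt ?_
  rw [hen, hmass, ← hp]
  set x := s * ξ with hx
  have hgx : g < x := by rw [hg, hx]; exact mul_lt_mul_of_pos_left hγξ hs0
  have hx2 : x ^ 2 ≤ A * Θ + g ^ 2 + A / 2 := by
    rw [hx, hg, mul_pow, mul_pow, hs2]; nlinarith
  have hbr := trial_energy_le hg0 hg2 hgx.le hx2
  -- The Robin term supplies `-g p`, which meets the `g p` of the right half-line; only `-p A/(4g)`
  -- and the error `sδN` remain.
  have hen2 : s * halfEnergy ξ u v ≤ A * Θ * (s⁻¹ * N) + s * δ * N - g * p := by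
    have e : A * Θ * (s⁻¹ * N) = s * (Θ * N) := by rw [← hs2]; field_simp
    rw [e, hg]
    linarith [mul_le_mul_of_nonneg_left hQ hs0.le]
  have hfin : s * δ * N < p * (A / (4 * g)) := by
    rw [le_div_iff₀ (by positivity)] at hδ3
    rw [← mul_div_assoc, lt_div_iff₀ (by positivity)]
    have f1 := mul_le_mul_of_nonneg_right hδ3 hM.le
    have f2 := mul_lt_mul_of_pos_right hp2 hA0
    have f3 := mul_pos (mul_pos h1Θ hA0) hM
    linarith
  have hpm := mul_le_mul_of_nonneg_left hbr hp0
  have e : A * Θ * (s⁻¹ * N + p / (2 * g)) = A * Θ * (s⁻¹ * N) + p * (A * Θ / (2 * g)) := by ring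
  rw [e]
  linarith

/-! ### Product functions in the plane -/

section Product

lemma memLp_prod_mul {f k : ℝ → ℂ} (hf : MemLp f 2 volume) (hk : MemLp k 2 volume) :
    MemLp (fun x : ℝ × ℝ => f x.1 * k x.2) 2 volume := by
  have hm : AEStronglyMeasurable (fun x : ℝ × ℝ => f x.1 * k x.2) volume :=
    hf.aestronglyMeasurable.comp_fst.mul hk.aestronglyMeasurable.comp_snd
  rw [memLp_two_iff_integrable_sq_norm hm]
  simp only [norm_mul, mul_pow]
  exact (hf.integrable_norm_pow two_ne_zero).mul_prod (hk.integrable_norm_pow two_ne_zero)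

lemma IsTest.slice_left {φ : ℝ × ℝ → ℂ} (h : IsTest φ) (y : ℝ) : IsTest (fun x => φ (x, y)) :=
  ⟨h.contDiff.comp (contDiff_id.prodMk contDiff_const),
    h.hasCompactSupport.comp_isClosedEmbedding (Function.LeftInverse.isClosedEmbedding
      (f := Prod.fst) (fun _ => rfl) continuous_fst (by fun_prop))⟩

lemma IsTest.slice_right {φ : ℝ × ℝ → ℂ} (h : IsTest φ) (x : ℝ) : IsTest (fun y => φ (x, y)) :=
  ⟨h.contDiff.comp (contDiff_const.prodMk contDiff_id),
    h.hasCompactSupport.comp_isClosedEmbedding (Function.LeftInverse.isClosedEmbedding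
      (f := Prod.snd) (fun _ => rfl) continuous_snd (by fun_prop))⟩

lemma IsTest.fderiv_slice_left {φ : ℝ × ℝ → ℂ} (h : IsTest φ) (x y : ℝ) :
    fderiv ℝ (fun x => φ (x, y)) x 1 = fderiv ℝ φ (x, y) (1, 0) := by
  have h1 : HasFDerivAt (fun x : ℝ => (x, y)) (ContinuousLinearMap.inl ℝ ℝ ℝ) x :=
    hasFDerivAt_prodMk_left x y
  have h2 := ((h.contDiff.differentiable (by simp)) (x, y)).hasFDerivAt.comp x h1
  have h3 : fderiv ℝ (fun x => φ (x, y)) x = _ := h2.fderiv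
  rw [h3]
  simp

lemma IsTest.fderiv_slice_right {φ : ℝ × ℝ → ℂ} (h : IsTest φ) (x y : ℝ) :
    fderiv ℝ (fun y => φ (x, y)) y 1 = fderiv ℝ φ (x, y) (0, 1) := by
  have h1 : HasFDerivAt (fun y : ℝ => (x, y)) (ContinuousLinearMap.inr ℝ ℝ ℝ) y :=
    hasFDerivAt_prodMk_right x y
  have h2 := ((h.contDiff.differentiable (by simp)) (x, y)).hasFDerivAt.comp y h1
  have h3 : fderiv ℝ (fun y => φ (x, y)) y = _ := h2.fderiv
  rw [h3]
  simp

/-- Fubini's theorem reduces the claim to the weak derivative of `f`, tested with the slices of `φ`.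
-/
lemma hasWeakDerivOn_prod_left {f f' k : ℝ → ℂ} (h : HasWeakDerivOn univ (1 : ℝ) f f')
    (hf : MemLp f 2 volume) (hf' : MemLp f' 2 volume) (hk : MemLp k 2 volume) :
    HasWeakDerivOn univ ((1, 0) : ℝ × ℝ) (fun x => f x.1 * k x.2) (fun x => f' x.1 * k x.2) := by
  intro φ h1 h2 _
  have hφ : IsTest φ := ⟨h1, h2⟩
  have i1 := (memLp_prod_mul hf hk).integrable_mul (hφ.memLp_deriv (μ := volume) (1, 0))
  have i2 := (memLp_prod_mul hf' hk).integrable_mul (hφ.memLp (μ := volume))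
  rw [Measure.volume_eq_prod] at i1 i2 ⊢
  have e1 := integral_prod_symm _ i1
  have e2 := integral_prod_symm _ i2
  simp only [Pi.mul_apply] at e1 e2
  rw [e1, e2, ← integral_neg]
  congr 1; ext y
  have hs := hφ.slice_left y
  have := h _ hs.contDiff hs.hasCompactSupport (subset_univ _)
  simp only [hφ.fderiv_slice_left] at this
  calc ∫ x, f x * k y * fderiv ℝ φ (x, y) (1, 0) = k y * ∫ x, f x * fderiv ℝ φ (x, y) (1, 0) := by
        rw [← integral_const_mul]; congr 1; ext x; ring
    _ = -∫ x, f' x * k y * φ (x, y) := by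
        rw [this, mul_neg, ← integral_const_mul]; congr 2; ext x; ring

lemma hasWeakDerivOn_prod_right {f k k' : ℝ → ℂ} (h : HasWeakDerivOn univ (1 : ℝ) k k')
    (hf : MemLp f 2 volume) (hk : MemLp k 2 volume) (hk' : MemLp k' 2 volume) :
    HasWeakDerivOn univ ((0, 1) : ℝ × ℝ) (fun x => f x.1 * k x.2) (fun x => f x.1 * k' x.2) := by
  intro φ h1 h2 _
  have hφ : IsTest φ := ⟨h1, h2⟩
  have i1 := (memLp_prod_mul hf hk).integrable_mul (hφ.memLp_deriv (μ := volume) (0, 1))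
  have i2 := (memLp_prod_mul hf hk').integrable_mul (hφ.memLp (μ := volume))
  rw [Measure.volume_eq_prod] at i1 i2 ⊢
  have e1 := integral_prod _ i1
  have e2 := integral_prod _ i2
  simp only [Pi.mul_apply] at e1 e2
  rw [e1, e2, ← integral_neg]
  congr 1; ext x
  have hs := hφ.slice_right x
  have := h _ hs.contDiff hs.hasCompactSupport (subset_univ _)
  simp only [hφ.fderiv_slice_right] at this
  calc ∫ y, f x * k y * fderiv ℝ φ (x, y) (0, 1) = f x * ∫ y, k y * fderiv ℝ φ (x, y) (0, 1) := by
        rw [← integral_const_mul]; congr 1; ext y; ring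
    _ = -∫ y, f x * k' y * φ (x, y) := by
        rw [this, mul_neg, ← integral_const_mul]; congr 2; ext y; ring

end Product

/-! ### The magnetic form and wave packets -/

section MagneticForm

lemma continuous_ramp_snd (a : ℝ) :
    Continuous (fun x : ℝ × ℝ => Complex.I * ((ramp a x.2 : ℝ) : ℂ)) :=
  continuous_const.mul (Complex.continuous_ofReal.comp ((continuous_ramp a).comp continuous_snd))

lemma IsTest.memLp_magnetic (a : ℝ) {φ : ℝ × ℝ → ℂ} (h : IsTest φ) :
    MemLp (fun x => fderiv ℝ φ x (1, 0) - Complex.I * ((ramp a x.2 : ℝ) : ℂ) * φ x) 2 volume :=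
  (h.memLp_deriv (1, 0)).sub (h.memLp_mul (continuous_ramp_snd a))

/-- The form domain of `𝓛_a`: triples of a function and its magnetic gradient. -/
noncomputable def magSpace (a : ℝ) : Submodule ℂ (Triple L2Plane) :=
  (Submodule.span ℂ ({s | ∃ (φ : ℝ × ℝ → ℂ) (h : IsTest φ),
      s = triple ((h.memLp_magnetic a).star.toLp _) (h.memLp.star.toLp _) 0} ∪
    {s | ∃ (φ : ℝ × ℝ → ℂ) (h : IsTest φ),
      s = triple ((h.memLp_deriv (0, 1)).star.toLp _) 0 (h.memLp.star.toLp _)}))ᗮ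

instance (a : ℝ) : CompleteSpace (magSpace a) :=
  (Submodule.isClosed_orthogonal _).completeSpace_coe

/-- Both families encode weak equations. The magnetic potential is moved onto the test function, so
that every pairing involves only square integrable functions. -/
lemma mem_magSpace_iff (a : ℝ) (u p d : L2Plane) :
    triple u p d ∈ magSpace a ↔ IsMagGrad a u p d := by
  have key1 : ∀ (φ : ℝ × ℝ → ℂ) (h : IsTest φ), inner ℂ
      (triple ((h.memLp_magnetic a).star.toLp _) (h.memLp.star.toLp _) (0 : L2Plane))
      (triple u p d) = (∫ x, u x * fderiv ℝ φ x (1, 0)) +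
        ∫ x, (p x - Complex.I * ((sigma a x * x.2 : ℝ) : ℂ) * u x) * φ x := fun φ h => by
    rw [inner_triple, inner_toLp_star (h.memLp_magnetic a), inner_toLp_star h.memLp,
      inner_zero_left, add_zero]
    have i1 := (Lp.memLp u).integrable_mul (h.memLp_deriv (μ := volume) (1, 0))
    have i2 := (Lp.memLp u).integrable_mul (h.memLp_mul (μ := volume) (continuous_ramp_snd a))
    have i3 := (Lp.memLp p).integrable_mul (h.memLp (μ := volume))
    have e1 : ∫ x, u x * (fderiv ℝ φ x (1, 0) - Complex.I * ((ramp a x.2 : ℝ) : ℂ) * φ x) =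
        (∫ x, u x * fderiv ℝ φ x (1, 0)) -
          ∫ x, u x * (Complex.I * ((ramp a x.2 : ℝ) : ℂ) * φ x) := by
      rw [← integral_sub]
      · simp only [mul_sub]
      · exact i1
      · exact i2
    have e2 : ∫ x, (p x - Complex.I * ((sigma a x * x.2 : ℝ) : ℂ) * u x) * φ x =
        (∫ x, p x * φ x) - ∫ x, u x * (Complex.I * ((ramp a x.2 : ℝ) : ℂ) * φ x) := by
      rw [← integral_sub]
      · congr 1; ext x; rw [sigma_mul]; ring
      · exact i3
      · exact i2
    rw [e1, e2]; ring
  have key2 : ∀ (φ : ℝ × ℝ → ℂ) (h : IsTest φ), inner ℂ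
      (triple ((h.memLp_deriv (0, 1)).star.toLp _) (0 : L2Plane) (h.memLp.star.toLp _))
      (triple u p d) = (∫ x, u x * fderiv ℝ φ x (0, 1)) + ∫ x, d x * φ x := fun φ h => by
    rw [inner_triple, inner_toLp_star (h.memLp_deriv (0, 1)), inner_toLp_star h.memLp,
      inner_zero_left, zero_add]
  rw [magSpace, mem_span_orthogonal_iff]
  constructor
  · intro h
    refine ⟨fun φ h1 h2 _ => ?_, fun φ h1 h2 _ => ?_⟩
    · have := h _ (Or.inl ⟨φ, ⟨h1, h2⟩, rfl⟩)
      rw [key1 φ ⟨h1, h2⟩] at this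
      exact eq_neg_of_add_eq_zero_left this
    · have := h _ (Or.inr ⟨φ, ⟨h1, h2⟩, rfl⟩)
      rw [key2 φ ⟨h1, h2⟩] at this
      exact eq_neg_of_add_eq_zero_left this
  · rintro ⟨h1, h2⟩ s (⟨φ, h, rfl⟩ | ⟨φ, h, rfl⟩)
    · rw [key1 φ h, h1 φ h.contDiff h.hasCompactSupport (subset_univ _), neg_add_cancel]
    · rw [key2 φ h, h2 φ h.contDiff h.hasCompactSupport (subset_univ _), neg_add_cancel]

lemma magneticOp_eq (a : ℝ) : magneticOp a = formOp (magSpace a) := by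
  simp only [magneticOp, formOp, mem_magSpace_iff]

end MagneticForm

section Trial

/-- A Gaussian wave packet of frequency `ζ` and width `1 / ε`. -/
noncomputable def packet (ε ζ t : ℝ) : ℂ := gauss (ε * t) * Complex.exp (ζ * t * Complex.I)

lemma norm_packet (ε ζ t : ℝ) : ‖packet ε ζ t‖ = ‖gauss (ε * t)‖ := by
  rw [packet, norm_mul, ← Complex.ofReal_mul, Complex.norm_exp_ofReal_mul_I, mul_one]

lemma hasDerivAt_packet (ε ζ t : ℝ) : HasDerivAt (packet ε ζ)
    ((-((ε ^ 2 * t : ℝ) : ℂ) + ζ * Complex.I) * packet ε ζ t) t := by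
  have h1 : HasDerivAt (fun t : ℝ => gauss (ε * t)) ((ε : ℂ) * (-((ε * t : ℝ) : ℂ) * gauss (ε * t))) t := by
    have := (hasDerivAt_gauss (ε * t)).scomp t ((hasDerivAt_id t).const_mul ε)
    simpa using! this
  have h2 : HasDerivAt (fun t : ℝ => Complex.exp (ζ * t * Complex.I))
      (Complex.exp (ζ * t * Complex.I) * (ζ * Complex.I)) t := by
    have := (((hasDerivAt_id t).ofReal_comp.const_mul (ζ : ℂ)).mul_const Complex.I).cexp
    simpa using this
  refine (h1.mul h2).congr_deriv ?_
  simp only [packet]; push_cast; ring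

lemma continuous_packet (ε ζ : ℝ) : Continuous (packet ε ζ) :=
  continuous_iff_continuousAt.mpr fun t => (hasDerivAt_packet ε ζ t).continuousAt

lemma memLp_packet {ε : ℝ} (hε : ε ≠ 0) (ζ : ℝ) : MemLp (packet ε ζ) 2 volume := by
  have h := memLp_comp_affine hε 0 (S := univ) (f := gauss) (by simpa using memLp_gauss)
  simp only [preimage_univ, Measure.restrict_univ, add_zero] at h
  exact h.of_le (continuous_packet ε ζ).aestronglyMeasurable
    (ae_of_all _ fun t => (norm_packet ε ζ t).le)

lemma memLp_mul_packet {ε : ℝ} (hε : ε ≠ 0) (ζ : ℝ) :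
    MemLp (fun t : ℝ => (t : ℂ) * packet ε ζ t) 2 volume := by
  have h := memLp_mul_comp_affine hε 0 (S := univ) (f := gauss) (by simpa using memLp_gauss)
    (by simpa using memLp_mul_gauss)
  simp only [preimage_univ, Measure.restrict_univ, add_zero] at h
  refine h.of_le ((Complex.continuous_ofReal.mul (continuous_packet ε ζ)).aestronglyMeasurable)
    (ae_of_all _ fun t => ?_)
  rw [norm_mul, norm_mul, norm_packet]

lemma integral_packet_sq {ε : ℝ} (hε : 0 < ε) (ζ : ℝ) :
    ∫ t, ‖packet ε ζ t‖ ^ 2 = ε⁻¹ * ∫ t, ‖gauss t‖ ^ 2 := by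
  simp only [norm_packet]
  rw [Measure.integral_comp_mul_left (fun t => ‖gauss t‖ ^ 2) ε, abs_inv, abs_of_pos hε, smul_eq_mul]

lemma integral_sq_mul_packet_sq {ε : ℝ} (hε : 0 < ε) (ζ : ℝ) :
    ε ^ 2 * ∫ t, t ^ 2 * ‖packet ε ζ t‖ ^ 2 = ε⁻¹ * ∫ t, t ^ 2 * ‖gauss t‖ ^ 2 := by
  have h := Measure.integral_comp_mul_left (fun t => t ^ 2 * ‖gauss t‖ ^ 2) ε
  rw [abs_inv, abs_of_pos hε, smul_eq_mul] at h
  rw [← h, ← integral_const_mul]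
  congr 1; ext t
  rw [norm_packet]; ring

lemma hasWeakDerivOn_packet (ε ζ : ℝ) : HasWeakDerivOn univ (1 : ℝ) (packet ε ζ)
    (fun t => (-((ε ^ 2 * t : ℝ) : ℂ) + ζ * Complex.I) * packet ε ζ t) := by
  have hc : Continuous (fun t : ℝ => (-((ε ^ 2 * t : ℝ) : ℂ) + ζ * Complex.I) * packet ε ζ t) :=
    (by fun_prop : Continuous fun t : ℝ => -((ε ^ 2 * t : ℝ) : ℂ) + ζ * Complex.I).mul
      (continuous_packet ε ζ)
  exact (IsPrim.of_hasDerivAt hc.continuousOn ordConnected_univ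
    fun t _ => hasDerivAt_packet ε ζ t).hasWeakDerivOn ordConnected_univ isOpen_univ
      (subset_univ _)

lemma integral_prod_norm_sq (f k : ℝ → ℝ) :
    ∫ x : ℝ × ℝ, f x.1 * k x.2 = (∫ t, f t) * ∫ t, k t := by
  rw [Measure.volume_eq_prod, integral_prod_mul]

/-- Wave packets transplant the quotients of the fiber operators to the plane. -/
lemma exists_mem_formQuotients_magSpace {a : ℝ} (ha : a ∈ Ioo (-1 : ℝ) 0) {ζ r : ℝ}
    (hr : r ∈ fiberQuotients a ζ) {ε : ℝ} (hε : 0 < ε) :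
    r + ε ^ 2 * ((∫ t, t ^ 2 * ‖gauss t‖ ^ 2) / ∫ t, ‖gauss t‖ ^ 2) ∈
      formQuotients (magSpace a) := by
  obtain ⟨u, v, hB, hN, rfl⟩ := hr
  have hu : MemLp u 2 volume := by simpa using hB.memLp
  have hv : MemLp v 2 volume := by simpa using hB.memLp_deriv
  have htu : MemLp (fun t : ℝ => (t : ℂ) * u t) 2 volume := by simpa using hB.memLp_mul
  have ha1 : |a| ≤ 1 := abs_le.mpr ⟨ha.1.le, ha.2.le.trans zero_le_one⟩
  have hru : MemLp (fun t : ℝ => Complex.I * ((ramp a t : ℝ) : ℂ) * u t) 2 volume := by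
    refine htu.of_le ((continuous_const.mul (Complex.continuous_ofReal.comp
      (continuous_ramp a))).aestronglyMeasurable.mul hu.aestronglyMeasurable)
      (ae_of_all _ fun t => ?_)
    rw [norm_mul, norm_mul, norm_mul, Complex.norm_I, one_mul, Complex.norm_real, Complex.norm_real]
    exact mul_le_mul_of_nonneg_right (abs_ramp_le ha1 t) (norm_nonneg _)
  set f := packet ε ζ with hf
  set f' : ℝ → ℂ := fun t => (-((ε ^ 2 * t : ℝ) : ℂ) + ζ * Complex.I) * f t with hf'
  have mf : MemLp f 2 volume := memLp_packet hε.ne' ζ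
  have mtf : MemLp (fun t : ℝ => (t : ℂ) * f t) 2 volume := memLp_mul_packet hε.ne' ζ
  have mf' : MemLp f' 2 volume := by
    refine ((mtf.const_mul (-(ε ^ 2 : ℝ) : ℂ)).add (mf.const_mul (ζ * Complex.I))).ae_eq
      (ae_of_all _ fun t => ?_)
    simp only [Pi.add_apply, hf']; push_cast; ring
  have mU := memLp_prod_mul mf hu
  have mD := memLp_prod_mul mf hv
  have mP := (memLp_prod_mul mf' hu).add (memLp_prod_mul mf hru)
  have w1 := hasWeakDerivOn_prod_left (hasWeakDerivOn_packet ε ζ) mf mf' hu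
  have w2 := hasWeakDerivOn_prod_right hB.weakDeriv mf hu hv
  have hK : triple (mU.toLp _) (mP.toLp _) (mD.toLp _) ∈ magSpace a := by
    rw [mem_magSpace_iff]
    refine ⟨w1.congr mU.coeFn_toLp.symm ?_, w2.congr mU.coeFn_toLp.symm mD.coeFn_toLp.symm⟩
    filter_upwards [mU.coeFn_toLp, mP.coeFn_toLp] with x e1 e2
    rw [e1, e2, sigma_mul]
    simp only [Pi.add_apply]; ring
  have i1 := mf.integrable_norm_pow two_ne_zero
  obtain ⟨j1, j2, j3⟩ := hB.integrable_fiber ha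
  have i2 : Integrable (fun t => t ^ 2 * ‖f t‖ ^ 2) := by
    refine (mtf.integrable_norm_pow two_ne_zero).congr (ae_of_all _ fun t => ?_)
    simp only
    rw [norm_mul, mul_pow, Complex.norm_real, Real.norm_eq_abs, sq_abs]
  set F := ∫ t, ‖f t‖ ^ 2 with hF
  set T := ∫ t, t ^ 2 * ‖f t‖ ^ 2 with hT
  set N := ∫ t, ‖u t‖ ^ 2 with hNdef
  have nU : ‖mU.toLp _‖ ^ 2 = F * N := by
    rw [norm_sq_toLp]
    simp only [norm_mul, mul_pow]
    exact integral_prod_norm_sq (fun t => ‖f t‖ ^ 2) (fun t => ‖u t‖ ^ 2)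
  have nD : ‖mD.toLp _‖ ^ 2 = F * ∫ t, ‖v t‖ ^ 2 := by
    rw [norm_sq_toLp]
    simp only [norm_mul, mul_pow]
    exact integral_prod_norm_sq (fun t => ‖f t‖ ^ 2) (fun t => ‖v t‖ ^ 2)
  have nP : ‖mP.toLp _‖ ^ 2 = ε ^ 4 * T * N + F * ∫ t, V a ζ t * ‖u t‖ ^ 2 := by
    rw [norm_sq_toLp]
    have e : ∀ x : ℝ × ℝ, ‖((fun x : ℝ × ℝ => f' x.1 * u x.2) +
        fun x : ℝ × ℝ => f x.1 * (Complex.I * ((ramp a x.2 : ℝ) : ℂ) * u x.2)) x‖ ^ 2 =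
        ε ^ 4 * ((x.1 ^ 2 * ‖f x.1‖ ^ 2) * ‖u x.2‖ ^ 2) +
          ‖f x.1‖ ^ 2 * (V a ζ x.2 * ‖u x.2‖ ^ 2) := by
      intro x
      -- After factoring out `f u`, the envelope derivative is real and `ζ + σx₂` is the imaginary
      -- part. The squared modulus has no cross term.
      have e1 : ((fun x : ℝ × ℝ => f' x.1 * u x.2) +
          fun x : ℝ × ℝ => f x.1 * (Complex.I * ((ramp a x.2 : ℝ) : ℂ) * u x.2)) x =
          (((-(ε ^ 2 * x.1) : ℝ) : ℂ) + ((ζ + ramp a x.2 : ℝ) : ℂ) * Complex.I) *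
            (f x.1 * u x.2) := by
        simp only [Pi.add_apply, hf']; push_cast; ring
      rw [e1, norm_mul, mul_pow, norm_mul, mul_pow, ← Complex.normSq_eq_norm_sq,
        Complex.normSq_add_mul_I, V_eq]
      ring
    simp only [e]
    have k1 : Integrable (fun x : ℝ × ℝ => x.1 ^ 2 * ‖f x.1‖ ^ 2 * ‖u x.2‖ ^ 2) := i2.mul_prod j1
    have k2 : Integrable (fun x : ℝ × ℝ => ‖f x.1‖ ^ 2 * (V a ζ x.2 * ‖u x.2‖ ^ 2)) :=
      i1.mul_prod (j3 ζ)
    rw [integral_add (k1.const_mul _) k2, integral_const_mul,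
      integral_prod_norm_sq (fun t => t ^ 2 * ‖f t‖ ^ 2) (fun t => ‖u t‖ ^ 2),
      integral_prod_norm_sq (fun t => ‖f t‖ ^ 2) (fun t => V a ζ t * ‖u t‖ ^ 2)]
    ring
  have hG : 0 < ∫ t, ‖gauss t‖ ^ 2 := by
    simp only [norm_gauss_sq]
    rw [integral_gaussian]; positivity
  have hFG : F = ε⁻¹ * ∫ t, ‖gauss t‖ ^ 2 := integral_packet_sq hε ζ
  have hTG : ε ^ 2 * T = ε⁻¹ * ∫ t, t ^ 2 * ‖gauss t‖ ^ 2 := integral_sq_mul_packet_sq hε ζ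
  have hF0 : 0 < F := by rw [hFG]; positivity
  refine ⟨_, _, _, hK, fun h => ?_, ?_⟩
  · rw [h, norm_zero] at nU
    have : 0 < F * N := mul_pos hF0 hN
    rw [← nU] at this
    simp at this
  · rw [nU, nD, nP, integral_add j2 (j3 ζ)]
    have e1 : ε ^ 4 * T = ε ^ 2 * (ε⁻¹ * ∫ t, t ^ 2 * ‖gauss t‖ ^ 2) := by rw [← hTG]; ring
    rw [e1, hFG]
    field_simp
    ring

/-- As the packet widens, `ε → 0` brings the planar quotient down to `μ_a(ζ)`, and some spectral
point lies at or below each quotient. -/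
lemma exists_mem_realSpectrum_lt {a : ℝ} (ha : a ∈ Ioo (-1 : ℝ) 0) {ζ c : ℝ} (h : mu a ζ < c) :
    ∃ s ∈ realSpectrum (magneticOp a), s < c := by
  set C := (∫ t, t ^ 2 * ‖gauss t‖ ^ 2) / ∫ t, ‖gauss t‖ ^ 2
  have ht : Tendsto (fun ε : ℝ => mu a ζ + ε ^ 2 * C) (𝓝[>] 0) (𝓝 (mu a ζ)) := by
    have : Continuous (fun ε : ℝ => mu a ζ + ε ^ 2 * C) := by fun_prop
    have h0 := (this.tendsto 0).mono_left (nhdsWithin_le_nhds (s := Ioi 0))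
    simpa using h0
  obtain ⟨ε, h1, h2⟩ := ((ht.eventually_lt_const h).and self_mem_nhdsWithin).exists
  obtain ⟨s, hs, hsle⟩ := exists_mem_realSpectrum_formOp_le (magSpace a)
    (exists_mem_formQuotients_magSpace ha (isEigenvalue_mu ha ζ).1.1 h2)
  rw [magneticOp_eq]
  exact ⟨s, hs, hsle.trans_lt h1⟩

end Trial

lemma nonneg_of_mem_realSpectrum_magneticOp {a r : ℝ} (hr : r ∈ realSpectrum (magneticOp a)) :
    0 ≤ r := by
  rw [magneticOp_eq] at hr
  exact nonneg_of_mem_realSpectrum_formOp (magSpace a) hr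

end StepField

theorem theorem2p7 (a : ℝ) (ha : a ∈ Set.Ioo (-1 : ℝ) 0) :
    -- `μ_a(ξ)` is the first eigenvalue of `𝔥_a[ξ]`
    (∀ ξ : ℝ, IsLeast {r : ℝ | StepField.IsEigenvalue (StepField.fiberOp a ξ) (r : ℂ)}
      (StepField.mu a ξ)) ∧
    -- it is below `|a|` for some negative `ξ`
    (∃ ξ : ℝ, ξ < 0 ∧ StepField.mu a ξ < |a|) ∧
    -- it has a global minimum, below `|a|` and below `|a| Θ(γ)`
    (∃ ζ : ℝ, (∀ ξ : ℝ, StepField.mu a ζ ≤ StepField.mu a ξ) ∧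
      StepField.mu a ζ < |a| ∧
      StepField.mu a ζ < |a| * StepField.Theta (Real.sqrt (1 / (2 * |a| * (1 - |a|))))) ∧
    -- the bottom `β_a` of the spectrum of `𝓛_a` obeys the same bound
    IsGLB (StepField.realSpectrum (StepField.magneticOp a)) (StepField.beta a) ∧
    StepField.beta a < |a| * StepField.Theta (Real.sqrt (1 / (2 * |a| * (1 - |a|)))) ∧
    |a| * StepField.Theta (Real.sqrt (1 / (2 * |a| * (1 - |a|)))) < |a| := by
  have hA : 0 < |a| := abs_pos.mpr ha.2.ne
  have hΘ : |a| * StepField.Theta (Real.sqrt (1 / (2 * |a| * (1 - |a|)))) < |a| :=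
    mul_lt_of_lt_one_right hA (StepField.Theta_lt_one (Real.sqrt_nonneg _))
  obtain ⟨ξ, hξ, hμ⟩ := StepField.exists_mu_lt ha
  obtain ⟨ζ, hζ⟩ := StepField.exists_forall_mu_le ha (hμ.trans hΘ)
  have hbdd : BddBelow (StepField.realSpectrum (StepField.magneticOp a)) :=
    ⟨0, fun r hr => StepField.nonneg_of_mem_realSpectrum_magneticOp hr⟩
  obtain ⟨s, hs, hlt⟩ := StepField.exists_mem_realSpectrum_lt ha hμ
  exact ⟨StepField.isLeast_isEigenvalue_mu ha, ⟨ξ, hξ, hμ.trans hΘ⟩,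
    ⟨ζ, hζ, (hζ ξ).trans_lt (hμ.trans hΘ), (hζ ξ).trans_lt hμ⟩,
    isGLB_csInf ⟨s, hs⟩ hbdd, (csInf_le hbdd hs).trans_lt hlt, hΘ⟩
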